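/- Let $h=(h_k)_{k\in\mathbb Z}$ be non-negative with $\|h\|_1=\sum_k h_k<\infty$, and let $(\beta_m)_{m\in\mathbb Z}$ be i.i.d. non-negative random variables (under the conditional law given the parameter vector $\xi$, which is fixed throughout). Let $\Lambda_\beta(t)=\log\mathbb E e^{t\beta_0}\in(-\infty,\infty]$. Put $\gamma_n=\sum_{m\in\mathbb Z}h_{n-m}\beta_m$; these are assumed to be well defined in the sense that $\prod_{|k|<M}\mathbb E e^{ith_k\beta_0}$ converges, as $M\to\infty$, for every $t\in\mathbb R$, to a continuous function of $t$. Let $1/A(s)=\gamma_n$ for $n-1\le s<n$, $n\ge 1$, and $A_\varepsilon(s)=A(s/\varepsilon)$, where $\varepsilon$ is restricted to $\varepsilon^{-1}\in\mathbb N$. Let $f\in L^2(0,1)$ be deterministic, $F(s)=\int_0^s f$, fix $x\in(0,1)$, and let $$\mathbf H=(F\mathbf 1_{(0,x)},\,F,\,\mathbf 1_{(0,x)},\,1),\qquad Z_\varepsilon=\int_0^1\frac{\mathbf H(s)}{A_\varepsilon(s)}\,ds\in\mathbb R^4,\qquad g(z)=-z_1+z_2\frac{z_3}{z_4}$$ (with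 $g(z)=-z_1$ if $z_4=0$). Define, with values in $(-\infty,\infty]$, $$\Lambda(\lambda)=\int_0^1\Lambda_\beta\bigl(\|h\|_1\,\lambda\cdot\mathbf H(s)\bigr)\,ds,\quad \lambda\in\mathbb R^4,\qquad \mathcal D_\Lambda=\{\lambda:\Lambda(\lambda)<\infty\},\qquad \Lambda^*(z)=\sup_{\lambda\in\mathbb R^4}[\lambda\cdot z-\Lambda(\lambda)].$$ (1) $\Lambda$ is convex and is $C^\infty$ in the interior $\mathcal D_\Lambda^\circ$; if $\Lambda_\beta$ is finite everywhere, then $\Lambda$ is finite everywhere and $\Lambda\in C^\infty(\mathbb R^4)$. (2) For every $\lambda\in\mathbb R^4$, $\lim_{\varepsilon\to0}\varepsilon\log\mathbb E\,e^{\varepsilon^{-1}\lambda\cdot Z_\varepsilon}=\Lambda(\lambda)$ in $(-\infty,\infty]$. (3) Suppose moreover that $\mathbb E\beta_0<\infty$ and that $\Lambda$ is steep, i.e. $|\nabla\Lambda(\lambda_j)|\to\infty$ for every sequence $(\lambda_j)$ in $\mathcal D_\Lambda^\circ$ that converges to a boundary point of $\mathcal D_\Lambda^\circ$. Then $Z_\varepsilon$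 satisfies, as $\varepsilon\to0$, a large deviation principle with the good convex rate function $\Lambda^*$; that is, $\Lambda^*:\mathbb R^4\to[0,\infty]$ is convex and lower semicontinuous with compact sub-level sets, and for all $\Gamma\subset\mathbb R^4$ $$-\inf_{\Gamma^\circ}\Lambda^*\le\liminf_{\varepsilon\to0}\varepsilon\log P[Z_\varepsilon\in\Gamma]\le\limsup_{\varepsilon\to0}\varepsilon\log P[Z_\varepsilon\in\Gamma]\le-\inf_{\overline\Gamma}\Lambda^*.$$ (4) Suppose, in addition to the assumptions of (3), that almost surely $\gamma_n>0$ for all $n$ (so that $A_\varepsilon$ is almost surely bounded and bounded away from $0$ on $(0,1)$), and let $u_\varepsilon$ be, almost surely, the weak solution in $H^1_0(0,1)$ of $-(A_\varepsilon u_\varepsilon')'=f$. Then $u_\varepsilon(x)=g(Z_\varepsilon)$ almost surely, and $u_\varepsilon(x)$ satisfies, as $\varepsilon\to0$, a large deviation principle in $\mathbb R$ with the good rate function $$I(\ell)=\inf_{z\in\mathbb R^4:\,g(z)=\ell}\Lambda^*(z).$$ If $P[\beta_0=0]=0$, the infimum may equivalently be restricted to those $z$ with $z_3>0$ and $z_4>0$.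 -/

import Mathlib

open MeasureTheory ProbabilityTheory Filter Topology Set
open scoped ENNReal

noncomputable section

namespace EllipticLDP

/-! ### Large deviations: extended-real-valued functions, rate functions, LDP -/

section LargeDeviations

variable {E : Type*} [NormedAddCommGroup E] [InnerProductSpace ℝ E]

/-- The logarithmic moment generating function `λ ↦ log 𝔼 exp (λ · Y)`, with values in
`[-∞, ∞]` (it is `+∞` where the exponential moment is infinite). -/
def logMGF {Ω : Type*} [MeasurableSpace Ω] (μ : Measure Ω) (Y : Ω → E) (l : E) : EReal :=
  ENNReal.log (∫⁻ ω, ENNReal.ofReal (Real.exp (inner ℝ l (Y ω))) ∂μ)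

/-- The Fenchel-Legendre transform `z ↦ sup_λ (λ · z - Λ(λ))`. -/
def legendre (L : E → EReal) (z : E) : EReal :=
  ⨆ l : E, (((inner ℝ l z : ℝ) : EReal) - L l)

/-- The effective domain `{x : L x < ∞}`. -/
def effDomain (L : E → EReal) : Set E := {x | L x < ⊤}

/-- Convexity of an extended-real-valued function: its epigraph is convex. -/
def IsConvexFun (L : E → EReal) : Prop :=
  Convex ℝ {p : E × ℝ | L p.1 ≤ (p.2 : EReal)}

/-- Steepness: the norm of the gradient tends to infinity along every sequence in the interior
of the effective domain that converges to a boundary point of this interior. -/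
def IsSteep [CompleteSpace E] (L : E → EReal) : Prop :=
  ∀ (y : E) (w : ℕ → E), y ∈ frontier (interior (effDomain L)) →
    (∀ j, w j ∈ interior (effDomain L)) → Tendsto w atTop (𝓝 y) →
    Tendsto (fun j => ‖gradient (fun l => (L l).toReal) (w j)‖) atTop atTop

/-- A good rate function: lower semicontinuous, with values in `[0, ∞]` and with compact
sub-level sets. -/
def IsGoodRateFunction (I : E → EReal) : Prop :=
  LowerSemicontinuous I ∧ (∀ y, 0 ≤ I y) ∧
    ∀ a : ℝ, 0 ≤ a → IsCompact {y | I y ≤ (a : EReal)}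

/-- The large deviation principle with rate function `I` for the random vectors `Y_ε`,
`ε = 1/N`, as `N → ∞` through the natural numbers. -/
def SatisfiesLDP {Ω : Type*} [MeasurableSpace Ω] (μ : Measure Ω) (Y : ℕ → Ω → E)
    (I : E → EReal) : Prop :=
  ∀ Γ : Set E,
    -(⨅ y ∈ interior Γ, I y) ≤
        liminf (fun N : ℕ => (((N : ℝ)⁻¹ : ℝ) : EReal) * ENNReal.log (μ {ω | Y N ω ∈ Γ})) atTop ∧
    limsup (fun N : ℕ => (((N : ℝ)⁻¹ : ℝ) : EReal) * ENNReal.log (μ {ω | Y N ω ∈ Γ})) atTop ≤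
        -(⨅ y ∈ closure Γ, I y)

end LargeDeviations

/-- The integral over `[0,1]` of an extended-real-valued function, as the integral of its
positive part minus the integral of its negative part. -/
def unitIntegral (φ : ℝ → EReal) : EReal :=
  ((∫⁻ s in Ioc (0 : ℝ) 1, (φ s).toENNReal : ℝ≥0∞) : EReal) -
    ((∫⁻ s in Ioc (0 : ℝ) 1, (-φ s).toENNReal : ℝ≥0∞) : EReal)

/-! ### The elliptic boundary value problem -/

/-- Test functions: smooth functions with compact support in the open interval `(0,1)`. -/
def IsTestFunction (φ : ℝ → ℝ) : Prop :=
  ContDiff ℝ ((⊤ : ℕ∞) : WithTop ℕ∞) φ ∧ HasCompactSupport φ ∧ tsupport φ ⊆ Ioo (0 : ℝ) 1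

/-- `u` is the continuous representative of a weak solution in `H^1_0(0,1)` of `-(a u')' = f`:
`v` is the weak derivative of `u`. -/
def IsWeakSolution (a f u : ℝ → ℝ) : Prop :=
  ContinuousOn u (Icc (0 : ℝ) 1) ∧ u 0 = 0 ∧ u 1 = 0 ∧
  ∃ v : ℝ → ℝ, MemLp v 2 (volume.restrict (Ioo (0 : ℝ) 1)) ∧
    (∀ φ, IsTestFunction φ →
      ∫ s in (0 : ℝ)..1, u s * deriv φ s = -∫ s in (0 : ℝ)..1, v s * φ s) ∧
    (∀ φ, IsTestFunction φ →
      ∫ s in (0 : ℝ)..1, a s * v s * deriv φ s = ∫ s in (0 : ℝ)..1, f s * φ s)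

/-! ### The convolved medium -/

/-- The convolved sequence `γ_n = ∑_m h_{n-m} β_m`. -/
def gam {Ω : Type*} (h : ℤ → ℝ) (β : ℤ → Ω → ℝ) (n : ℤ) (ω : Ω) : ℝ :=
  ∑' m : ℤ, h (n - m) * β m ω

/-- The reciprocal coefficient `1/A(s)`, equal to `γ_n` for `n - 1 ≤ s < n`. -/
def invA {Ω : Type*} (h : ℤ → ℝ) (β : ℤ → Ω → ℝ) (ω : Ω) (s : ℝ) : ℝ :=
  gam h β (⌊s⌋ + 1) ω

/-- The coefficient `A_ε(s) = A(s/ε)` for `ε = 1/N`. -/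
def coeffA {Ω : Type*} (h : ℤ → ℝ) (β : ℤ → Ω → ℝ) (N : ℕ) (ω : Ω) (s : ℝ) : ℝ :=
  (invA h β ω (N * s))⁻¹

/-- The condition for the `γ_n` to be well defined: the products
`∏_{|k| < M} 𝔼 exp (i t h_k β)` converge pointwise to a continuous function of `t`. -/
def HasContinuousLimitCharFun {Ω : Type*} [MeasurableSpace Ω] (μ : Measure Ω)
    (h : ℤ → ℝ) (b : Ω → ℝ) : Prop :=
  ∃ φ : ℝ → ℂ, Continuous φ ∧ ∀ t : ℝ,
    Tendsto (fun M : ℕ => ∏ k ∈ Finset.Ioo (-(M : ℤ)) (M : ℤ),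
      ∫ ω, Complex.exp (((t * h k * b ω : ℝ) : ℂ) * Complex.I) ∂μ) atTop (𝓝 (φ t))

/-- `F(s) = ∫_0^s f`. -/
def primitive (f : ℝ → ℝ) (s : ℝ) : ℝ := ∫ t in (0 : ℝ)..s, f t

/-- The vector function `H = (F 1_{(0,x)}, F, 1_{(0,x)}, 1)`. -/
def Hvec (f : ℝ → ℝ) (x s : ℝ) : EuclideanSpace ℝ (Fin 4) :=
  !₂[(Ioo 0 x).indicator (primitive f) s, primitive f s,
    (Ioo 0 x).indicator (fun _ => (1 : ℝ)) s, 1]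

/-- The vector `Z_ε = ∫_0^1 H(s) / A_ε(s) ds` for `ε = 1/N`. -/
def Zvec {Ω : Type*} (h : ℤ → ℝ) (β : ℤ → Ω → ℝ) (f : ℝ → ℝ) (x : ℝ) (N : ℕ) (ω : Ω) :
    EuclideanSpace ℝ (Fin 4) :=
  WithLp.toLp 2 (fun i => ∫ s in (0 : ℝ)..1, Hvec f x s i * invA h β ω (N * s))

/-- `Λ(λ) = ∫_0^1 Λ_β(‖h‖₁ λ · H(s)) ds`. -/
def limitLambda {Ω : Type*} [MeasurableSpace Ω] (μ : Measure Ω) (h : ℤ → ℝ) (b : Ω → ℝ)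
    (f : ℝ → ℝ) (x : ℝ) (l : EuclideanSpace ℝ (Fin 4)) : EReal :=
  unitIntegral (fun s => logMGF μ b ((∑' k : ℤ, h k) * inner ℝ l (Hvec f x s)))

/-- `g(z) = -z₁ + z₂ z₃ / z₄` (with value `-z₁` where `z₄ = 0`). -/
def gfun (z : EuclideanSpace ℝ (Fin 4)) : ℝ := -z 0 + z 1 * (z 2 / z 3)

/-- `ℓ ↦ inf {Λ*(z) : g(z) = ℓ}`. -/
def rateU (L : EuclideanSpace ℝ (Fin 4) → EReal) (y : ℝ) : EReal :=
  ⨅ z ∈ gfun ⁻¹' {y}, legendre L z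

end EllipticLDP

end

open EllipticLDP

/-!
The proof rests on three facts.

*The limiting logarithmic moment generating function.* Almost surely the series `γ_n` converge,
because the partial sums are monotone and their laws are tight (Lévy's continuity argument,
`ae_summable_gam`). Hence `N λ · Z_ε` is a series `∑_m c_m β_m` whose coefficients
`c_m = ∑_n h_{n-m} (average of λ · H over the n-th cell)` are close to `‖h‖₁ λ · H(m/N)`
(`mul_inner_Zvec`, `tendsto_cellWeight`), and by independence its exponential moment is
`∏_m 𝔼 exp (c_m β_0)`. For the upper bound, `c_m` is the integral of `‖h‖₁ λ · H` against a
sub-probability density; Jensen's inequality for the convex function `Λ_β` (`logMGF_integral_le`)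
and summation over `m` give `ε log 𝔼 exp (ε⁻¹ λ · Z_ε) ≤ Λ(λ)` for *every* `ε`
(`log_exp_cellWeight_le_avgLogMGF`). For the lower bound, the indices `m ∈ [1, N]` contribute a
Riemann-type integral to which Fatou's lemma and the lower semicontinuity of `Λ_β` apply; the
other indices contribute at least `∑_k Λ_β(-W h_k) · #{n ∈ [1, N] : n - k ∉ [1, N]}`, by
superadditivity of `Λ_β` on the negative half-line, and this is `o(N)` because
`∑_k Λ_β(-W h_k)` is, up to a bound, the logarithm of the positive number `𝔼 exp (-W γ_0)`
(`summable_neg_cgf`, `tendsto_boundary`, `avgLogMGF_le_liminf`).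

*The Gärtner-Ellis theorem* (`gartnerEllis`), proved here in a finite-dimensional inner product
space. The upper bound is a covering by half-spaces. For the lower bound at `z`, the function
`Λ(λ) - λ · z + δ |λ|² / 2` has a minimiser `η`; steepness forces `η` into the interior of the
effective domain (`exists_interior_maximizer`), so that `∇Λ(η) = z - δ η`, and the law tilted by
`η` concentrates at `∇Λ(η)`, which is near `z` for small `δ`. The theorem applies because `Λ` is
smooth in the interior of its domain (differentiation under the integral sign: at an interior
point the arguments `‖h‖₁ λ · H(s)` stay away from the end of the domain of `Λ_β`, since the last
component of `H` is `1`), and because steepness and a finite mean put `0` in that interior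
(`zero_mem_interior_effDomain`).

*The contraction principle and the explicit solution.* By the du Bois-Reymond lemma a weak solution
satisfies `A_ε u' = c - F`, which gives `u(x) = g(Z_ε)` (`IsWeakSolution.apply_eq_gfun`). The
function `g` is discontinuous on `ℝ⁴`, but `Z_ε` lies in a closed cone (`zCone`) on which `g` is
continuous and outside of which the rate function is infinite, and this suffices for the
contraction principle (`SatisfiesLDP.comp_continuousOn`). If `β_0` has no atom at `0`, then
`Λ_β(t) → -∞` as `t → -∞`, which makes `Λ*` infinite where `z₃ ≤ 0` or `z₄ ≤ 0`
(`legendre_eq_top_of_nonpos`).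
-/


namespace EllipticLDP

/-! ### Exponential growth rates and logarithmic moment generating functions -/

section GartnerEllis

set_option linter.unusedSectionVars false

open ExpGrowth

lemma inv_mul_log_eq_div (N : ℕ) (u : ℝ≥0∞) :
    (((N : ℝ)⁻¹ : ℝ) : EReal) * ENNReal.log u = ENNReal.log u / N := by
  rw [EReal.div_eq_inv_mul, EReal.coe_inv]
  simp

lemma expGrowth_ofReal_exp (r : ℝ) :
    expGrowthSup (fun N : ℕ => ENNReal.ofReal (Real.exp (N * r))) = (r : EReal) ∧
    expGrowthInf (fun N : ℕ => ENNReal.ofReal (Real.exp (N * r))) = (r : EReal) := by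
  have h : (fun N : ℕ => ENNReal.ofReal (Real.exp (N * r))) =
      fun N : ℕ => EReal.exp ((r : EReal) * N) := by
    funext N
    rw [mul_comm]
    have : (r : EReal) * (N : EReal) = ((r * N : ℝ) : EReal) := by
      rw [EReal.coe_mul]; simp
    rw [this, EReal.exp_coe]
  rw [h]
  exact ⟨expGrowthSup_exp, expGrowthInf_exp⟩

variable {Ω : Type*} [MeasurableSpace Ω] {μ : Measure Ω}
variable {E : Type*} [NormedAddCommGroup E] [InnerProductSpace ℝ E]

lemma satisfiesLDP_iff {Y : ℕ → Ω → E} {I : E → EReal} :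
    SatisfiesLDP μ Y I ↔ ∀ Γ : Set E,
      -(⨅ y ∈ interior Γ, I y) ≤ expGrowthInf (fun N => μ {ω | Y N ω ∈ Γ}) ∧
      expGrowthSup (fun N => μ {ω | Y N ω ∈ Γ}) ≤ -(⨅ y ∈ closure Γ, I y) := by
  simp only [SatisfiesLDP, inv_mul_log_eq_div]
  rfl

/-- A large deviation principle only sees the random vectors up to null sets, and only for
large indices. -/
lemma SatisfiesLDP.congr_ae {Y Y' : ℕ → Ω → E} {I : E → EReal} (h : SatisfiesLDP μ Y I)
    (hY : ∀ N : ℕ, 1 ≤ N → Y N =ᵐ[μ] Y' N) : SatisfiesLDP μ Y' I := by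
  rw [satisfiesLDP_iff] at h ⊢
  intro Γ
  have key : (fun N => μ {ω | Y N ω ∈ Γ}) =ᶠ[atTop] (fun N => μ {ω | Y' N ω ∈ Γ}) := by
    filter_upwards [eventually_ge_atTop 1] with N hN
    refine measure_congr ?_
    filter_upwards [hY N hN] with ω hω
    change (Y N ω ∈ Γ) = (Y' N ω ∈ Γ)
    rw [hω]
  rw [← expGrowthInf_congr key, ← expGrowthSup_congr key]
  exact h Γ

lemma logMGF_zero [IsProbabilityMeasure μ] (Y : Ω → E) : logMGF μ Y 0 = 0 := by
  simp [logMGF]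

lemma expGrowth_of_tendsto_logMGF {Y : ℕ → Ω → E} {l : E} {a : EReal}
    (h : Tendsto (fun N : ℕ => (((N : ℝ)⁻¹ : ℝ) : EReal) * logMGF μ (Y N) ((N : ℝ) • l)) atTop
      (𝓝 a)) :
    expGrowthSup (fun N : ℕ => ∫⁻ ω, ENNReal.ofReal (Real.exp (N * inner ℝ l (Y N ω))) ∂μ) = a ∧
    expGrowthInf (fun N : ℕ => ∫⁻ ω, ENNReal.ofReal (Real.exp (N * inner ℝ l (Y N ω))) ∂μ) = a := by
  simp only [logMGF, inv_mul_log_eq_div, real_inner_smul_left] at h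
  exact ⟨h.limsup_eq, h.liminf_eq⟩

section Basics

variable [MeasurableSpace E] [BorelSpace E] [SecondCountableTopology E]

/-- The exponential Chebyshev inequality for a half-space under exponential tilting. -/
lemma expGrowthSup_setLIntegral_halfSpace_le {Y : ℕ → Ω → E} (hY : ∀ N, Measurable (Y N))
    {L : E → EReal}
    (hlim : ∀ l, Tendsto (fun N : ℕ => (((N : ℝ)⁻¹ : ℝ) : EReal) * logMGF μ (Y N) ((N : ℝ) • l))
      atTop (𝓝 (L l))) (η θ : E) (r : ℝ) :
    expGrowthSup (fun N : ℕ => ∫⁻ ω in {ω | r ≤ inner ℝ θ (Y N ω)},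
      ENNReal.ofReal (Real.exp (N * inner ℝ η (Y N ω))) ∂μ) ≤ L (η + θ) - r := by
  have h1 : ∀ N : ℕ, (∫⁻ ω in {ω | r ≤ inner ℝ θ (Y N ω)},
      ENNReal.ofReal (Real.exp (N * inner ℝ η (Y N ω))) ∂μ) ≤
      ENNReal.ofReal (Real.exp (N * (-r))) *
        ∫⁻ ω, ENNReal.ofReal (Real.exp (N * inner ℝ (η + θ) (Y N ω))) ∂μ := by
    intro N
    have hm : Measurable fun ω => inner ℝ θ (Y N ω) := (measurable_const.inner (hY N))
    rw [← lintegral_const_mul' _ _ (by simp)]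
    refine (setLIntegral_mono' (measurableSet_le measurable_const hm) ?_).trans
      (setLIntegral_le_lintegral _ _)
    intro ω hω
    rw [← ENNReal.ofReal_mul (Real.exp_pos _).le, ← Real.exp_add]
    refine ENNReal.ofReal_le_ofReal (Real.exp_le_exp.mpr ?_)
    rw [inner_add_left]
    have : (0 : ℝ) ≤ N := N.cast_nonneg
    have hω' : r ≤ inner ℝ θ (Y N ω) := hω
    nlinarith
  refine (expGrowthSup_monotone h1).trans ?_
  have h2 := (expGrowth_ofReal_exp (-r)).1
  refine (expGrowthSup_mul_le (Or.inl ?_) (Or.inl ?_)).trans ?_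
  · rw [h2]; exact EReal.coe_ne_bot _
  · rw [h2]; exact EReal.coe_ne_top _
  · rw [h2, (expGrowth_of_tendsto_logMGF (hlim (η + θ))).1, add_comm, sub_eq_add_neg, EReal.coe_neg]

lemma expGrowthSup_halfSpace_le {Y : ℕ → Ω → E} (hY : ∀ N, Measurable (Y N))
    {L : E → EReal}
    (hlim : ∀ l, Tendsto (fun N : ℕ => (((N : ℝ)⁻¹ : ℝ) : EReal) * logMGF μ (Y N) ((N : ℝ) • l))
      atTop (𝓝 (L l))) (θ : E) (r : ℝ) :
    expGrowthSup (fun N : ℕ => μ {ω | r ≤ inner ℝ θ (Y N ω)}) ≤ L θ - r := by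
  simpa using expGrowthSup_setLIntegral_halfSpace_le hY hlim 0 θ r

end Basics

/-! ### Extended-real-valued convex functions -/

lemma IsConvexFun.le_combo {L : E → EReal} (hL : IsConvexFun L) {u v : E} {p q a b : ℝ}
    (hu : L u ≤ p) (hv : L v ≤ q) (ha : 0 ≤ a) (hb : 0 ≤ b) (hab : a + b = 1) :
    L (a • u + b • v) ≤ ((a * p + b * q : ℝ) : EReal) :=
  hL (x := (u, p)) (y := (v, q)) hu hv ha hb hab

lemma coe_toReal_of_mem_effDomain {L : E → EReal} (hbot : ∀ l, L l ≠ ⊥) {u : E}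
    (hu : u ∈ effDomain L) : ((L u).toReal : EReal) = L u :=
  EReal.coe_toReal (ne_of_lt hu) (hbot u)

lemma IsConvexFun.convexOn_toReal {L : E → EReal} (hL : IsConvexFun L) (hbot : ∀ l, L l ≠ ⊥) :
    ConvexOn ℝ (effDomain L) (fun l => (L l).toReal) := by
  have key : ∀ u ∈ effDomain L, ∀ v ∈ effDomain L, ∀ a b : ℝ, 0 ≤ a → 0 ≤ b → a + b = 1 →
      L (a • u + b • v) ≤ ((a * (L u).toReal + b * (L v).toReal : ℝ) : EReal) :=
    fun u hu v hv a b ha hb hab => hL.le_combo (coe_toReal_of_mem_effDomain hbot hu).ge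
      (coe_toReal_of_mem_effDomain hbot hv).ge ha hb hab
  have hc : Convex ℝ (effDomain L) := fun u hu v hv a b ha hb hab =>
    (key u hu v hv a b ha hb hab).trans_lt (EReal.coe_lt_top _)
  refine ⟨hc, fun u hu v hv a b ha hb hab => ?_⟩
  have := key u hu v hv a b ha hb hab
  rw [← coe_toReal_of_mem_effDomain hbot (hc hu hv ha hb hab)] at this
  exact_mod_cast this

/-- The graph of a convex function lies above its tangent plane. -/
lemma tangent_le_of_convexOn [CompleteSpace E] {D : Set E} {φ : E → ℝ} (hφ : ConvexOn ℝ D φ)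
    {η l : E} (hη : η ∈ D) (hl : l ∈ D) (hd : DifferentiableAt ℝ φ η) :
    φ η + inner ℝ (gradient φ η) (l - η) ≤ φ l := by
  have h1 : HasDerivAt (fun t : ℝ => φ (η + t • (l - η))) (inner ℝ (gradient φ η) (l - η)) 0 := by
    have hg := hd.hasGradientAt.hasFDerivAt
    have hline : HasDerivAt (fun t : ℝ => η + t • (l - η)) (l - η) 0 := by
      simpa using ((hasDerivAt_id (0 : ℝ)).smul_const (l - η)).const_add η
    have hg' : HasFDerivAt φ (InnerProductSpace.toDual ℝ E (gradient φ η))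
        (η + (0 : ℝ) • (l - η)) := by simpa using hg
    exact hg'.comp_hasDerivAt (0 : ℝ) hline
  have h2 := h1.tendsto_slope_zero_right
  refine le_of_forall_pos_le_add fun ε hε => ?_
  have h3 : ∀ᶠ t : ℝ in 𝓝[>] 0, t⁻¹ • (φ (η + (0 + t) • (l - η)) - φ (η + (0 : ℝ) • (l - η))) ≤
      φ l - φ η := by
    have : ∀ᶠ t : ℝ in 𝓝[>] 0, t ∈ Ioc (0 : ℝ) 1 := Ioc_mem_nhdsGT one_pos
    filter_upwards [this] with t ht
    have := hφ.2 hη hl (by linarith [ht.2] : (0 : ℝ) ≤ 1 - t) ht.1.le (by ring)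
    have e : η + (0 + t) • (l - η) = (1 - t) • η + t • l := by
      simp only [zero_add, smul_sub, sub_smul, one_smul]; abel
    rw [e, smul_eq_mul, inv_mul_le_iff₀ ht.1]
    simp only [smul_eq_mul, zero_smul, add_zero] at this ⊢
    linarith
  have := le_of_tendsto h2 h3
  linarith


/-! ### The Legendre transform as a rate function -/

lemma le_legendre (L : E → EReal) (l z : E) : ((inner ℝ l z : ℝ) : EReal) - L l ≤ legendre L z :=
  le_iSup (fun l : E => ((inner ℝ l z : ℝ) : EReal) - L l) l

lemma legendre_nonneg {L : E → EReal} (h0 : L 0 = 0) (z : E) : 0 ≤ legendre L z := by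
  simpa [h0] using le_legendre L 0 z

lemma legendre_le_coe_iff {L : E → EReal} (hbot : ∀ l, L l ≠ ⊥) {z : E} {a : ℝ} :
    legendre L z ≤ a ↔ ∀ l ∈ effDomain L, inner ℝ l z - (L l).toReal ≤ a := by
  rw [legendre, iSup_le_iff]
  refine forall_congr' fun l => ?_
  by_cases hl : l ∈ effDomain L
  · rw [← coe_toReal_of_mem_effDomain hbot hl]
    simp only [hl, true_imp_iff, EReal.toReal_coe]
    exact_mod_cast Iff.rfl
  · have : L l = ⊤ := by simpa [effDomain] using hl
    simp [hl, this]

lemma lowerSemicontinuous_of_isClosed_le_real {X : Type*} [TopologicalSpace X] {I : X → EReal}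
    (h : ∀ a : ℝ, IsClosed {y | I y ≤ (a : EReal)}) : LowerSemicontinuous I := by
  rw [lowerSemicontinuous_iff_isClosed_preimage]
  intro c
  have : I ⁻¹' Iic c = ⋂ (a : ℝ) (_ : c < a), {y | I y ≤ (a : EReal)} := by
    ext y
    simp only [mem_preimage, mem_Iic, mem_iInter, mem_ofPred_eq]
    refine ⟨fun hy a ha => hy.trans ha.le, fun hy => ?_⟩
    refine le_of_forall_gt_imp_ge_of_dense fun b hb => ?_
    obtain ⟨a, ha, ha'⟩ := EReal.lt_iff_exists_real_btwn.mp hb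
    exact (hy a ha).trans ha'.le
  rw [this]
  exact isClosed_iInter fun a => isClosed_iInter fun _ => h a

lemma isClosed_legendre_le {L : E → EReal} (hbot : ∀ l, L l ≠ ⊥) (a : ℝ) :
    IsClosed {z | legendre L z ≤ (a : EReal)} := by
  simp only [legendre_le_coe_iff hbot, ofPred_forall]
  refine isClosed_iInter fun l => isClosed_iInter fun _ => ?_
  exact isClosed_le (by fun_prop) continuous_const

lemma isConvexFun_legendre {L : E → EReal} (hbot : ∀ l, L l ≠ ⊥) : IsConvexFun (legendre L) := by
  rintro ⟨u, p⟩ hu ⟨v, q⟩ hv a b ha hb hab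
  simp only [mem_ofPred_eq, Prod.smul_mk, Prod.mk_add_mk, legendre_le_coe_iff hbot] at hu hv ⊢
  intro l hl
  have h1 := mul_le_mul_of_nonneg_left (hu l hl) ha
  have h2 := mul_le_mul_of_nonneg_left (hv l hl) hb
  rw [inner_add_right, inner_smul_right, inner_smul_right, smul_eq_mul, smul_eq_mul]
  have : (L l).toReal = a * (L l).toReal + b * (L l).toReal := by rw [← add_mul, hab, one_mul]
  linarith

section FiniteDim

variable [FiniteDimensional ℝ E]

/-- Finitely many directions, taken from a neighbourhood `D` of the origin, suffice: every point far
from the origin has a large inner product with one of them. -/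
lemma exists_finset_directions {D : Set E} (h0 : (0 : E) ∈ interior D) :
    ∃ T : Finset E, (∀ l ∈ T, l ∈ D) ∧
      ∀ R : ℝ, ∃ S : ℝ, ∀ z : E, S < ‖z‖ → ∃ l ∈ T, R ≤ inner ℝ l z := by
  classical
  obtain ⟨ρ, hρ, hball⟩ := Metric.mem_nhds_iff.mp (mem_interior_iff_mem_nhds.mp h0)
  let e := stdOrthonormalBasis ℝ E
  let τ := ρ / 2
  have hτ : 0 < τ := half_pos hρ
  have hmem : ∀ s : ℝ, |s| = τ → ∀ i, s • e i ∈ D := by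
    intro s hs i
    refine hball ?_
    rw [mem_ball_zero_iff, norm_smul, e.norm_eq_one, Real.norm_eq_abs, hs, mul_one]
    exact half_lt_self hρ
  refine ⟨(Finset.univ.image fun i => τ • e i) ∪ (Finset.univ.image fun i => (-τ) • e i), ?_, ?_⟩
  · intro l hl
    simp only [Finset.mem_union, Finset.mem_image, Finset.mem_univ, true_and] at hl
    rcases hl with ⟨i, rfl⟩ | ⟨i, rfl⟩
    · exact hmem _ (abs_of_pos hτ) i
    · exact hmem _ (by rw [abs_neg, abs_of_pos hτ]) i
  · intro R
    refine ⟨Real.sqrt (Module.finrank ℝ E * (R / τ) ^ 2), fun z hz => ?_⟩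
    by_contra hcon
    simp only [Finset.mem_union, Finset.mem_image, Finset.mem_univ, true_and, not_exists,
      not_and, not_le] at hcon
    have hb : ∀ i, |inner ℝ (e i) z| ≤ |R / τ| := by
      intro i
      have h1 := hcon _ (Or.inl ⟨i, rfl⟩)
      have h2 := hcon _ (Or.inr ⟨i, rfl⟩)
      rw [real_inner_smul_left] at h1 h2
      refine (abs_le.mpr ⟨?_, ?_⟩ : _ ≤ R / τ).trans (le_abs_self _)
      · rw [neg_le, le_div_iff₀ hτ]; linarith
      · rw [le_div_iff₀ hτ]; linarith
    have hsum : ‖z‖ ^ 2 ≤ Module.finrank ℝ E * (R / τ) ^ 2 := by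
      rw [← e.sum_sq_norm_inner_right z]
      refine (Finset.sum_le_sum fun i _ => ?_).trans
        (b := ∑ _i : Fin (Module.finrank ℝ E), (R / τ) ^ 2) ?_
      · rw [Real.norm_eq_abs]; exact sq_le_sq.mpr (by simpa using hb i)
      · simp
    exact absurd (Real.le_sqrt_of_sq_le hsum) (not_le.mpr hz)

/-- The sub-level sets are bounded because `L` is finite near the origin. -/
lemma isCompact_legendre_le {L : E → EReal} (hbot : ∀ l, L l ≠ ⊥)
    (h0 : (0 : E) ∈ interior (effDomain L)) (a : ℝ) :
    IsCompact {z | legendre L z ≤ (a : EReal)} := by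
  refine Metric.isCompact_of_isClosed_isBounded (isClosed_legendre_le hbot a) ?_
  obtain ⟨T, hT, hT'⟩ := exists_finset_directions h0
  obtain ⟨S, hS⟩ := hT' (∑ l ∈ T, |(L l).toReal| + a + 1)
  refine (Metric.isBounded_closedBall (x := (0 : E)) (r := S)).subset fun z hz => ?_
  rw [mem_closedBall_zero_iff]
  by_contra hcon
  obtain ⟨l, hl, hl'⟩ := hS z (not_le.mp hcon)
  have h1 := (legendre_le_coe_iff hbot).mp hz l (hT l hl)
  have h2 : |(L l).toReal| ≤ ∑ l ∈ T, |(L l).toReal| :=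
    Finset.single_le_sum (f := fun l => |(L l).toReal|) (fun _ _ => abs_nonneg _) hl
  linarith [le_abs_self (L l).toReal]

lemma isGoodRateFunction_legendre {L : E → EReal} (hbot : ∀ l, L l ≠ ⊥) (hL0 : L 0 = 0)
    (h0 : (0 : E) ∈ interior (effDomain L)) : IsGoodRateFunction (legendre L) :=
  ⟨lowerSemicontinuous_of_isClosed_le_real (isClosed_legendre_le hbot), legendre_nonneg hL0,
    fun a _ => isCompact_legendre_le hbot h0 a⟩

variable [MeasurableSpace E] [BorelSpace E]

/-! ### The Gärtner-Ellis theorem -/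

/-- The upper bound of the Gärtner-Ellis theorem, for closed sets. -/
lemma gartnerEllis_upper {Y : ℕ → Ω → E} (hY : ∀ N, Measurable (Y N)) {L : E → EReal}
    (hlim : ∀ l, Tendsto (fun N : ℕ => (((N : ℝ)⁻¹ : ℝ) : EReal) * logMGF μ (Y N) ((N : ℝ) • l))
      atTop (𝓝 (L l))) (hbot : ∀ l, L l ≠ ⊥)
    (h0 : (0 : E) ∈ interior (effDomain L)) {F : Set E} (hF : IsClosed F) :
    expGrowthSup (fun N => μ {ω | Y N ω ∈ F}) ≤ -(⨅ y ∈ F, legendre L y) := by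
  classical
  rw [EReal.le_neg]
  refine le_of_forall_lt_imp_le_of_dense fun b hb => ?_
  obtain ⟨a, hba, hab⟩ := EReal.lt_iff_exists_real_btwn.mp hb
  refine hba.le.trans ?_
  rw [EReal.le_neg]
  obtain ⟨T, hT, hT'⟩ := exists_finset_directions h0
  obtain ⟨S, hS⟩ := hT' (∑ l ∈ T, |(L l).toReal| + a)
  -- each point of the compact part of `F` lies in an open half-space whose probability decays at
  -- rate `a`; the finitely many directions in `T` take care of the part outside a ball
  let U : effDomain L → Set E := fun l => {y | a < inner ℝ (l : E) y - (L l).toReal}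
  have hUo : ∀ l, IsOpen (U l) := fun l => isOpen_lt continuous_const (by fun_prop)
  have hK : IsCompact (F ∩ Metric.closedBall 0 S) := (isCompact_closedBall 0 S).inter_left hF
  obtain ⟨T₂, hT₂⟩ := hK.elim_finite_subcover U hUo (by
    intro y hy
    have h1 : ¬ legendre L y ≤ a := by
      refine not_le.mpr (hab.trans_le ?_)
      exact iInf₂_le y hy.1
    rw [legendre_le_coe_iff hbot] at h1
    push Not at h1
    obtain ⟨l, hl, hl'⟩ := h1
    exact mem_iUnion.mpr ⟨⟨l, hl⟩, hl'⟩)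
  let T₃ : Finset E := T ∪ T₂.image Subtype.val
  have hT₃ : ∀ l ∈ T₃, l ∈ effDomain L := by
    intro l hl
    rcases Finset.mem_union.mp hl with h | h
    · exact hT l h
    · obtain ⟨l', -, rfl⟩ := Finset.mem_image.mp h
      exact l'.2
  have hcov : ∀ y ∈ F, ∃ l ∈ T₃, (L l).toReal + a ≤ inner ℝ l y := by
    intro y hy
    by_cases hyS : ‖y‖ ≤ S
    · have := hT₂ ⟨hy, mem_closedBall_zero_iff.mpr hyS⟩
      simp only [mem_iUnion] at this
      obtain ⟨l, hl, hl'⟩ := this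
      refine ⟨l, Finset.mem_union_right _ (Finset.mem_image_of_mem _ hl), ?_⟩
      have : a < inner ℝ (l : E) y - (L l).toReal := hl'
      linarith
    · obtain ⟨l, hl, hl'⟩ := hS y (not_le.mp hyS)
      refine ⟨l, Finset.mem_union_left _ hl, ?_⟩
      have h2 : |(L l).toReal| ≤ ∑ l ∈ T, |(L l).toReal| :=
        Finset.single_le_sum (f := fun l => |(L l).toReal|) (fun _ _ => abs_nonneg _) hl
      linarith [le_abs_self (L l).toReal]
  have hle : (fun N => μ {ω | Y N ω ∈ F}) ≤
      ∑ l ∈ T₃, fun N => μ {ω | (L l).toReal + a ≤ inner ℝ l (Y N ω)} := by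
    intro N
    rw [Finset.sum_apply]
    refine (measure_mono fun ω hω => ?_).trans (measure_biUnion_finset_le T₃ _)
    obtain ⟨l, hl, hl'⟩ := hcov _ hω
    exact mem_biUnion hl hl'
  refine (expGrowthSup_monotone hle).trans ?_
  rw [expGrowthSup_sum]
  refine iSup₂_le fun l hl => ?_
  refine (expGrowthSup_halfSpace_le hY hlim l _).trans ?_
  rw [← coe_toReal_of_mem_effDomain hbot (hT₃ l hl)]
  rw [EReal.toReal_coe]
  exact_mod_cast (by linarith : (L l).toReal - ((L l).toReal + a) ≤ -a)

lemma expGrowthInf_add_le (u v : ℕ → ℝ≥0∞) :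
    expGrowthInf (u + v) ≤ expGrowthInf u ⊔ expGrowthSup v := by
  refine le_of_forall_gt_imp_ge_of_dense fun b hb => ?_
  rw [sup_lt_iff] at hb
  have h1 := (frequently_le_exp hb.1).and_eventually (eventually_le_exp hb.2)
  calc expGrowthInf (u + v) ≤ expGrowthSup (fun n => 2 * EReal.exp (b * n)) := by
        refine expGrowthInf_le_expGrowthSup_of_frequently_le (h1.mono fun n hn => ?_)
        rw [Pi.add_apply, two_mul]
        exact add_le_add hn.1 hn.2
    _ ≤ expGrowthSup (fun n : ℕ => EReal.exp (b * n)) :=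
        expGrowthSup_le_of_eventually_le (b := 2) (by simp) (Eventually.of_forall fun n => le_rfl)
    _ = b := expGrowthSup_exp

/-- The local lower bound at the gradient of `L`: under the tilted law with parameter `η` the
vectors concentrate at `∇L(η)`. -/
lemma gartnerEllis_local_lower {Y : ℕ → Ω → E} (hY : ∀ N, Measurable (Y N)) {L : E → EReal}
    (hlim : ∀ l, Tendsto (fun N : ℕ => (((N : ℝ)⁻¹ : ℝ) : EReal) * logMGF μ (Y N) ((N : ℝ) • l))
      atTop (𝓝 (L l))) (hbot : ∀ l, L l ≠ ⊥) {η : E} (hη : η ∈ interior (effDomain L))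
    (hd : DifferentiableAt ℝ (fun l => (L l).toReal) η) {r : ℝ} (hr : 0 < r) :
    (((L η).toReal - (inner ℝ η (gradient (fun l => (L l).toReal) η) + ‖η‖ * r) : ℝ) : EReal) ≤
      expGrowthInf (fun N => μ {ω | Y N ω ∈
        Metric.ball (gradient (fun l => (L l).toReal) η) r}) := by
  classical
  set φ : E → ℝ := fun l => (L l).toReal with hφ
  set y := gradient φ η with hy
  have hηD : η ∈ effDomain L := interior_subset hη
  -- the complement of the ball is covered by finitely many half-spaces at distance `q`
  obtain ⟨T, -, hT⟩ := exists_finset_directions (D := (univ : Set E)) (by simp)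
  obtain ⟨S, hS⟩ := hT 1
  set q := r / (|S| + 1) with hq
  have hS1 : 0 < |S| + 1 := by positivity
  have hq0 : 0 < q := div_pos hr hS1
  have hdir : ∀ z : E, r ≤ ‖z‖ → ∃ l ∈ T, q ≤ inner ℝ l z := by
    intro z hz
    obtain ⟨l, hl, hl'⟩ := hS (q⁻¹ • z) (by
      rw [norm_smul, norm_inv, Real.norm_of_nonneg hq0.le, ← div_eq_inv_mul, lt_div_iff₀ hq0]
      calc S * q ≤ |S| * q := by gcongr; exact le_abs_self S
        _ < (|S| + 1) * q := by gcongr; linarith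
        _ = r := by rw [hq]; field_simp
        _ ≤ ‖z‖ := hz)
    refine ⟨l, hl, ?_⟩
    rw [inner_smul_right, ← div_eq_inv_mul, le_div_iff₀ hq0] at hl'
    linarith
  -- along each direction a small tilt makes the half-space exponentially negligible
  have htau : ∀ l : E, ∃ τ : ℝ, 0 < τ ∧ η + τ • l ∈ effDomain L ∧
      φ (η + τ • l) - φ η - τ * inner ℝ l y < τ * q := by
    intro l
    have h1 : HasDerivAt (fun t : ℝ => φ (η + t • l)) (inner ℝ y l) 0 := by
      have hline : HasDerivAt (fun t : ℝ => η + t • l) l 0 := by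
        simpa using ((hasDerivAt_id (0 : ℝ)).smul_const l).const_add η
      have hg' : HasFDerivAt φ (InnerProductSpace.toDual ℝ E y) (η + (0 : ℝ) • l) := by
        rw [zero_smul, add_zero]
        exact hd.hasGradientAt.hasFDerivAt
      exact hg'.comp_hasDerivAt (0 : ℝ) hline
    have h2 := h1.tendsto_slope_zero_right.eventually (gt_mem_nhds (lt_add_of_pos_right _ hq0))
    have h3 : ∀ᶠ t : ℝ in 𝓝[>] 0, η + t • l ∈ effDomain L := by
      have hc : Tendsto (fun t : ℝ => η + t • l) (𝓝[>] 0) (𝓝 η) := by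
        have : Continuous fun t : ℝ => η + t • l := by fun_prop
        simpa using this.tendsto' 0 η (by simp) |>.mono_left nhdsWithin_le_nhds
      exact hc.eventually (mem_interior_iff_mem_nhds.mp hη)
    obtain ⟨τ, h2, h3, hτ⟩ := (h2.and (h3.and self_mem_nhdsWithin)).exists
    have hτ : 0 < τ := hτ
    refine ⟨τ, hτ, h3, ?_⟩
    rw [smul_eq_mul, inv_mul_lt_iff₀ hτ] at h2
    simp only [zero_add, zero_smul, add_zero] at h2
    rw [real_inner_comm]
    linarith
  choose τ hτ hτD hτq using htau
  -- unnormalised tilted masses: total (`A`), of the ball (`B`), of the half-spaces (`C`)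
  set A : ℕ → ℝ≥0∞ := fun N => ∫⁻ ω, ENNReal.ofReal (Real.exp (N * inner ℝ η (Y N ω))) ∂μ
  set B : ℕ → ℝ≥0∞ := fun N => ∫⁻ ω in {ω | Y N ω ∈ Metric.ball y r},
    ENNReal.ofReal (Real.exp (N * inner ℝ η (Y N ω))) ∂μ with hB
  set C : E → ℕ → ℝ≥0∞ := fun l N => ∫⁻ ω in {ω | τ l * (q + inner ℝ l y) ≤
    inner ℝ (τ l • l) (Y N ω)}, ENNReal.ofReal (Real.exp (N * inner ℝ η (Y N ω))) ∂μ
  have hAle : A ≤ B + ∑ l ∈ T, C l := by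
    intro N
    have hcov : (univ : Set Ω) ⊆ {ω | Y N ω ∈ Metric.ball y r} ∪ ⋃ l ∈ T,
        {ω | τ l * (q + inner ℝ l y) ≤ inner ℝ (τ l • l) (Y N ω)} := by
      intro ω _
      by_cases hω : Y N ω ∈ Metric.ball y r
      · exact Or.inl hω
      · right
        rw [mem_ball_iff_norm, not_lt] at hω
        obtain ⟨l, hl, hl'⟩ := hdir _ hω
        refine mem_biUnion hl ?_
        rw [inner_sub_right] at hl'
        rw [mem_ofPred_eq, real_inner_smul_left]
        exact mul_le_mul_of_nonneg_left (by linarith) (hτ l).le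
    calc A N = ∫⁻ ω in univ, ENNReal.ofReal (Real.exp (N * inner ℝ η (Y N ω))) ∂μ := by
          simp [A]
      _ ≤ _ := lintegral_mono_set hcov
      _ ≤ B N + ∫⁻ ω in ⋃ l ∈ T, {ω | τ l * (q + inner ℝ l y) ≤ inner ℝ (τ l • l) (Y N ω)},
            ENNReal.ofReal (Real.exp (N * inner ℝ η (Y N ω))) ∂μ := lintegral_union_le _ _ _
      _ ≤ (B + ∑ l ∈ T, C l) N := by
          rw [Pi.add_apply, Finset.sum_apply]
          gcongr
          rw [← Finset.set_biUnion_coe, biUnion_eq_iUnion]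
          refine (lintegral_iUnion_le _ _).trans ?_
          rw [tsum_fintype, Finset.univ_eq_attach]
          exact (Finset.sum_attach T fun l => C l N).le
  have hAinf : expGrowthInf A = L η := (expGrowth_of_tendsto_logMGF (hlim η)).2
  have hCsup : expGrowthSup (∑ l ∈ T, C l) < L η := by
    rw [expGrowthSup_sum, ← Finset.sup_eq_iSup, Finset.sup_lt_iff (bot_lt_iff_ne_bot.mpr (hbot η))]
    intro l _
    refine (expGrowthSup_setLIntegral_halfSpace_le hY hlim η (τ l • l) _).trans_lt ?_
    rw [← coe_toReal_of_mem_effDomain hbot (hτD l), ← coe_toReal_of_mem_effDomain hbot hηD]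
    have := hτq l
    simp only [hφ] at this
    exact_mod_cast (by linarith : (L (η + τ l • l)).toReal - τ l * (q + inner ℝ l y) <
      (L η).toReal)
  have hBinf : L η ≤ expGrowthInf B := by
    have h1 : L η ≤ expGrowthInf B ⊔ expGrowthSup (∑ l ∈ T, C l) := by
      rw [← hAinf]
      exact (expGrowthInf_monotone hAle).trans (expGrowthInf_add_le _ _)
    rcases le_sup_iff.mp h1 with h | h
    · exact h
    · exact absurd h (not_le.mpr hCsup)
  set c := inner ℝ η y + ‖η‖ * r with hc
  have hBle : B ≤ (fun N : ℕ => ENNReal.ofReal (Real.exp (N * c))) *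
      fun N => μ {ω | Y N ω ∈ Metric.ball y r} := by
    intro N
    have hms : MeasurableSet {ω | Y N ω ∈ Metric.ball y r} := hY N measurableSet_ball
    rw [Pi.mul_apply, ← setLIntegral_const]
    refine setLIntegral_mono' hms fun ω hω => ?_
    refine ENNReal.ofReal_le_ofReal (Real.exp_le_exp.mpr ?_)
    refine mul_le_mul_of_nonneg_left ?_ N.cast_nonneg
    have h1 : ‖Y N ω - y‖ < r := mem_ball_iff_norm.mp hω
    have h2 : inner ℝ η (Y N ω) = inner ℝ η y + inner ℝ η (Y N ω - y) := by
      rw [inner_sub_right]; ring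
    have h3 := real_inner_le_norm η (Y N ω - y)
    have h4 : ‖η‖ * ‖Y N ω - y‖ ≤ ‖η‖ * r := by gcongr
    linarith
  have hexp := (expGrowth_ofReal_exp c).1
  have h2 : L η ≤ (c : EReal) + expGrowthInf fun N => μ {ω | Y N ω ∈ Metric.ball y r} := by
    refine hBinf.trans ((expGrowthInf_monotone hBle).trans ?_)
    rw [← hexp]
    exact expGrowthInf_mul_le (Or.inl (by rw [hexp]; exact EReal.coe_ne_bot _))
      (Or.inl (by rw [hexp]; exact EReal.coe_ne_top _))
  rw [EReal.coe_sub, coe_toReal_of_mem_effDomain hbot hηD]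
  exact EReal.sub_le_of_le_add' h2

/-- For a steep convex function, the quadratically regularised supremum defining the Legendre
transform is attained at an interior point of the effective domain. -/
lemma exists_interior_maximizer {L : E → EReal} (hbot : ∀ l, L l ≠ ⊥) (hconv : IsConvexFun L)
    (hlsc : LowerSemicontinuous L) (hL0 : L 0 = 0) (h0 : (0 : E) ∈ interior (effDomain L))
    (hdiff : ∀ η ∈ interior (effDomain L), DifferentiableAt ℝ (fun l => (L l).toReal) η)
    (hsteep : IsSteep L) (z : E) {δ : ℝ} (hδ : 0 < δ) :
    ∃ η ∈ interior (effDomain L), gradient (fun l => (L l).toReal) η = z - δ • η ∧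
      0 ≤ inner ℝ η z - (L η).toReal - δ / 2 * ‖η‖ ^ 2 := by
  set φ : E → ℝ := fun l => (L l).toReal with hφ
  set D := effDomain L with hD
  have hconvφ : ConvexOn ℝ D φ := hconv.convexOn_toReal hbot
  have hφ0 : φ 0 = 0 := by simp [hφ, hL0]
  have h0D : (0 : E) ∈ D := interior_subset h0
  -- an affine minorant of `φ`
  set g0 := gradient φ 0
  have hmin : ∀ l ∈ D, inner ℝ g0 l ≤ φ l := by
    intro l hl
    have := tangent_le_of_convexOn hconvφ h0D hl (hdiff 0 h0)
    rwa [hφ0, zero_add, sub_zero] at this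
  set ψ : E → ℝ := fun l => δ / 2 * ‖l‖ ^ 2 - inner ℝ l z with hψ
  have hψc : Continuous ψ := by fun_prop
  set Φ : E → EReal := fun l => L l + (ψ l : EReal) with hΦ
  have hΦlsc : LowerSemicontinuous Φ := by
    refine hlsc.add' (continuous_coe_real_ereal.comp hψc).lowerSemicontinuous fun l => ?_
    exact EReal.continuousAt_add (Or.inr (EReal.coe_ne_bot _)) (Or.inr (EReal.coe_ne_top _))
  -- outside the ball of radius `R` the quadratic term dominates the affine minorant
  set R := 2 / δ * (‖g0‖ + ‖z‖) with hR
  have hR0 : 0 ≤ R := by positivity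
  obtain ⟨η, hηR, hηmin⟩ := (hΦlsc.lowerSemicontinuousOn _).exists_isMinOn
    (⟨0, by simpa using hR0⟩ : (Metric.closedBall (0 : E) R).Nonempty) (isCompact_closedBall 0 R)
  have hΦ0 : Φ 0 = 0 := by simp [hΦ, hL0, hψ]
  have hη0 : Φ η ≤ 0 := hΦ0 ▸ hηmin (by simpa using hR0)
  have hηD : η ∈ D := by
    rw [hD, effDomain, mem_ofPred_eq, lt_top_iff_ne_top]
    intro h
    simp [hΦ, h] at hη0
  have hΦD : ∀ l ∈ D, Φ l = ((φ l + ψ l : ℝ) : EReal) := by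
    intro l hl
    simp only [hΦ, hφ]
    rw [EReal.coe_add, coe_toReal_of_mem_effDomain hbot hl]
  have hglob : ∀ l ∈ D, φ η + ψ η ≤ φ l + ψ l := by
    intro l hl
    by_cases hlR : ‖l‖ ≤ R
    · have := hηmin (mem_closedBall_zero_iff.mpr hlR)
      simp only [mem_ofPred_eq] at this
      rw [hΦD l hl, hΦD η hηD] at this
      exact_mod_cast this
    · have h1 := hmin l hl
      rw [hΦD η hηD] at hη0
      have h2 : φ η + ψ η ≤ 0 := by exact_mod_cast hη0
      refine h2.trans ?_
      have h3 := neg_le_of_abs_le (abs_real_inner_le_norm g0 l)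
      have h4 := real_inner_le_norm l z
      have h5 : (‖g0‖ + ‖z‖) ≤ δ / 2 * ‖l‖ := by
        have : R < ‖l‖ := not_le.mp hlR
        rw [hR] at this
        have h6 := mul_lt_mul_of_pos_left this (half_pos hδ)
        have h7 : δ / 2 * (2 / δ * (‖g0‖ + ‖z‖)) = ‖g0‖ + ‖z‖ := by field_simp
        linarith
      have h6 := mul_le_mul_of_nonneg_right h5 (norm_nonneg l)
      simp only [hψ]
      nlinarith
  have hηint : η ∈ interior D := by
    by_contra hni
    -- approach `η` along the segment from the origin
    set t : ℕ → ℝ := fun j => 1 / ((j : ℝ) + 2) with ht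
    have ht0 : ∀ j, 0 < t j := fun j => by positivity
    have ht1 : ∀ j, t j < 1 := fun j => by
      rw [ht]; simp only; rw [div_lt_one (by positivity)]
      have : (0 : ℝ) ≤ j := j.cast_nonneg
      linarith
    have htt : Tendsto t atTop (𝓝 0) := by
      have := tendsto_const_div_atTop_nhds_zero_nat (1 : ℝ)
      have h2 := (tendsto_add_atTop_iff_nat 2).mpr this
      simpa [ht] using h2
    set w : ℕ → E := fun j => (1 - t j) • η with hw
    have hwint : ∀ j, w j ∈ interior D := by
      intro j
      have := hconvφ.1.combo_interior_self_mem_interior h0 hηD (ht0 j)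
        (by linarith [ht1 j] : (0 : ℝ) ≤ 1 - t j) (by ring)
      simpa [hw] using this
    have hwt : Tendsto w atTop (𝓝 η) := by
      have := (htt.const_sub 1).smul_const η
      simpa [hw] using this
    have hfr : η ∈ frontier (interior D) := by
      rw [frontier, interior_interior]
      exact ⟨mem_closure_of_tendsto hwt (Eventually.of_forall hwint), hni⟩
    have hgt := hsteep η w hfr hwint hwt
    change Tendsto (fun j => ‖gradient φ (w j)‖) atTop atTop at hgt
    -- a closed ball in the interior on which `φ` is bounded above
    obtain ⟨ρ, hρ, hball⟩ := Metric.nhds_basis_closedBall.mem_iff.mp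
      (mem_interior_iff_mem_nhds.mp (interior_interior (s := D) ▸ h0))
    obtain ⟨M, hM⟩ := (isCompact_closedBall (0 : E) ρ).exists_bound_of_continuousOn
      (f := φ) fun u hu => (hdiff u (hball hu)).continuousAt.continuousWithinAt
    have hbd : ∀ j, ρ * ‖gradient φ (w j)‖ ≤ M + ‖g0‖ * ‖η‖ + |inner ℝ η z| := by
      intro j
      set G := gradient φ (w j) with hG
      have hwD := interior_subset (hwint j)
      have hdw := hdiff _ (hwint j)
      have hnw : ‖w j‖ ≤ ‖η‖ := by
        rw [hw]; simp only
        rw [norm_smul, Real.norm_of_nonneg (by linarith [ht1 j])]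
        have := norm_nonneg η
        nlinarith [ht0 j]
      have hlow : -(‖g0‖ * ‖η‖) ≤ φ (w j) := by
        have h1 := hmin _ hwD
        have h2 := neg_le_of_abs_le (abs_real_inner_le_norm g0 (w j))
        have : ‖g0‖ * ‖w j‖ ≤ ‖g0‖ * ‖η‖ := by gcongr
        linarith
      -- minimality of `η` bounds the derivative along the segment
      have hA : inner ℝ G (w j) ≤ |inner ℝ η z| := by
        have h1 := tangent_le_of_convexOn hconvφ hwD hηD hdw
        have h2 := hglob _ hwD
        have e1 : η - w j = t j • η := by
          rw [hw]; simp only [sub_smul, one_smul]; abel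
        rw [← hG, e1, inner_smul_right] at h1
        simp only [hψ] at h2
        have e2 : inner ℝ (w j) z = (1 - t j) * inner ℝ η z := by
          rw [hw]; exact real_inner_smul_left _ _ _
        have e3 : inner ℝ G (w j) = (1 - t j) * inner ℝ G η := by
          rw [hw]; exact real_inner_smul_right _ _ _
        have h3 : δ / 2 * ‖w j‖ ^ 2 ≤ δ / 2 * ‖η‖ ^ 2 := by gcongr
        rw [e2] at h2
        have h4 : t j * inner ℝ G η ≤ t j * inner ℝ η z := by linarith
        have h5 := le_of_mul_le_mul_left h4 (ht0 j)
        rw [e3]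
        have h6 := le_abs_self (inner ℝ η z)
        have h7 := abs_nonneg (inner ℝ η z)
        nlinarith [ht0 j, ht1 j]
      -- the tangent inequality at the point of the ball in the direction of `G`
      have hB : ρ * ‖G‖ - inner ℝ G (w j) + φ (w j) ≤ M := by
        by_cases hG0 : G = 0
        · have h1 := tangent_le_of_convexOn hconvφ hwD h0D hdw
          have h2 := hM 0 (Metric.mem_closedBall_self hρ.le)
          rw [← hG, hG0, inner_zero_left, hφ0] at h1
          rw [hφ0] at h2
          simp only [hG0, norm_zero, mul_zero, inner_zero_left] at h1 h2 ⊢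
          linarith
        · have hGn : ‖G‖ ≠ 0 := norm_ne_zero_iff.mpr hG0
          set u := (ρ / ‖G‖) • G with hu
          have hun : ‖u‖ = ρ := by
            rw [hu, norm_smul, norm_div, norm_norm, Real.norm_of_nonneg hρ.le]
            field_simp
          have huB : u ∈ Metric.closedBall (0 : E) ρ := mem_closedBall_zero_iff.mpr hun.le
          have h1 := tangent_le_of_convexOn hconvφ hwD (interior_subset (hball huB)) hdw
          have h2 := (le_abs_self _).trans (hM u huB)
          have e : inner ℝ G u = ρ * ‖G‖ := by
            rw [hu, inner_smul_right, real_inner_self_eq_norm_sq]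
            field_simp
          rw [← hG, inner_sub_right, e] at h1
          linarith
      linarith
    obtain ⟨j, hj⟩ := (hgt.eventually_gt_atTop
      ((M + ‖g0‖ * ‖η‖ + |inner ℝ η z|) / ρ)).exists
    rw [div_lt_iff₀ hρ] at hj
    linarith [hbd j]
  refine ⟨η, hηint, ?_, ?_⟩
  · have hgrad := (hdiff η hηint).hasGradientAt
    have hψg : HasGradientAt ψ (δ • η - z) η := by
      have h1 : HasFDerivAt (fun l : E => ‖l‖ ^ 2) (2 • (innerSL ℝ η)) η :=
        (hasStrictFDerivAt_norm_sq η).hasFDerivAt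
      have h2 : HasFDerivAt (fun l : E => inner ℝ z l) (innerSL ℝ z) η :=
        (innerSL ℝ z).hasFDerivAt
      have h3 := (h1.const_mul (δ / 2)).sub h2
      have e : ψ = (fun l : E => δ / 2 * ‖l‖ ^ 2 - inner ℝ z l) := by
        funext l; simp only [hψ, real_inner_comm]
      rw [e, hasGradientAt_iff_hasFDerivAt]
      have key : InnerProductSpace.toDual ℝ E (δ • η - z) =
          (δ / 2) • 2 • innerSL ℝ η - innerSL ℝ z := by
        ext v
        have : δ / 2 * (2 * inner ℝ η v) = δ * inner ℝ η v := by ring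
        simp [this]
      rw [key]
      exact h3
    have hsum : HasFDerivAt (fun l => φ l + ψ l)
        (InnerProductSpace.toDual ℝ E (gradient φ η) +
          InnerProductSpace.toDual ℝ E (δ • η - z)) η :=
      hgrad.hasFDerivAt.add hψg.hasFDerivAt
    have hloc : IsLocalMin (fun l => φ l + ψ l) η := by
      filter_upwards [mem_interior_iff_mem_nhds.mp hηint] with l hl using hglob l hl
    have hz := hloc.hasFDerivAt_eq_zero hsum
    rw [← map_add] at hz
    have := (map_eq_zero_iff _ (InnerProductSpace.toDual ℝ E).injective).mp hz
    rw [eq_neg_of_add_eq_zero_left this]; abel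
  · have := hglob 0 h0D
    simp only [hφ0, hψ] at this
    simp at this
    simp only [hφ] at this
    linarith

/-- The Gärtner-Ellis theorem for a lower semicontinuous, steep limiting logarithmic moment
generating function. -/
theorem gartnerEllis {Y : ℕ → Ω → E} (hY : ∀ N, Measurable (Y N)) {L : E → EReal}
    (hlim : ∀ l, Tendsto (fun N : ℕ => (((N : ℝ)⁻¹ : ℝ) : EReal) * logMGF μ (Y N) ((N : ℝ) • l))
      atTop (𝓝 (L l))) (hbot : ∀ l, L l ≠ ⊥) (hconv : IsConvexFun L)
    (hlsc : LowerSemicontinuous L) (hL0 : L 0 = 0) (h0 : (0 : E) ∈ interior (effDomain L))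
    (hdiff : ∀ η ∈ interior (effDomain L), DifferentiableAt ℝ (fun l => (L l).toReal) η)
    (hsteep : IsSteep L) : SatisfiesLDP μ Y (legendre L) := by
  rw [satisfiesLDP_iff]
  refine fun Γ => ⟨?_, ?_⟩
  · rw [EReal.neg_le]
    refine le_iInf₂ fun z hz => ?_
    rw [EReal.neg_le]
    refine le_of_forall_lt_imp_le_of_dense fun b hb => ?_
    obtain ⟨a, hba, hab⟩ := EReal.lt_iff_exists_real_btwn.mp hb
    refine hba.le.trans ?_
    have hne : legendre L z ≠ ⊤ := by
      intro h; rw [h] at hab; simp at hab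
    have hnb : legendre L z ≠ ⊥ := ne_bot_of_le_ne_bot EReal.zero_ne_bot (legendre_nonneg hL0 z)
    set c := (legendre L z).toReal with hc
    have hcz : legendre L z = (c : EReal) := (EReal.coe_toReal hne hnb).symm
    have hac : a < -c := by rw [hcz] at hab; exact_mod_cast hab
    have hc0 : 0 ≤ c := by
      have := legendre_nonneg hL0 z; rw [hcz] at this; exact_mod_cast this
    obtain ⟨r, hr, hball⟩ := Metric.isOpen_iff.mp (isOpen_interior (s := Γ)) z hz
    -- the regularisation parameter keeps the shifted point within `r / 2` of `z`
    set δ := (r / 2) ^ 2 / (2 * (c + 1)) with hδ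
    have hδ0 : 0 < δ := by positivity
    obtain ⟨η, hη, hgrad, hval⟩ := exists_interior_maximizer hbot hconv hlsc hL0 h0 hdiff hsteep z
      hδ0
    have hηD := interior_subset hη
    have hleg : inner ℝ η z - (L η).toReal ≤ c :=
      (legendre_le_coe_iff hbot).mp hcz.le η hηD
    have hsmall : ‖δ • η‖ ≤ r / 2 := by
      rw [norm_smul, Real.norm_of_nonneg hδ0.le]
      refine abs_le_of_sq_le_sq' ?_ (by positivity) |>.2
      have h1 : δ / 2 * ‖η‖ ^ 2 ≤ c := by linarith
      have h2 : (δ * ‖η‖) ^ 2 = 2 * δ * (δ / 2 * ‖η‖ ^ 2) := by ring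
      rw [h2]
      calc 2 * δ * (δ / 2 * ‖η‖ ^ 2) ≤ 2 * δ * (c + 1) := by gcongr; linarith
        _ = (r / 2) ^ 2 := by rw [hδ]; field_simp
    set r' := min (r / 2) ((-c - a) / (‖η‖ + 1)) with hr'
    have hr'0 : 0 < r' := lt_min (by positivity) (div_pos (by linarith) (by positivity))
    have hloc := gartnerEllis_local_lower hY hlim hbot hη (hdiff η hη) hr'0
    rw [hgrad] at hloc
    have hsub : ∀ N, {ω | Y N ω ∈ Metric.ball (z - δ • η) r'} ⊆ {ω | Y N ω ∈ Γ} := by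
      intro N ω hω
      change Y N ω ∈ Γ
      refine interior_subset (hball ?_)
      rw [mem_ball_iff_norm]
      have h1 : ‖Y N ω - (z - δ • η)‖ < r' := mem_ball_iff_norm.mp hω
      calc ‖Y N ω - z‖ = ‖(Y N ω - (z - δ • η)) - δ • η‖ := by congr 1; abel
        _ ≤ ‖Y N ω - (z - δ • η)‖ + ‖δ • η‖ := norm_sub_le _ _
        _ < r / 2 + r / 2 := add_lt_add_of_lt_of_le (h1.trans_le (min_le_left _ _)) hsmall
        _ = r := by ring
    refine le_trans ?_ (hloc.trans (expGrowthInf_monotone fun N => measure_mono (hsub N)))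
    have h1 : ‖η‖ * r' ≤ -c - a := by
      calc ‖η‖ * r' ≤ (‖η‖ + 1) * ((-c - a) / (‖η‖ + 1)) := by
            gcongr
            · linarith
            · exact min_le_right _ _
        _ = -c - a := by field_simp
    have h2 : inner ℝ η (z - δ • η) ≤ inner ℝ η z := by
      rw [inner_sub_right, inner_smul_right, real_inner_self_eq_norm_sq]
      have : 0 ≤ δ * ‖η‖ ^ 2 := by positivity
      linarith
    exact_mod_cast (by linarith :
      a ≤ (L η).toReal - (inner ℝ η (z - δ • η) + ‖η‖ * r'))
  · have hcl : ∀ N, {ω | Y N ω ∈ Γ} ⊆ {ω | Y N ω ∈ closure Γ} := fun N ω hω =>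
      (subset_closure (show Y N ω ∈ Γ from hω) : Y N ω ∈ closure Γ)
    exact (expGrowthSup_monotone fun N => measure_mono (hcl N)).trans
      (gartnerEllis_upper hY hlim hbot h0 isClosed_closure)

end FiniteDim

end GartnerEllis

/-! ### The logarithmic moment generating function -/

section LogMGF

set_option linter.unusedSectionVars false

variable {Ω : Type*} [MeasurableSpace Ω] {μ : Measure Ω}
variable {E : Type*} [NormedAddCommGroup E] [InnerProductSpace ℝ E]

section Vector

variable [MeasurableSpace E] [BorelSpace E] [SecondCountableTopology E]

/-- Convexity of the logarithmic moment generating function (Hölder's inequality). -/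
lemma isConvexFun_logMGF {Y : Ω → E} (hY : Measurable Y) : IsConvexFun (logMGF μ Y) := by
  rintro ⟨u, p⟩ hu ⟨v, q⟩ hv a b ha hb hab
  simp only [mem_ofPred_eq, Prod.smul_mk, Prod.mk_add_mk, smul_eq_mul] at hu hv ⊢
  have hmeas : ∀ l : E, AEMeasurable (fun ω => ENNReal.ofReal (Real.exp (inner ℝ l (Y ω)))) μ := by
    intro l
    have : Measurable fun ω => inner ℝ l (Y ω) := measurable_const.inner hY
    fun_prop
  have hH := ENNReal.lintegral_mul_norm_pow_le (hmeas u) (hmeas v) ha hb hab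
  have hpt : ∀ ω, ENNReal.ofReal (Real.exp (inner ℝ (a • u + b • v) (Y ω))) =
      ENNReal.ofReal (Real.exp (inner ℝ u (Y ω))) ^ a *
        ENNReal.ofReal (Real.exp (inner ℝ v (Y ω))) ^ b := by
    intro ω
    rw [ENNReal.ofReal_rpow_of_pos (Real.exp_pos _), ENNReal.ofReal_rpow_of_pos (Real.exp_pos _),
      ← ENNReal.ofReal_mul (by positivity), ← Real.exp_mul, ← Real.exp_mul, ← Real.exp_add,
      inner_add_left, real_inner_smul_left, real_inner_smul_left]
    ring_nf
  unfold logMGF at hu hv ⊢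
  simp_rw [hpt]
  refine (ENNReal.log_monotone hH).trans ?_
  rw [ENNReal.log_mul_add, ENNReal.log_rpow, ENNReal.log_rpow, EReal.coe_add, EReal.coe_mul,
    EReal.coe_mul]
  exact add_le_add (mul_le_mul_of_nonneg_left hu (by exact_mod_cast ha))
    (mul_le_mul_of_nonneg_left hv (by exact_mod_cast hb))

lemma lowerSemicontinuous_logMGF {Y : Ω → E} (hY : Measurable Y) :
    LowerSemicontinuous (logMGF μ Y) := by
  unfold logMGF
  refine ENNReal.continuous_log.comp_lowerSemicontinuous ?_ ENNReal.log_monotone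
  rw [lowerSemicontinuous_iff_le_liminf]
  intro l
  have hpt : ∀ ω, ENNReal.ofReal (Real.exp (inner ℝ l (Y ω))) =
      liminf (fun l' => ENNReal.ofReal (Real.exp (inner ℝ l' (Y ω)))) (𝓝 l) := by
    intro ω
    have : Continuous fun l' => ENNReal.ofReal (Real.exp (inner ℝ l' (Y ω))) :=
      ENNReal.continuous_ofReal.comp (by fun_prop)
    exact (this.tendsto l).liminf_eq.symm
  simp_rw [hpt]
  refine lintegral_liminf_le fun l' => ?_
  have : Measurable fun ω => inner ℝ l' (Y ω) := measurable_const.inner hY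
  fun_prop

end Vector

/-! ### The cumulant generating function of a non-negative random variable -/

lemma logMGF_real (X : Ω → ℝ) (t : ℝ) :
    logMGF μ X t = ENNReal.log (∫⁻ ω, ENNReal.ofReal (Real.exp (t * X ω)) ∂μ) := by
  simp [logMGF, mul_comm]

variable [IsProbabilityMeasure μ] {X : Ω → ℝ}

lemma logMGF_ne_bot (hX : Measurable X) (t : ℝ) : logMGF μ X t ≠ ⊥ := by
  rw [logMGF_real, Ne, ENNReal.log_eq_bot_iff, lintegral_eq_zero_iff (by fun_prop)]
  intro h
  obtain ⟨ω, hω⟩ := h.exists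
  simp only [Pi.zero_apply, ENNReal.ofReal_eq_zero] at hω
  exact absurd hω (not_le.mpr (Real.exp_pos _))

lemma logMGF_of_mem {t : ℝ} (ht : t ∈ integrableExpSet X μ) :
    logMGF μ X t = ((cgf X μ t : ℝ) : EReal) := by
  have ht' : Integrable (fun ω => Real.exp (t * X ω)) μ := ht
  rw [logMGF_real, ← ofReal_integral_eq_lintegral_ofReal ht'
    (Eventually.of_forall fun _ => (Real.exp_pos _).le)]
  exact ENNReal.log_ofReal_of_pos (mgf_pos ht')

lemma logMGF_of_notMem (hX : Measurable X) {t : ℝ} (ht : t ∉ integrableExpSet X μ) :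
    logMGF μ X t = ⊤ := by
  rw [logMGF_real, ENNReal.log_eq_top_iff]
  by_contra h
  exact ht ((lintegral_ofReal_ne_top_iff_integrable (by fun_prop)
    (Eventually.of_forall fun _ => (Real.exp_pos _).le)).mp h)

lemma effDomain_logMGF (hX : Measurable X) : effDomain (logMGF μ X) = integrableExpSet X μ := by
  ext t
  by_cases ht : t ∈ integrableExpSet X μ
  · simp [effDomain, logMGF_of_mem ht, ht, EReal.coe_lt_top]
  · simp [effDomain, logMGF_of_notMem hX ht, ht]

lemma toReal_logMGF (hX : Measurable X) : (fun t => (logMGF μ X t).toReal) = cgf X μ := by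
  funext t
  by_cases ht : t ∈ integrableExpSet X μ
  · rw [logMGF_of_mem ht, EReal.toReal_coe]
  · rw [logMGF_of_notMem hX ht, EReal.toReal_top, cgf_undef ht]

lemma monotone_logMGF (hpos : ∀ᵐ ω ∂μ, 0 ≤ X ω) : Monotone (logMGF μ X) := by
  intro s t hst
  rw [logMGF_real, logMGF_real]
  refine ENNReal.log_monotone (lintegral_mono_ae ?_)
  filter_upwards [hpos] with ω hω
  exact ENNReal.ofReal_le_ofReal (Real.exp_le_exp.mpr (mul_le_mul_of_nonneg_right hst hω))

lemma mem_integrableExpSet_of_le (hX : Measurable X) (hpos : ∀ᵐ ω ∂μ, 0 ≤ X ω) {s t : ℝ}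
    (hst : s ≤ t) (ht : t ∈ integrableExpSet X μ) : s ∈ integrableExpSet X μ := by
  rw [← effDomain_logMGF hX] at ht ⊢
  exact (monotone_logMGF hpos hst).trans_lt ht

lemma zero_mem_integrableExpSet : (0 : ℝ) ∈ integrableExpSet X μ := by
  simp [integrableExpSet]

lemma mem_integrableExpSet_of_nonpos (hX : Measurable X) (hpos : ∀ᵐ ω ∂μ, 0 ≤ X ω) {t : ℝ}
    (ht : t ≤ 0) : t ∈ integrableExpSet X μ :=
  mem_integrableExpSet_of_le hX hpos ht zero_mem_integrableExpSet

lemma cgf_mono (hX : Measurable X) (hpos : ∀ᵐ ω ∂μ, 0 ≤ X ω) {s t : ℝ}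
    (hst : s ≤ t) (ht : t ∈ integrableExpSet X μ) : cgf X μ s ≤ cgf X μ t := by
  have := monotone_logMGF hpos hst
  rw [logMGF_of_mem ht, logMGF_of_mem (mem_integrableExpSet_of_le hX hpos hst ht)] at this
  exact_mod_cast this

lemma cgf_nonpos (hX : Measurable X) (hpos : ∀ᵐ ω ∂μ, 0 ≤ X ω) {t : ℝ} (ht : t ≤ 0) :
    cgf X μ t ≤ 0 := by
  simpa using cgf_mono hX hpos ht zero_mem_integrableExpSet

lemma convexOn_cgf (hX : Measurable X) : ConvexOn ℝ (integrableExpSet X μ) (cgf X μ) := by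
  have := (isConvexFun_logMGF (μ := μ) hX).convexOn_toReal (logMGF_ne_bot hX)
  rwa [effDomain_logMGF hX, toReal_logMGF hX] at this

/-- On the negative half-line the cumulant generating function is superadditive, being convex and
zero at the origin. -/
lemma cgf_neg_add_le (hX : Measurable X) (hpos : ∀ᵐ ω ∂μ, 0 ≤ X ω) {s t : ℝ} (hs : 0 ≤ s)
    (ht : 0 ≤ t) : cgf X μ (-s) + cgf X μ (-t) ≤ cgf X μ (-(s + t)) := by
  rcases eq_or_lt_of_le (add_nonneg hs ht) with h | h
  · have h1 : s = 0 := by linarith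
    have h2 : t = 0 := by linarith
    simp [h1, h2]
  have hst : -(s + t) ∈ integrableExpSet X μ := mem_integrableExpSet_of_nonpos hX hpos (by linarith)
  have key : ∀ r : ℝ, 0 ≤ r → r ≤ s + t → cgf X μ (-r) ≤ r / (s + t) * cgf X μ (-(s + t)) := by
    intro r hr hr'
    have := (convexOn_cgf (μ := μ) hX).2 hst zero_mem_integrableExpSet
      (div_nonneg hr h.le) (by rw [sub_nonneg, div_le_one h]; exact hr' : 0 ≤ 1 - r / (s + t))
      (by ring)
    have e : (r / (s + t)) • (-(s + t)) + (1 - r / (s + t)) • (0 : ℝ) = -r := by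
      simp only [smul_eq_mul]; field_simp; ring
    rw [e] at this
    simpa using this
  have h1 := key s hs (by linarith)
  have h2 := key t ht (by linarith)
  have : s / (s + t) * cgf X μ (-(s + t)) + t / (s + t) * cgf X μ (-(s + t)) =
    cgf X μ (-(s + t)) := by field_simp
  linarith

lemma sum_cgf_neg_le {ι : Type*} (hX : Measurable X) (hpos : ∀ᵐ ω ∂μ, 0 ≤ X ω) (T : Finset ι)
    {d : ι → ℝ} (hd : ∀ i, 0 ≤ d i) :
    ∑ i ∈ T, cgf X μ (-d i) ≤ cgf X μ (-∑ i ∈ T, d i) := by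
  classical
  induction T using Finset.induction_on with
  | empty => simp
  | insert i T hi ih =>
    rw [Finset.sum_insert hi, Finset.sum_insert hi]
    exact (add_le_add le_rfl ih).trans
      (cgf_neg_add_le hX hpos (hd i) (Finset.sum_nonneg fun j _ => hd j))

/-- Supporting lines of the cumulant generating function of a non-negative random variable are
non-decreasing. -/
lemma exists_supporting_line (hX : Measurable X) (hpos : ∀ᵐ ω ∂μ, 0 ≤ X ω) {a : ℝ}
    (ha : a ∈ interior (integrableExpSet X μ)) :
    ∃ κ : ℝ, 0 ≤ κ ∧ ∀ t ∈ integrableExpSet X μ, cgf X μ a + κ * (t - a) ≤ cgf X μ t := by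
  have hc := convexOn_cgf (μ := μ) hX
  have haS := interior_subset ha
  have ht : ∀ t ∈ integrableExpSet X μ,
      cgf X μ a + gradient (cgf X μ) a * (t - a) ≤ cgf X μ t := by
    intro t ht
    have := tangent_le_of_convexOn hc haS ht (analyticAt_cgf ha).differentiableAt
    rw [real_inner_eq_re_inner] at this
    simpa [mul_comm] using this
  refine ⟨gradient (cgf X μ) a, ?_, ht⟩
  have h1 := ht (a - 1) (mem_integrableExpSet_of_le hX hpos (by linarith) haS)
  have h2 := cgf_mono hX hpos (by linarith : a - 1 ≤ a) haS
  linarith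

/-- A bound to the left of `a` extends to `a` by lower semicontinuity, also when `a` is the end point
of the domain. -/
lemma logMGF_le_of_forall_lt (hX : Measurable X) {a : ℝ} {r : EReal}
    (h : ∀ a' < a, logMGF μ X a' ≤ r) : logMGF μ X a ≤ r := by
  refine le_of_forall_lt fun b hb => ?_
  have h1 := lowerSemicontinuous_logMGF (μ := μ) hX a b hb
  obtain ⟨a', h2, h3⟩ := ((h1.filter_mono nhdsWithin_le_nhds).and
    (self_mem_nhdsWithin : Iio a ∈ 𝓝[<] a)).exists
  exact h2.trans_le (h a' h3)

end LogMGF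

/-! ### Integrals of extended-real-valued functions -/

section UnitIntegral

lemma unitIntegral_congr {φ φ' : ℝ → EReal} (h : ∀ s ∈ Ioc (0 : ℝ) 1, φ s = φ' s) :
    unitIntegral φ = unitIntegral φ' := by
  unfold unitIntegral
  congr 2
  · exact setLIntegral_congr_fun measurableSet_Ioc fun s hs => congrArg _ (h s hs)
  · exact setLIntegral_congr_fun measurableSet_Ioc fun s hs =>
      congrArg (fun a : EReal => (-a).toENNReal) (h s hs)

lemma toENNReal_coe_real (r : ℝ) : (r : EReal).toENNReal = ENNReal.ofReal r := by
  rw [EReal.toENNReal_of_ne_top (EReal.coe_ne_top _), EReal.toReal_coe]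

lemma toENNReal_add_coe_eq {a : EReal} {B : ℝ} (hB : 0 ≤ B) (h : -(B : EReal) ≤ a) :
    a.toENNReal + ENNReal.ofReal B = (a + B).toENNReal + (-a).toENNReal := by
  induction a with
  | bot => simp at h
  | top => simp
  | coe r =>
    have h' : -B ≤ r := by exact_mod_cast h
    rw [← EReal.coe_add, ← EReal.coe_neg, toENNReal_coe_real, toENNReal_coe_real,
      toENNReal_coe_real]
    rcases le_total 0 r with hr | hr
    · rw [ENNReal.ofReal_of_nonpos (by linarith : -r ≤ 0), add_zero,
        ENNReal.ofReal_add hr hB]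
    · rw [ENNReal.ofReal_of_nonpos hr, zero_add, ← ENNReal.ofReal_add (by linarith) (by linarith)]
      congr 1; ring

/-- For an integrand bounded below the integral over the unit interval is a single Lebesgue
integral of a non-negative function, up to a constant. -/
lemma unitIntegral_eq_lintegral_sub {φ : ℝ → EReal} {B : ℝ} (hB : 0 ≤ B)
    (hφ : Measurable φ) (h : ∀ s ∈ Ioc (0 : ℝ) 1, -(B : EReal) ≤ φ s) :
    unitIntegral φ = ((∫⁻ s in Ioc (0 : ℝ) 1, (φ s + B).toENNReal : ℝ≥0∞) : EReal) - B := by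
  have hneg : ∫⁻ s in Ioc (0 : ℝ) 1, (-φ s).toENNReal ≤ ENNReal.ofReal B := by
    calc ∫⁻ s in Ioc (0 : ℝ) 1, (-φ s).toENNReal
        ≤ ∫⁻ s in Ioc (0 : ℝ) 1, ENNReal.ofReal B := by
          refine setLIntegral_mono' measurableSet_Ioc fun s hs => ?_
          rw [← toENNReal_coe_real]
          exact EReal.toENNReal_le_toENNReal (EReal.neg_le.mp (h s hs))
      _ = ENNReal.ofReal B := by simp
  have hsum : (∫⁻ s in Ioc (0 : ℝ) 1, (φ s).toENNReal) + ENNReal.ofReal B =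
      (∫⁻ s in Ioc (0 : ℝ) 1, (φ s + B).toENNReal) +
        ∫⁻ s in Ioc (0 : ℝ) 1, (-φ s).toENNReal := by
    have e : ENNReal.ofReal B = ∫⁻ s in Ioc (0 : ℝ) 1, ENNReal.ofReal B := by simp
    rw [e, ← lintegral_add_right _ measurable_const,
      ← lintegral_add_right _ (by fun_prop : Measurable fun s => (-φ s).toENNReal)]
    exact setLIntegral_congr_fun measurableSet_Ioc fun s hs => toENNReal_add_coe_eq hB (h s hs)
  unfold unitIntegral
  generalize (∫⁻ s in Ioc (0 : ℝ) 1, (φ s).toENNReal) = a at hsum ⊢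
  generalize (∫⁻ s in Ioc (0 : ℝ) 1, (-φ s).toENNReal) = b at hsum hneg ⊢
  generalize (∫⁻ s in Ioc (0 : ℝ) 1, (φ s + B).toENNReal) = c at hsum ⊢
  have hb : b ≠ ⊤ := ne_top_of_le_ne_top ENNReal.ofReal_ne_top hneg
  lift b to NNReal using hb
  rcases eq_or_ne a ⊤ with ha | ha
  · have hc : c = ⊤ := by
      by_contra hc
      have : c + (b : ℝ≥0∞) ≠ ⊤ := ENNReal.add_ne_top.mpr ⟨hc, ENNReal.coe_ne_top⟩
      rw [← hsum, ha] at this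
      simp at this
    rw [ha, hc]
    simp
  · have hc : c ≠ ⊤ := by
      intro hc
      have : a + ENNReal.ofReal B ≠ ⊤ := ENNReal.add_ne_top.mpr ⟨ha, ENNReal.ofReal_ne_top⟩
      rw [hsum, hc] at this
      simp at this
    lift a to NNReal using ha
    lift c to NNReal using hc
    have h1 := congrArg ENNReal.toReal hsum
    rw [ENNReal.toReal_add ENNReal.coe_ne_top ENNReal.ofReal_ne_top,
      ENNReal.toReal_add ENNReal.coe_ne_top ENNReal.coe_ne_top, ENNReal.toReal_ofReal hB] at h1
    simp only [ENNReal.coe_toReal] at h1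
    change ((a : ℝ) : EReal) - ((b : ℝ) : EReal) = ((c : ℝ) : EReal) - (B : EReal)
    exact_mod_cast (by linarith : (a : ℝ) - b = c - B)

lemma unitIntegral_coe {φ : ℝ → EReal} {g : ℝ → ℝ}
    (hφ : ∀ᵐ s ∂volume.restrict (Ioc (0 : ℝ) 1), φ s = (g s : EReal))
    (hg : IntegrableOn g (Ioc 0 1)) :
    unitIntegral φ = ((∫ s in Ioc (0 : ℝ) 1, g s : ℝ) : EReal) := by
  have h1 : ∫⁻ s in Ioc (0 : ℝ) 1, (φ s).toENNReal = ∫⁻ s in Ioc (0 : ℝ) 1, ENNReal.ofReal (g s) := by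
    refine lintegral_congr_ae ?_
    filter_upwards [hφ] with s hs
    rw [hs, toENNReal_coe_real]
  have h2 : ∫⁻ s in Ioc (0 : ℝ) 1, (-φ s).toENNReal =
      ∫⁻ s in Ioc (0 : ℝ) 1, ENNReal.ofReal (-g s) := by
    refine lintegral_congr_ae ?_
    filter_upwards [hφ] with s hs
    rw [hs, ← EReal.coe_neg, toENNReal_coe_real]
  unfold unitIntegral
  rw [h1, h2, integral_eq_lintegral_pos_part_sub_lintegral_neg_part hg]
  have f1 : ∫⁻ s in Ioc (0 : ℝ) 1, ENNReal.ofReal (g s) ≠ ⊤ := (hg.lintegral_lt_top).ne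
  have f2 : ∫⁻ s in Ioc (0 : ℝ) 1, ENNReal.ofReal (-g s) ≠ ⊤ := (hg.neg.lintegral_lt_top).ne
  rw [EReal.coe_sub, EReal.coe_ennreal_toReal f1, EReal.coe_ennreal_toReal f2]

end UnitIntegral

/-! ### The averaged logarithmic moment generating function -/

/-- `l ↦ ∫_0^1 Λ_X(κ l · H(s)) ds`, the limiting logarithmic moment generating function for a
general bounded vector function `H`. -/
noncomputable def avgLogMGF {Ω : Type*} [MeasurableSpace Ω] (μ : Measure Ω) (X : Ω → ℝ)
    {E : Type*} [NormedAddCommGroup E] [InnerProductSpace ℝ E] (κ : ℝ) (H : ℝ → E) (l : E) :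
    EReal :=
  unitIntegral (fun s => logMGF μ X (κ * inner ℝ l (H s)))

section AvgLogMGF

set_option linter.unusedSectionVars false

variable {Ω : Type*} [MeasurableSpace Ω] {μ : Measure Ω} [IsProbabilityMeasure μ] {X : Ω → ℝ}
variable {E : Type*} [NormedAddCommGroup E] [InnerProductSpace ℝ E] [FiniteDimensional ℝ E]
  [MeasurableSpace E] [BorelSpace E]
variable {κ C : ℝ} {H : ℝ → E}

lemma measurable_logMGF (hX : Measurable X) : Measurable (logMGF μ X) :=
  (lowerSemicontinuous_logMGF hX).measurable

lemma abs_mul_inner_le (hκ : 0 ≤ κ) (hC : ∀ s, ‖H s‖ ≤ C) {l : E} {R : ℝ} (hl : ‖l‖ ≤ R)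
    (s : ℝ) : |κ * inner ℝ l (H s)| ≤ κ * (R * C) := by
  rw [abs_mul, abs_of_nonneg hκ]
  have h1 := abs_real_inner_le_norm l (H s)
  have h2 : ‖l‖ * ‖H s‖ ≤ R * C :=
    mul_le_mul hl (hC s) (norm_nonneg _) ((norm_nonneg _).trans hl)
  exact mul_le_mul_of_nonneg_left (h1.trans h2) hκ

lemma neg_le_logMGF (hX : Measurable X) (hpos : ∀ᵐ ω ∂μ, 0 ≤ X ω) {T t : ℝ} (hT : 0 ≤ T)
    (ht : |t| ≤ T) : -((-cgf X μ (-T) : ℝ) : EReal) ≤ logMGF μ X t := by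
  rw [EReal.coe_neg, neg_neg,
    ← logMGF_of_mem (mem_integrableExpSet_of_nonpos hX hpos (by linarith : -T ≤ 0))]
  exact monotone_logMGF hpos (neg_le_of_abs_le ht)

lemma avgLogMGF_eq (hX : Measurable X) (hpos : ∀ᵐ ω ∂μ, 0 ≤ X ω) (hκ : 0 ≤ κ)
    (hH : Measurable H) (hC : ∀ s, ‖H s‖ ≤ C) {R : ℝ} {l : E} (hl : ‖l‖ ≤ R) :
    avgLogMGF μ X κ H l = ((∫⁻ s in Ioc (0 : ℝ) 1, (logMGF μ X (κ * inner ℝ l (H s)) +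
      ((-cgf X μ (-(κ * (R * C))) : ℝ) : EReal)).toENNReal : ℝ≥0∞) : EReal) -
      ((-cgf X μ (-(κ * (R * C))) : ℝ) : EReal) := by
  have hT : 0 ≤ κ * (R * C) :=
    mul_nonneg hκ (mul_nonneg ((norm_nonneg _).trans hl) ((norm_nonneg _).trans (hC 0)))
  refine unitIntegral_eq_lintegral_sub ?_ ?_ fun s _ => ?_
  · linarith [cgf_nonpos (μ := μ) hX hpos (by linarith : -(κ * (R * C)) ≤ 0)]
  · exact (measurable_logMGF hX).comp ((measurable_const.inner hH).const_mul κ)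
  · exact neg_le_logMGF hX hpos hT (abs_mul_inner_le hκ hC hl s)

lemma avgLogMGF_ne_bot (hX : Measurable X) (hpos : ∀ᵐ ω ∂μ, 0 ≤ X ω) (hκ : 0 ≤ κ)
    (hH : Measurable H) (hC : ∀ s, ‖H s‖ ≤ C) (l : E) : avgLogMGF μ X κ H l ≠ ⊥ := by
  rw [avgLogMGF_eq hX hpos hκ hH hC le_rfl, sub_eq_add_neg, ← EReal.coe_neg, Ne,
    EReal.add_eq_bot_iff]
  simp

lemma avgLogMGF_zero : avgLogMGF μ X κ H 0 = 0 := by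
  have : (fun s : ℝ => logMGF μ X (κ * inner ℝ (0 : E) (H s))) = fun _ => 0 := by
    funext s; rw [inner_zero_left, mul_zero, logMGF_zero]
  rw [avgLogMGF, this, unitIntegral]
  simp

lemma avgLogMGF_zero_left (l : E) : avgLogMGF μ X 0 H l = 0 := by
  have : (fun s : ℝ => logMGF μ X (0 * inner ℝ l (H s))) = fun _ => 0 := by
    funext s; rw [zero_mul, logMGF_zero]
  rw [avgLogMGF, this, unitIntegral]
  simp

lemma coe_ennreal_sub_le_iff {J : ℝ≥0∞} {B p : ℝ} :
    (J : EReal) - (B : EReal) ≤ (p : EReal) ↔ J ≤ ENNReal.ofReal (p + B) ∧ 0 ≤ p + B := by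
  constructor
  · intro h
    have hJ : J ≠ ⊤ := by
      rintro rfl
      simp at h
    lift J to NNReal using hJ
    change ((J : ℝ) : EReal) - (B : EReal) ≤ p at h
    have h' : (J : ℝ) - B ≤ p := by exact_mod_cast h
    have hJ0 : (0 : ℝ) ≤ J := J.coe_nonneg
    refine ⟨?_, by linarith⟩
    rw [← ENNReal.ofReal_coe_nnreal]
    exact ENNReal.ofReal_le_ofReal (by linarith)
  · rintro ⟨h, h0⟩
    have hJ : J ≠ ⊤ := ne_top_of_le_ne_top ENNReal.ofReal_ne_top h
    lift J to NNReal using hJ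
    have h' := ENNReal.toReal_mono ENNReal.ofReal_ne_top h
    rw [ENNReal.toReal_ofReal h0, ENNReal.coe_toReal] at h'
    change ((J : ℝ) : EReal) - (B : EReal) ≤ p
    exact_mod_cast (by linarith : (J : ℝ) - B ≤ p)

lemma toENNReal_logMGF_convex (hX : Measurable X) {B s t a b : ℝ}
    (hs : -(B : EReal) ≤ logMGF μ X s) (ht : -(B : EReal) ≤ logMGF μ X t)
    (ha : 0 ≤ a) (hb : 0 ≤ b) (hab : a + b = 1) :
    (logMGF μ X (a * s + b * t) + (B : EReal)).toENNReal ≤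
      ENNReal.ofReal a * (logMGF μ X s + (B : EReal)).toENNReal +
      ENNReal.ofReal b * (logMGF μ X t + (B : EReal)).toENNReal := by
  rcases eq_or_lt_of_le ha with rfl | ha'
  · have : b = 1 := by linarith
    simp [this]
  rcases eq_or_lt_of_le hb with rfl | hb'
  · have : a = 1 := by linarith
    simp [this]
  by_cases hs' : s ∈ integrableExpSet X μ
  swap
  · rw [logMGF_of_notMem hX hs']
    simp [ENNReal.mul_top, ha']
  by_cases ht' : t ∈ integrableExpSet X μ
  swap
  · rw [logMGF_of_notMem hX ht']
    simp [ENNReal.mul_top, hb']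
  have hc := convexOn_cgf (μ := μ) hX
  have hst := hc.1 hs' ht' ha hb hab
  have h1 := hc.2 hs' ht' ha hb hab
  simp only [smul_eq_mul] at hst h1
  rw [logMGF_of_mem hs', logMGF_of_mem ht', logMGF_of_mem hst]
  rw [logMGF_of_mem hs'] at hs
  rw [logMGF_of_mem ht'] at ht
  have hs2 : -B ≤ cgf X μ s := by exact_mod_cast hs
  have ht2 : -B ≤ cgf X μ t := by exact_mod_cast ht
  simp only [← EReal.coe_add, toENNReal_coe_real]
  rw [← ENNReal.ofReal_mul ha, ← ENNReal.ofReal_mul hb, ← ENNReal.ofReal_add]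
  · refine ENNReal.ofReal_le_ofReal ?_
    have : B = a * B + b * B := by rw [← add_mul, hab, one_mul]
    linarith
  · exact mul_nonneg ha (by linarith)
  · exact mul_nonneg hb (by linarith)

lemma isConvexFun_avgLogMGF (hX : Measurable X) (hpos : ∀ᵐ ω ∂μ, 0 ≤ X ω) (hκ : 0 ≤ κ)
    (hH : Measurable H) (hC : ∀ s, ‖H s‖ ≤ C) : IsConvexFun (avgLogMGF μ X κ H : E → EReal) := by
  rintro ⟨u, p⟩ hu ⟨v, q⟩ hv a b ha hb hab
  simp only [mem_ofPred_eq, Prod.smul_mk, Prod.mk_add_mk, smul_eq_mul] at hu hv ⊢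
  set R := max ‖u‖ ‖v‖
  have huR : ‖u‖ ≤ R := le_max_left _ _
  have hvR : ‖v‖ ≤ R := le_max_right _ _
  have huvR : ‖a • u + b • v‖ ≤ R := by
    have h := convex_closedBall (0 : E) R (mem_closedBall_zero_iff.mpr huR)
      (mem_closedBall_zero_iff.mpr hvR) ha hb hab
    exact mem_closedBall_zero_iff.mp h
  have hT : 0 ≤ κ * (R * C) :=
    mul_nonneg hκ (mul_nonneg ((norm_nonneg _).trans huR) ((norm_nonneg _).trans (hC 0)))
  rw [avgLogMGF_eq hX hpos hκ hH hC huR, coe_ennreal_sub_le_iff] at hu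
  rw [avgLogMGF_eq hX hpos hκ hH hC hvR, coe_ennreal_sub_le_iff] at hv
  rw [avgLogMGF_eq hX hpos hκ hH hC huvR, coe_ennreal_sub_le_iff]
  set B := -cgf X μ (-(κ * (R * C)))
  have hsum : a * p + b * q + B = a * (p + B) + b * (q + B) := by
    have : B = a * B + b * B := by rw [← add_mul, hab, one_mul]
    linarith
  have hmeas : ∀ l : E, Measurable fun s =>
      (logMGF μ X (κ * inner ℝ l (H s)) + (B : EReal)).toENNReal := fun l =>
    (((measurable_logMGF hX).comp ((measurable_const.inner hH).const_mul κ)).add_const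
      (B : EReal)).ereal_toENNReal
  rw [hsum]
  refine ⟨?_, by have := hu.2; have := hv.2; positivity⟩
  calc ∫⁻ s in Ioc (0 : ℝ) 1,
        (logMGF μ X (κ * inner ℝ (a • u + b • v) (H s)) + (B : EReal)).toENNReal
      ≤ ∫⁻ s in Ioc (0 : ℝ) 1,
          (ENNReal.ofReal a * (logMGF μ X (κ * inner ℝ u (H s)) + (B : EReal)).toENNReal +
          ENNReal.ofReal b * (logMGF μ X (κ * inner ℝ v (H s)) + (B : EReal)).toENNReal) := by
        refine lintegral_mono fun s => ?_
        have e : κ * inner ℝ (a • u + b • v) (H s) =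
            a * (κ * inner ℝ u (H s)) + b * (κ * inner ℝ v (H s)) := by
          rw [inner_add_left, real_inner_smul_left, real_inner_smul_left]; ring
        simp only [e]
        exact toENNReal_logMGF_convex hX
          (neg_le_logMGF hX hpos hT (abs_mul_inner_le hκ hC huR s))
          (neg_le_logMGF hX hpos hT (abs_mul_inner_le hκ hC hvR s)) ha hb hab
    _ = ENNReal.ofReal a * (∫⁻ s in Ioc (0 : ℝ) 1,
          (logMGF μ X (κ * inner ℝ u (H s)) + (B : EReal)).toENNReal) +
        ENNReal.ofReal b * ∫⁻ s in Ioc (0 : ℝ) 1,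
          (logMGF μ X (κ * inner ℝ v (H s)) + (B : EReal)).toENNReal := by
        rw [lintegral_add_left ((hmeas u).const_mul _), lintegral_const_mul _ (hmeas u),
          lintegral_const_mul _ (hmeas v)]
    _ ≤ ENNReal.ofReal a * ENNReal.ofReal (p + B) + ENNReal.ofReal b * ENNReal.ofReal (q + B) := by
        gcongr
        · exact hu.1
        · exact hv.1
    _ = ENNReal.ofReal (a * (p + B) + b * (q + B)) := by
        rw [← ENNReal.ofReal_mul ha, ← ENNReal.ofReal_mul hb, ENNReal.ofReal_add]
        · exact mul_nonneg ha hu.2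
        · exact mul_nonneg hb hv.2

lemma lowerSemicontinuous_toENNReal_logMGF_add (hX : Measurable X) (B : ℝ) :
    LowerSemicontinuous fun t => (logMGF μ X t + (B : EReal)).toENNReal := by
  have h1 : LowerSemicontinuous fun t => logMGF μ X t + (B : EReal) := by
    refine (lowerSemicontinuous_logMGF hX).add' lowerSemicontinuous_const fun t => ?_
    exact EReal.continuousAt_add (Or.inr (EReal.coe_ne_bot _)) (Or.inr (EReal.coe_ne_top _))
  exact EReal.continuous_toENNReal.comp_lowerSemicontinuous h1
    fun _ _ h => EReal.toENNReal_le_toENNReal h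

lemma lowerSemicontinuous_avgLogMGF (hX : Measurable X) (hpos : ∀ᵐ ω ∂μ, 0 ≤ X ω) (hκ : 0 ≤ κ)
    (hH : Measurable H) (hC : ∀ s, ‖H s‖ ≤ C) :
    LowerSemicontinuous (avgLogMGF μ X κ H : E → EReal) := by
  intro l₀ y hy
  set R := ‖l₀‖ + 1
  have hnear : ∀ᶠ l in 𝓝 l₀, ‖l‖ ≤ R :=
    (continuous_norm.continuousAt.eventually (gt_mem_nhds (lt_add_one ‖l₀‖))).mono
      fun _ h => le_of_lt h
  rw [avgLogMGF_eq hX hpos hκ hH hC (by linarith [norm_nonneg l₀] : ‖l₀‖ ≤ R)] at hy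
  set B := -cgf X μ (-(κ * (R * C))) with hB
  set J : E → ℝ≥0∞ := fun l => ∫⁻ s in Ioc (0 : ℝ) 1,
    (logMGF μ X (κ * inner ℝ l (H s)) + (B : EReal)).toENNReal with hJ
  have hmeas : ∀ l : E, Measurable fun s =>
      (logMGF μ X (κ * inner ℝ l (H s)) + (B : EReal)).toENNReal := fun l =>
    (((measurable_logMGF hX).comp ((measurable_const.inner hH).const_mul κ)).add_const
      (B : EReal)).ereal_toENNReal
  have hJlsc : LowerSemicontinuous J := by
    rw [lowerSemicontinuous_iff_le_liminf]
    intro l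
    refine le_trans (lintegral_mono fun s => ?_) (lintegral_liminf_le hmeas)
    have hcomp : LowerSemicontinuous fun l' : E =>
        (logMGF μ X (κ * inner ℝ l' (H s)) + (B : EReal)).toENNReal :=
      (lowerSemicontinuous_toENNReal_logMGF_add hX B).comp
        (by fun_prop : Continuous fun l' : E => κ * inner ℝ l' (H s))
    exact lowerSemicontinuous_iff_le_liminf.mp hcomp l
  have hlsc : LowerSemicontinuous fun l => (J l : EReal) - (B : EReal) := by
    have h1 : LowerSemicontinuous fun l => (J l : EReal) :=
      continuous_coe_ennreal_ereal.comp_lowerSemicontinuous hJlsc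
        fun _ _ h => EReal.coe_ennreal_le_coe_ennreal_iff.mpr h
    simp_rw [sub_eq_add_neg, ← EReal.coe_neg]
    refine h1.add' lowerSemicontinuous_const fun t => ?_
    exact EReal.continuousAt_add (Or.inr (EReal.coe_ne_bot _)) (Or.inr (EReal.coe_ne_top _))
  filter_upwards [hnear, hlsc l₀ y hy] with l hl h
  rwa [avgLogMGF_eq hX hpos hκ hH hC hl]

/-- In the effective domain almost every argument `κ l · H(s)` has a finite exponential moment. -/
lemma ae_mem_integrableExpSet (hX : Measurable X) (hpos : ∀ᵐ ω ∂μ, 0 ≤ X ω) (hκ : 0 ≤ κ)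
    (hH : Measurable H) (hC : ∀ s, ‖H s‖ ≤ C) {l : E} (hl : l ∈ effDomain (avgLogMGF μ X κ H)) :
    ∀ᵐ s ∂volume.restrict (Ioc (0 : ℝ) 1), κ * inner ℝ l (H s) ∈ integrableExpSet X μ := by
  rw [effDomain, mem_ofPred_eq, avgLogMGF_eq hX hpos hκ hH hC le_rfl] at hl
  set B := -cgf X μ (-(κ * (‖l‖ * C)))
  have hfin : ∫⁻ s in Ioc (0 : ℝ) 1,
      (logMGF μ X (κ * inner ℝ l (H s)) + (B : EReal)).toENNReal ≠ ⊤ := by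
    intro h
    rw [h] at hl
    simp at hl
  have hmeas : Measurable fun s =>
      (logMGF μ X (κ * inner ℝ l (H s)) + (B : EReal)).toENNReal :=
    (((measurable_logMGF hX).comp ((measurable_const.inner hH).const_mul κ)).add_const
      (B : EReal)).ereal_toENNReal
  filter_upwards [ae_lt_top hmeas hfin] with s hs
  by_contra hcon
  rw [logMGF_of_notMem hX hcon] at hs
  simp at hs

end AvgLogMGF

/-! ### Smoothness of parametric integrals -/

section ParametricIntegral

variable {E : Type*} [NormedAddCommGroup E] [InnerProductSpace ℝ E] [FiniteDimensional ℝ E]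
  [MeasurableSpace E] [BorelSpace E]

lemma hasFDerivAt_integral_comp_inner {k : ℝ → ℝ} {V Q : Set ℝ} (hV : IsOpen V)
    (hk : ContDiffOn ℝ ((⊤ : ℕ∞) : WithTop ℕ∞) k V) (hkm : Measurable k) (hQ : IsCompact Q)
    (hQV : Q ⊆ V) {G : ℝ → E} (hG : Measurable G) {C : ℝ} (hC : ∀ s, ‖G s‖ ≤ C)
    {w : ℝ → ℝ} (hw : Measurable w) {W : ℝ} (hW : ∀ s, |w s| ≤ W) {U : Set E} (hU : IsOpen U)
    (hUQ : ∀ᵐ s ∂volume.restrict (Ioc (0 : ℝ) 1), ∀ l ∈ U, inner ℝ l (G s) ∈ Q) {l : E}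
    (hl : l ∈ U) :
    HasFDerivAt (fun l : E => ∫ s in Ioc (0 : ℝ) 1, w s * k (inner ℝ l (G s)))
      (∑ i, (∫ s in Ioc (0 : ℝ) 1, (w s * inner ℝ (stdOrthonormalBasis ℝ E i) (G s)) *
        deriv k (inner ℝ l (G s))) • innerSL ℝ (stdOrthonormalBasis ℝ E i)) l := by
  have hW0 : 0 ≤ W := (abs_nonneg _).trans (hW 0)
  have hC0 : 0 ≤ C := (norm_nonneg _).trans (hC 0)
  obtain ⟨M, hM⟩ := hQ.exists_bound_of_continuousOn (hk.continuousOn.mono hQV)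
  have hk' : ContinuousOn (deriv k) V := hk.continuousOn_deriv_of_isOpen hV (by simp)
  obtain ⟨M', hM'⟩ := hQ.exists_bound_of_continuousOn (hk'.mono hQV)
  have hin : ∀ l : E, Measurable fun s => inner ℝ l (G s) := fun l => measurable_const.inner hG
  have hmain := hasFDerivAt_integral_of_dominated_of_fderiv_le
    (μ := volume.restrict (Ioc (0 : ℝ) 1)) (𝕜 := ℝ)
    (F := fun (l : E) s => w s * k (inner ℝ l (G s)))
    (F' := fun (l : E) s => (w s * deriv k (inner ℝ l (G s))) • innerSL ℝ (G s))
    (x₀ := l) (s := U) (bound := fun _ => W * M' * C) (hU.mem_nhds hl)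
    (Eventually.of_forall fun l' => (hw.mul (hkm.comp (hin l'))).aestronglyMeasurable)
    (by
      refine Measure.integrableOn_of_bounded (M := W * M) (by simp)
        (hw.mul (hkm.comp (hin l))).aestronglyMeasurable ?_
      filter_upwards [hUQ] with s hs
      rw [norm_mul]
      exact mul_le_mul (hW s) (hM _ (hs l hl)) (norm_nonneg _) hW0)
    (by
      have h1 : Measurable fun s => innerSL ℝ (G s) := (innerSL ℝ).continuous.measurable.comp hG
      exact ((hw.mul ((measurable_deriv k).comp (hin l))).smul h1).aestronglyMeasurable)
    (by
      filter_upwards [hUQ] with s hs l' hl'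
      have h1 : ‖w s * deriv k (inner ℝ l' (G s))‖ ≤ W * M' := by
        rw [norm_mul]
        exact mul_le_mul (hW s) (hM' _ (hs l' hl')) (norm_nonneg _) hW0
      rw [norm_smul, innerSL_apply_norm]
      exact mul_le_mul h1 (hC s) (norm_nonneg _) ((norm_nonneg _).trans h1))
    (integrable_const _)
    (by
      filter_upwards [hUQ] with s hs l' hl'
      have hx : inner ℝ l' (G s) ∈ V := hQV (hs l' hl')
      have h1 : HasDerivAt k (deriv k (inner ℝ l' (G s))) (inner ℝ l' (G s)) :=
        ((hk.contDiffAt (hV.mem_nhds hx)).differentiableAt (by simp)).hasDerivAt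
      have h2 : HasFDerivAt (fun l : E => inner ℝ l (G s)) (innerSL ℝ (G s)) l' := by
        have := (innerSL ℝ (G s)).hasFDerivAt (x := l')
        refine this.congr_of_eventuallyEq (Eventually.of_forall fun v => ?_)
        simp [real_inner_comm]
      have h3 := (h1.comp_hasFDerivAt l' h2).const_mul (w s)
      rwa [smul_smul] at h3)
  refine hmain.congr_fderiv ?_
  set e := stdOrthonormalBasis ℝ E
  have hexp : ∀ s, (w s * deriv k (inner ℝ l (G s))) • innerSL ℝ (G s) =
      ∑ i, ((w s * inner ℝ (e i) (G s)) * deriv k (inner ℝ l (G s))) • innerSL ℝ (e i) := by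
    intro s
    have h : innerSL ℝ (G s) = ∑ i, inner ℝ (e i) (G s) • innerSL ℝ (e i) := by
      conv_lhs => rw [← e.sum_repr' (G s)]
      simp only [map_sum, map_smul]
    rw [h, Finset.smul_sum]
    refine Finset.sum_congr rfl fun i _ => ?_
    rw [smul_smul]
    congr 1; ring
  simp_rw [hexp]
  rw [integral_finsetSum]
  · refine Finset.sum_congr rfl fun i _ => ?_
    rw [integral_smul_const]
  · intro i _
    refine Integrable.smul_const ?_ _
    refine Measure.integrableOn_of_bounded (M := W * C * M') (by simp)
      ((hw.mul (hin _)).mul ((measurable_deriv k).comp (hin l))).aestronglyMeasurable ?_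
    filter_upwards [hUQ] with s hs
    rw [norm_mul, norm_mul]
    have h1 : ‖inner ℝ (e i) (G s)‖ ≤ C := by
      refine (norm_inner_le_norm _ _).trans ?_
      rw [e.norm_eq_one, one_mul]
      exact hC s
    exact mul_le_mul (mul_le_mul (hW s) h1 (norm_nonneg _) hW0) (hM' _ (hs l hl)) (norm_nonneg _)
      (by positivity)

/-- Parametric integrals `l ↦ ∫ w(s) k(l · G(s)) ds` of a smooth function `k` are smooth. -/
lemma contDiffOn_integral_comp_inner (n : ℕ) {k : ℝ → ℝ} {V Q : Set ℝ} (hV : IsOpen V)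
    (hk : ContDiffOn ℝ ((⊤ : ℕ∞) : WithTop ℕ∞) k V) (hkm : Measurable k) (hQ : IsCompact Q)
    (hQV : Q ⊆ V) {G : ℝ → E} (hG : Measurable G) {C : ℝ} (hC : ∀ s, ‖G s‖ ≤ C)
    {w : ℝ → ℝ} (hw : Measurable w) {W : ℝ} (hW : ∀ s, |w s| ≤ W) {U : Set E} (hU : IsOpen U)
    (hUQ : ∀ᵐ s ∂volume.restrict (Ioc (0 : ℝ) 1), ∀ l ∈ U, inner ℝ l (G s) ∈ Q) :
    ContDiffOn ℝ n (fun l : E => ∫ s in Ioc (0 : ℝ) 1, w s * k (inner ℝ l (G s))) U := by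
  induction n generalizing k w W with
  | zero =>
    refine contDiffOn_zero.mpr fun l hl => ?_
    exact (hasFDerivAt_integral_comp_inner hV hk hkm hQ hQV hG hC hw hW hU hUQ
      hl).continuousAt.continuousWithinAt
  | succ n ih =>
    have hder := fun l (hl : l ∈ U) =>
      hasFDerivAt_integral_comp_inner hV hk hkm hQ hQV hG hC hw hW hU hUQ hl
    have hn : ((n + 1 : ℕ) : WithTop ℕ∞) = (n : WithTop ℕ∞) + 1 := by norm_cast
    rw [hn, contDiffOn_succ_iff_fderiv_of_isOpen hU]
    refine ⟨fun l hl => (hder l hl).differentiableAt.differentiableWithinAt, by simp, ?_⟩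
    refine ContDiffOn.congr ?_ fun l hl => (hder l hl).fderiv
    refine ContDiffOn.sum fun i _ => ContDiffOn.fun_smul ?_ contDiffOn_const
    refine ih (W := W * C) (hk.deriv_of_isOpen hV (by simp)) (measurable_deriv k)
      (hw.mul (measurable_const.inner hG)) fun s => ?_
    rw [abs_mul]
    refine mul_le_mul (hW s) ?_ (abs_nonneg _) ((abs_nonneg _).trans (hW s))
    refine (abs_real_inner_le_norm _ _).trans ?_
    rw [(stdOrthonormalBasis ℝ E).norm_eq_one, one_mul]
    exact hC s

end ParametricIntegral

/-! ### Smoothness of the averaged logarithmic moment generating function -/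

section AvgLogMGFSmooth

set_option linter.unusedSectionVars false

variable {Ω : Type*} [MeasurableSpace Ω] {μ : Measure Ω} [IsProbabilityMeasure μ] {X : Ω → ℝ}
variable {E : Type*} [NormedAddCommGroup E] [InnerProductSpace ℝ E] [FiniteDimensional ℝ E]
  [MeasurableSpace E] [BorelSpace E]
variable {κ C : ℝ} {H : ℝ → E}

/-- At an interior point of the effective domain the arguments `κ l · H(s)` stay away from the
right end of the interval of finite exponential moments: a small step in the direction `e` raises
all of them by the same amount without leaving the domain. -/
lemma exists_bound_of_mem_interior (hX : Measurable X) (hpos : ∀ᵐ ω ∂μ, 0 ≤ X ω) (hκ : 0 < κ)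
    (hH : Measurable H) (hC : ∀ s, ‖H s‖ ≤ C) {e : E} (he : ∀ s ∈ Ioc (0 : ℝ) 1, inner ℝ e (H s) = 1)
    {l : E} (hl : l ∈ interior (effDomain (avgLogMGF μ X κ H))) :
    ∃ c ε : ℝ, 0 < ε ∧ Iio (c + 2 * ε) ⊆ integrableExpSet X μ ∧
      ∀ᵐ s ∂volume.restrict (Ioc (0 : ℝ) 1), κ * inner ℝ l (H s) ≤ c := by
  have hev : ∀ᶠ δ : ℝ in 𝓝[>] 0, l + δ • e ∈ effDomain (avgLogMGF μ X κ H) := by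
    have hc : Tendsto (fun t : ℝ => l + t • e) (𝓝[>] 0) (𝓝 l) := by
      have : Continuous fun t : ℝ => l + t • e := by fun_prop
      exact (this.tendsto' 0 l (by simp)).mono_left nhdsWithin_le_nhds
    exact hc.eventually (mem_interior_iff_mem_nhds.mp hl)
  obtain ⟨δ, hδD, hδ⟩ := (hev.and self_mem_nhdsWithin).exists
  have hδ : 0 < δ := hδ
  have hae := ae_mem_integrableExpSet hX hpos hκ.le hH hC hδD
  have hae' : ∀ᵐ s ∂volume.restrict (Ioc (0 : ℝ) 1),
      κ * inner ℝ l (H s) + κ * δ ∈ integrableExpSet X μ := by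
    filter_upwards [hae, ae_restrict_mem measurableSet_Ioc] with s hs hs'
    rwa [inner_add_left, real_inner_smul_left, he s hs', mul_one, mul_add] at hs
  set V : Set ℝ := {v | v ∈ integrableExpSet X μ ∧ ∃ s, v = κ * inner ℝ l (H s) + κ * δ} with hV
  have : (ae (volume.restrict (Ioc (0 : ℝ) 1))).NeBot := by
    rw [ae_neBot]; intro h
    have := congrArg (fun m => m univ) h
    simp at this
  obtain ⟨s₀, hs₀⟩ := hae'.exists
  have hVne : V.Nonempty := ⟨_, hs₀, s₀, rfl⟩
  have hVbdd : BddAbove V := by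
    refine ⟨κ * (‖l‖ * C) + κ * δ, ?_⟩
    rintro v ⟨-, s, rfl⟩
    have := (le_abs_self _).trans (abs_mul_inner_le hκ.le hC (le_refl ‖l‖) s)
    linarith
  have hκδ : 0 < κ * δ := mul_pos hκ hδ
  obtain ⟨v, hvV, hv⟩ := exists_lt_of_lt_csSup hVne
    (by linarith : sSup V - κ * δ / 2 < sSup V)
  refine ⟨v - κ * δ / 2, κ * δ / 4, by positivity, ?_, ?_⟩
  · intro t ht
    rw [mem_Iio] at ht
    exact mem_integrableExpSet_of_le hX hpos (by linarith : t ≤ v) hvV.1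
  · filter_upwards [hae'] with s hs
    have := le_csSup hVbdd (⟨hs, s, rfl⟩ : κ * inner ℝ l (H s) + κ * δ ∈ V)
    linarith

lemma measurable_cgf (hX : Measurable X) : Measurable (cgf X μ) := by
  rw [← toReal_logMGF hX]
  exact (measurable_logMGF hX).ereal_toReal

lemma avgLogMGF_eq_integral (hX : Measurable X) (hpos : ∀ᵐ ω ∂μ, 0 ≤ X ω) (hκ : 0 ≤ κ)
    (hH : Measurable H) (hC : ∀ s, ‖H s‖ ≤ C) {l : E} {c : ℝ} (hc : c ∈ integrableExpSet X μ)
    (hl : ∀ᵐ s ∂volume.restrict (Ioc (0 : ℝ) 1), κ * inner ℝ l (H s) ≤ c) :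
    avgLogMGF μ X κ H l =
      ((∫ s in Ioc (0 : ℝ) 1, cgf X μ (κ * inner ℝ l (H s)) : ℝ) : EReal) := by
  set T := κ * (‖l‖ * C)
  have hT : 0 ≤ T :=
    mul_nonneg hκ (mul_nonneg (norm_nonneg _) ((norm_nonneg _).trans (hC 0)))
  refine unitIntegral_coe ?_ ?_
  · filter_upwards [hl] with s hs
    exact logMGF_of_mem (mem_integrableExpSet_of_le hX hpos hs hc)
  · refine Measure.integrableOn_of_bounded (M := max (-cgf X μ (-T)) (cgf X μ c)) (by simp)
      ((measurable_cgf hX).comp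
        ((measurable_const.inner hH).const_mul κ)).aestronglyMeasurable ?_
    filter_upwards [hl] with s hs
    have h1 := cgf_mono hX hpos hs hc
    have h2 := cgf_mono hX hpos (neg_le_of_abs_le (abs_mul_inner_le hκ hC (le_refl ‖l‖) s))
      (mem_integrableExpSet_of_le hX hpos hs hc)
    rw [Real.norm_eq_abs, abs_le]
    exact ⟨by have := le_max_left (-cgf X μ (-T)) (cgf X μ c); linarith,
      h1.trans (le_max_right _ _)⟩

/-- If the arguments at `l` stay away from the right end, then so do the arguments at the nearby
points. -/
lemma nearby_bound (hκ : 0 ≤ κ) (hC : ∀ s, ‖H s‖ ≤ C) {l : E} {c ε : ℝ} (hε : 0 < ε)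
    (hl : ∀ᵐ s ∂volume.restrict (Ioc (0 : ℝ) 1), κ * inner ℝ l (H s) ≤ c) :
    ∃ ρ > 0, ∀ᵐ s ∂volume.restrict (Ioc (0 : ℝ) 1), ∀ l' ∈ Metric.ball l ρ,
      κ * inner ℝ l' (H s) ∈ Icc (-(κ * ((‖l‖ + ρ) * C))) (c + ε) := by
  have hC0 : 0 ≤ C := (norm_nonneg _).trans (hC 0)
  refine ⟨ε / (κ * C + 1), by positivity, ?_⟩
  set ρ := ε / (κ * C + 1) with hρ
  filter_upwards [hl] with s hs l' hl'
  have hd : ‖l' - l‖ ≤ ρ := (mem_ball_iff_norm.mp hl').le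
  have hn : ‖l'‖ ≤ ‖l‖ + ρ := by
    calc ‖l'‖ = ‖l + (l' - l)‖ := by congr 1; abel
      _ ≤ ‖l‖ + ‖l' - l‖ := norm_add_le _ _
      _ ≤ _ := by gcongr
  refine ⟨neg_le_of_abs_le (abs_mul_inner_le hκ hC hn s), ?_⟩
  have h1 := (le_abs_self _).trans (abs_mul_inner_le hκ hC hd s)
  have h2 : κ * (ρ * C) ≤ ε := by
    have : κ * (ρ * C) = ε * (κ * C / (κ * C + 1)) := by rw [hρ]; field_simp
    rw [this]
    have h3 : κ * C / (κ * C + 1) ≤ 1 := by rw [div_le_one (by positivity)]; linarith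
    nlinarith
  rw [inner_sub_left, mul_sub] at h1
  linarith

lemma contDiffAt_avgLogMGF (hX : Measurable X) (hpos : ∀ᵐ ω ∂μ, 0 ≤ X ω) (hκ : 0 ≤ κ)
    (hH : Measurable H) (hC : ∀ s, ‖H s‖ ≤ C) {l : E} {c ε : ℝ} (hε : 0 < ε)
    (hc : Iio (c + 2 * ε) ⊆ integrableExpSet X μ)
    (hl : ∀ᵐ s ∂volume.restrict (Ioc (0 : ℝ) 1), κ * inner ℝ l (H s) ≤ c) :
    l ∈ interior (effDomain (avgLogMGF μ X κ H)) ∧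
    ContDiffAt ℝ ((⊤ : ℕ∞) : WithTop ℕ∞) (fun l => (avgLogMGF μ X κ H l).toReal) l := by
  obtain ⟨ρ, hρ, hnear⟩ := nearby_bound hκ hC hε hl
  have hmem : c + ε ∈ integrableExpSet X μ := hc (by rw [mem_Iio]; linarith)
  have hformula : ∀ l' ∈ Metric.ball l ρ, avgLogMGF μ X κ H l' =
      ((∫ s in Ioc (0 : ℝ) 1, cgf X μ (κ * inner ℝ l' (H s)) : ℝ) : EReal) := by
    intro l' hl'
    refine avgLogMGF_eq_integral hX hpos hκ hH hC hmem ?_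
    filter_upwards [hnear] with s hs using (hs l' hl').2
  refine ⟨?_, ?_⟩
  · rw [mem_interior_iff_mem_nhds]
    filter_upwards [Metric.ball_mem_nhds l hρ] with l' hl'
    rw [effDomain, mem_ofPred_eq, hformula l' hl']
    exact EReal.coe_lt_top _
  · have hsm : ContDiffOn ℝ ((⊤ : ℕ∞) : WithTop ℕ∞)
        (fun l : E => ∫ s in Ioc (0 : ℝ) 1, (1 : ℝ) * cgf X μ (inner ℝ l (κ • H s)))
        (Metric.ball l ρ) := by
      rw [contDiffOn_infty]
      intro n
      refine contDiffOn_integral_comp_inner n (V := Iio (c + 2 * ε)) isOpen_Iio ?_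
        (measurable_cgf hX) (isCompact_Icc (a := -(κ * ((‖l‖ + ρ) * C))) (b := c + ε)) ?_
        (hH.const_smul κ) (C := κ * C) ?_ measurable_const (W := 1) (by simp)
        Metric.isOpen_ball ?_
      · exact (analyticOn_cgf.mono (interior_maximal hc isOpen_Iio)).contDiffOn
          (uniqueDiffOn_Iio _)
      · intro t ht
        rw [mem_Iio]; linarith [ht.2]
      · intro s
        rw [Pi.smul_apply, norm_smul, Real.norm_of_nonneg hκ]
        exact mul_le_mul_of_nonneg_left (hC s) hκ
      · filter_upwards [hnear] with s hs l' hl'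
        rw [Pi.smul_apply, inner_smul_right]
        exact hs l' hl'
    have hat := hsm.contDiffAt (Metric.ball_mem_nhds l hρ)
    refine hat.congr_of_eventuallyEq ?_
    filter_upwards [Metric.ball_mem_nhds l hρ] with l' hl'
    rw [hformula l' hl', EReal.toReal_coe]
    simp only [one_mul, inner_smul_right]

lemma contDiffOn_avgLogMGF (hX : Measurable X) (hpos : ∀ᵐ ω ∂μ, 0 ≤ X ω) (hκ : 0 ≤ κ)
    (hH : Measurable H) (hC : ∀ s, ‖H s‖ ≤ C) {e : E}
    (he : ∀ s ∈ Ioc (0 : ℝ) 1, inner ℝ e (H s) = 1) :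
    ContDiffOn ℝ ((⊤ : ℕ∞) : WithTop ℕ∞) (fun l => (avgLogMGF μ X κ H l).toReal)
      (interior (effDomain (avgLogMGF μ X κ H))) := by
  rcases eq_or_lt_of_le hκ with rfl | hκ'
  · have : (fun l : E => (avgLogMGF μ X 0 H l).toReal) = fun _ => 0 := by
      funext l; rw [avgLogMGF_zero_left, EReal.toReal_zero]
    rw [this]
    exact contDiffOn_const
  · intro l hl
    obtain ⟨c, ε, hε, hc, hlc⟩ := exists_bound_of_mem_interior hX hpos hκ' hH hC he hl
    exact (contDiffAt_avgLogMGF hX hpos hκ hH hC hε hc hlc).2.contDiffWithinAt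

lemma avgLogMGF_smooth_of_finite (hX : Measurable X) (hpos : ∀ᵐ ω ∂μ, 0 ≤ X ω) (hκ : 0 ≤ κ)
    (hH : Measurable H) (hC : ∀ s, ‖H s‖ ≤ C) (hfin : ∀ t : ℝ, logMGF μ X t < ⊤) :
    (∀ l : E, avgLogMGF μ X κ H l < ⊤) ∧
      ContDiff ℝ ((⊤ : ℕ∞) : WithTop ℕ∞) (fun l : E => (avgLogMGF μ X κ H l).toReal) := by
  have hS : ∀ t, t ∈ integrableExpSet X μ := by
    intro t
    rw [← effDomain_logMGF hX]
    exact hfin t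
  have key := fun l : E => contDiffAt_avgLogMGF (l := l) hX hpos hκ hH hC one_pos
    (c := κ * (‖l‖ * C)) (fun t _ => hS t)
    (Eventually.of_forall fun s => (le_abs_self _).trans (abs_mul_inner_le hκ hC le_rfl s))
  have hD : ∀ l : E, l ∈ effDomain (avgLogMGF μ X κ H) := fun l => interior_subset (key l).1
  exact ⟨hD, contDiff_iff_contDiffAt.mpr fun l => (key l).2⟩

end AvgLogMGFSmooth

/-! ### Almost sure convergence of the convolution series -/

section RandomSeries

set_option linter.unusedSectionVars false

variable {Ω : Type*} [MeasurableSpace Ω] {μ : Measure Ω} [IsProbabilityMeasure μ]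
variable {h : ℤ → ℝ} {β : ℤ → Ω → ℝ}

/-- The characteristic function of a finite sum of the independent terms `a_i β_{e(i)}`. -/
lemma charFun_map_sum (β_meas : ∀ m, Measurable (β m))
    (β_indep : iIndepFun β μ) (β_ident : ∀ m, IdentDistrib (β m) (β 0) μ μ)
    (a : ℤ → ℝ) {e : ℤ → ℤ} (he : Function.Injective e) (T : Finset ℤ) (t : ℝ) :
    charFun (μ.map (fun ω => ∑ k ∈ T, a k * β (e k) ω)) t =
      ∏ k ∈ T, ∫ ω, Complex.exp (((t * a k * β 0 ω : ℝ) : ℂ) * Complex.I) ∂μ := by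
  have hm : Measurable fun ω => ∑ k ∈ T, a k * β (e k) ω :=
    Finset.measurable_sum _ fun k _ => (β_meas _).const_mul _
  rw [charFun_apply_real, integral_map hm.aemeasurable (by fun_prop)]
  have hind : iIndepFun (fun k : T => β (e k)) μ :=
    β_indep.precomp (g := fun k : T => e k) (he.comp Subtype.val_injective)
  have hprod := hind.integral_fun_prod_comp (𝕜 := ℂ)
    (f := fun (k : T) (y : ℝ) => Complex.exp (((t * a k * y : ℝ) : ℂ) * Complex.I))
    (fun k => (β_meas _).aemeasurable) (fun k => by fun_prop)
  rw [← Finset.prod_coe_sort T]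
  have h1 : ∀ k : T, ∫ ω, Complex.exp (((t * a k * β (e k) ω : ℝ) : ℂ) * Complex.I) ∂μ =
      ∫ ω, Complex.exp (((t * a k * β 0 ω : ℝ) : ℂ) * Complex.I) ∂μ := by
    intro k
    have := (β_ident (e k)).comp (u := fun y : ℝ => Complex.exp (((t * a k * y : ℝ) : ℂ) * Complex.I))
      (by fun_prop)
    exact this.integral_eq
  rw [← Finset.prod_congr rfl fun k _ => h1 k, ← hprod]
  refine integral_congr_ae (Eventually.of_forall fun ω => ?_)
  simp only
  rw [← Complex.exp_sum, ← Finset.sum_coe_sort T]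
  congr 1
  push_cast
  rw [Finset.mul_sum, Finset.sum_mul]
  exact Finset.sum_congr rfl fun k _ => by ring

/-- The series `γ_n = ∑ h_{n-m} β_m` converge almost surely: the laws of the partial sums are
tight, by the continuity of the limiting characteristic function. -/
lemma ae_summable_gam (h_nonneg : ∀ k, 0 ≤ h k)
    (β_meas : ∀ m, Measurable (β m)) (β_nonneg : ∀ m, ∀ᵐ ω ∂μ, 0 ≤ β m ω)
    (β_indep : iIndepFun β μ) (β_ident : ∀ m, IdentDistrib (β m) (β 0) μ μ)
    (γ_def : HasContinuousLimitCharFun μ h (β 0)) :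
    ∀ᵐ ω ∂μ, ∀ n : ℤ, Summable fun m => h (n - m) * β m ω := by
  rw [ae_all_iff]
  intro n
  have hpos : ∀ᵐ ω ∂μ, ∀ m, 0 ≤ β m ω := ae_all_iff.mpr β_nonneg
  set S : ℕ → Ω → ℝ := fun M ω => ∑ k ∈ Finset.Ioo (-(M : ℤ)) M, h k * β (n - k) ω with hS
  have hSm : ∀ M, Measurable (S M) := fun M =>
    Finset.measurable_sum _ fun k _ => (β_meas _).const_mul _
  obtain ⟨φ, hφc, hφ⟩ := γ_def
  have : ∀ M, IsProbabilityMeasure (μ.map (S M)) := fun M =>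
    Measure.isProbabilityMeasure_map (hSm M).aemeasurable
  have htight : IsTightMeasureSet (Set.range fun M => μ.map (S M)) := by
    refine isTightMeasureSet_of_tendsto_charFun hφc.continuousAt fun t => ?_
    refine (hφ t).congr fun M => ?_
    exact (charFun_map_sum β_meas β_indep β_ident h (sub_right_injective (b := n)) _ t).symm
  have htend := tendsto_measure_norm_gt_of_isTightMeasureSet htight
  -- the exceptional set has arbitrarily small measure
  set B : Set Ω := {ω | (∀ m, 0 ≤ β m ω) ∧ ¬ Summable fun m => h (n - m) * β m ω} with hB
  have hmono : ∀ ω, (∀ m, 0 ≤ β m ω) → Monotone fun M => S M ω := by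
    intro ω hω M M' hMM'
    refine Finset.sum_le_sum_of_subset_of_nonneg ?_ fun k _ _ => mul_nonneg (h_nonneg k) (hω _)
    intro k hk
    rw [Finset.mem_Ioo] at hk ⊢
    omega
  have hle : ∀ r : ℝ, μ B ≤ ⨆ ν ∈ Set.range fun M => μ.map (S M), ν {x | r < ‖x‖} := by
    intro r
    have hsub : B ⊆ ⋃ M, {ω | (∀ m, 0 ≤ β m ω) ∧ r < S M ω} := by
      rintro ω ⟨hω, hns⟩
      by_contra hcon
      simp only [mem_iUnion, mem_ofPred_eq, not_exists, not_and, not_lt] at hcon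
      refine hns ?_
      have hsum : Summable fun k => h k * β (n - k) ω := by
        refine summable_of_sum_le (c := r) (fun k => mul_nonneg (h_nonneg k) (hω _)) fun T => ?_
        obtain ⟨M, hM⟩ : ∃ M : ℕ, ∀ k ∈ T, |k| < M := by
          refine ⟨T.sup Int.natAbs + 1, fun k hk => ?_⟩
          have := Finset.le_sup (f := Int.natAbs) hk
          rw [Int.abs_eq_natAbs]
          omega
        refine le_trans ?_ (hcon M hω)
        refine Finset.sum_le_sum_of_subset_of_nonneg ?_ fun k _ _ => mul_nonneg (h_nonneg k) (hω _)
        intro k hk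
        rw [Finset.mem_Ioo]
        exact abs_lt.mp (hM k hk)
      have := (Equiv.subLeft n).summable_iff.mpr hsum
      refine this.congr fun m => ?_
      simp
    refine (measure_mono hsub).trans ?_
    rw [Monotone.measure_iUnion]
    · refine iSup_le fun M => ?_
      refine le_trans ?_ (le_iSup₂ (f := fun (ν : Measure ℝ)
        (_ : ν ∈ Set.range fun M => μ.map (S M)) => ν {x | r < ‖x‖}) (μ.map (S M)) ⟨M, rfl⟩)
      rw [Measure.map_apply (hSm M) (measurableSet_lt measurable_const measurable_norm)]
      refine measure_mono ?_
      rintro ω ⟨-, hω⟩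
      exact hω.trans_le (le_abs_self _)
    · intro M M' hMM' ω hω
      exact ⟨hω.1, hω.2.trans_le (hmono ω hω.1 hMM')⟩
  have hzero : μ B = 0 := le_antisymm (ge_of_tendsto' htend hle) zero_le
  filter_upwards [hpos, measure_eq_zero_iff_ae_notMem.mp hzero] with ω hω hωB
  by_contra hns
  exact hωB ⟨hω, hns⟩

end RandomSeries

/-! ### Exponential moments of random series -/

/-- The moment generating function with values in `[0, ∞]`. -/
noncomputable def expMoment {Ω : Type*} [MeasurableSpace Ω] (μ : Measure Ω) (X : Ω → ℝ) (t : ℝ) :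
    ℝ≥0∞ :=
  ∫⁻ ω, ENNReal.ofReal (Real.exp (t * X ω)) ∂μ

section ExpSeries

set_option linter.unusedSectionVars false

variable {Ω : Type*} [MeasurableSpace Ω] {μ : Measure Ω} [IsProbabilityMeasure μ]
variable {β : ℤ → Ω → ℝ}

lemma logMGF_eq_log_expMoment (X : Ω → ℝ) (t : ℝ) :
    logMGF μ X t = ENNReal.log (expMoment μ X t) := logMGF_real X t

lemma expMoment_of_mem {X : Ω → ℝ} {t : ℝ} (ht : t ∈ integrableExpSet X μ) :
    expMoment μ X t = ENNReal.ofReal (Real.exp (cgf X μ t)) := by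
  have h := logMGF_of_mem ht
  rw [logMGF_eq_log_expMoment, ← Real.log_exp (cgf X μ t),
    ← ENNReal.log_ofReal_of_pos (Real.exp_pos _), ENNReal.log_eq_iff] at h
  exact h

/-- Moment generating function of a finite linear combination of the `β_m`. -/
lemma lintegral_exp_sum (β_meas : ∀ m, Measurable (β m))
    (β_indep : iIndepFun β μ) (β_ident : ∀ m, IdentDistrib (β m) (β 0) μ μ)
    (c : ℤ → ℝ) (T : Finset ℤ) :
    ∫⁻ ω, ENNReal.ofReal (Real.exp (∑ m ∈ T, c m * β m ω)) ∂μ = ∏ m ∈ T, expMoment μ (β 0) (c m) := by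
  have hind : iIndepFun (fun (m : ℤ) ω => ENNReal.ofReal (Real.exp (c m * β m ω))) μ :=
    β_indep.comp (fun m (y : ℝ) => ENNReal.ofReal (Real.exp (c m * y))) fun m => by fun_prop
  have h := lintegral_prod_eq_prod_lintegral_of_indepFun T _ hind fun m => by
    have := β_meas m
    fun_prop
  have h1 : ∀ m, ∫⁻ ω, ENNReal.ofReal (Real.exp (c m * β m ω)) ∂μ = expMoment μ (β 0) (c m) := by
    intro m
    have := (β_ident m).comp (u := fun y : ℝ => ENNReal.ofReal (Real.exp (c m * y))) (by fun_prop)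
    exact this.lintegral_eq
  rw [← Finset.prod_congr rfl fun m _ => h1 m, ← h]
  refine lintegral_congr fun ω => ?_
  rw [Real.exp_sum, ENNReal.ofReal_prod_of_nonneg fun _ _ => (Real.exp_pos _).le]

lemma tendsto_Icc_int : Tendsto (fun K : ℕ => Finset.Icc (-(K : ℤ)) K) atTop atTop := by
  refine tendsto_atTop_finset_of_monotone ?_ fun k => ⟨k.natAbs, ?_⟩
  · intro K K' h k hk
    rw [Finset.mem_Icc] at hk ⊢
    omega
  · rw [Finset.mem_Icc]
    omega

/-- An upper bound for the exponential moment of an infinite series, by Fatou's lemma. -/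
lemma lintegral_exp_tsum_le (β_meas : ∀ m, Measurable (β m))
    (β_indep : iIndepFun β μ) (β_ident : ∀ m, IdentDistrib (β m) (β 0) μ μ)
    {c : ℤ → ℝ} (hsum : ∀ᵐ ω ∂μ, Summable fun m => c m * β m ω) {r : ℕ → ℝ≥0∞} {R : ℝ≥0∞}
    (hr : ∀ K : ℕ, ∏ m ∈ Finset.Icc (-(K : ℤ)) K, expMoment μ (β 0) (c m) ≤ r K)
    (hR : Tendsto r atTop (𝓝 R)) :
    ∫⁻ ω, ENNReal.ofReal (Real.exp (∑' m, c m * β m ω)) ∂μ ≤ R := by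
  have hcont : Continuous fun y : ℝ => ENNReal.ofReal (Real.exp y) :=
    ENNReal.continuous_ofReal.comp Real.continuous_exp
  calc ∫⁻ ω, ENNReal.ofReal (Real.exp (∑' m, c m * β m ω)) ∂μ
      = ∫⁻ ω, liminf (fun K : ℕ => ENNReal.ofReal
          (Real.exp (∑ m ∈ Finset.Icc (-(K : ℤ)) K, c m * β m ω))) atTop ∂μ := by
        refine lintegral_congr_ae ?_
        filter_upwards [hsum] with ω hω
        exact ((hcont.tendsto _).comp (hω.hasSum.comp tendsto_Icc_int)).liminf_eq.symm
    _ ≤ liminf (fun K : ℕ => ∫⁻ ω, ENNReal.ofReal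
          (Real.exp (∑ m ∈ Finset.Icc (-(K : ℤ)) K, c m * β m ω)) ∂μ) atTop :=
        lintegral_liminf_le fun K => hcont.measurable.comp
          (Finset.measurable_sum _ fun m _ => (β_meas m).const_mul _)
    _ ≤ liminf r atTop := by
        refine liminf_le_liminf (Eventually.of_forall fun K => ?_)
        simp only [lintegral_exp_sum β_meas β_indep β_ident]
        exact hr K
    _ = R := hR.liminf_eq

lemma le_lintegral_exp_neg_tsum (β_meas : ∀ m, Measurable (β m))
    (β_nonneg : ∀ m, ∀ᵐ ω ∂μ, 0 ≤ β m ω)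
    (β_indep : iIndepFun β μ) (β_ident : ∀ m, IdentDistrib (β m) (β 0) μ μ)
    {d : ℤ → ℝ} (hd : ∀ m, 0 ≤ d m) (hsum : ∀ᵐ ω ∂μ, Summable fun m => d m * β m ω) {r : ℝ≥0∞}
    (hr : ∀ T : Finset ℤ, r ≤ ∏ m ∈ T, expMoment μ (β 0) (-d m)) :
    r ≤ ∫⁻ ω, ENNReal.ofReal (Real.exp (-∑' m, d m * β m ω)) ∂μ := by
  have hcont : Continuous fun y : ℝ => ENNReal.ofReal (Real.exp (-y)) :=
    ENNReal.continuous_ofReal.comp (Real.continuous_exp.comp continuous_neg)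
  have hpos : ∀ᵐ ω ∂μ, ∀ m, 0 ≤ β m ω := ae_all_iff.mpr β_nonneg
  have hlim := tendsto_lintegral_of_dominated_convergence (μ := μ)
    (F := fun (K : ℕ) ω => ENNReal.ofReal
      (Real.exp (-∑ m ∈ Finset.Icc (-(K : ℤ)) K, d m * β m ω)))
    (f := fun ω => ENNReal.ofReal (Real.exp (-∑' m, d m * β m ω))) (fun _ => 1)
    (fun K => hcont.measurable.comp (Finset.measurable_sum _ fun m _ => (β_meas m).const_mul _))
    (fun K => by
      filter_upwards [hpos] with ω hω
      rw [← ENNReal.ofReal_one]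
      refine ENNReal.ofReal_le_ofReal (Real.exp_le_one_iff.mpr ?_)
      exact neg_nonpos.mpr (Finset.sum_nonneg fun m _ => mul_nonneg (hd m) (hω m)))
    (by simp)
    (by
      filter_upwards [hsum] with ω hω
      exact (hcont.tendsto _).comp (hω.hasSum.comp tendsto_Icc_int))
  refine ge_of_tendsto' hlim fun K => ?_
  have h := lintegral_exp_sum β_meas β_indep β_ident (fun m => -d m) (Finset.Icc (-(K : ℤ)) K)
  simp only [neg_mul, Finset.sum_neg_distrib] at h
  rw [h]
  exact hr _

/-- A lower bound for the exponential moment of an infinite series: finitely many terms are kept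
and the remaining ones, which are independent of them, are bounded below. -/
lemma le_lintegral_exp_tsum (β_meas : ∀ m, Measurable (β m))
    (β_nonneg : ∀ m, ∀ᵐ ω ∂μ, 0 ≤ β m ω)
    (β_indep : iIndepFun β μ) (β_ident : ∀ m, IdentDistrib (β m) (β 0) μ μ)
    {c d : ℤ → ℝ} (hd : ∀ m, 0 ≤ d m) (hcd : ∀ m, |c m| ≤ d m)
    (hsum : ∀ᵐ ω ∂μ, Summable fun m => d m * β m ω) (T : Finset ℤ) {r : ℝ≥0∞}
    (hr : ∀ T' : Finset ℤ, Disjoint T' T → r ≤ ∏ m ∈ T', expMoment μ (β 0) (-d m)) :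
    (∏ m ∈ T, expMoment μ (β 0) (c m)) * r ≤
      ∫⁻ ω, ENNReal.ofReal (Real.exp (∑' m, c m * β m ω)) ∂μ := by
  classical
  -- the weights of the bound for the remaining terms
  set d' : ℤ → ℝ := fun m => if m ∈ T then 0 else d m with hd'
  have hd'0 : ∀ m, 0 ≤ d' m := fun m => by
    simp only [hd']; split_ifs; exacts [le_rfl, hd m]
  have hd'le : ∀ m, d' m ≤ d m := fun m => by
    simp only [hd']; split_ifs; exacts [hd m, le_rfl]
  have hpos : ∀ᵐ ω ∂μ, ∀ m, 0 ≤ β m ω := ae_all_iff.mpr β_nonneg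
  have hsum' : ∀ᵐ ω ∂μ, Summable fun m => d' m * β m ω := by
    filter_upwards [hsum, hpos] with ω hω hp
    exact hω.of_nonneg_of_le (fun m => mul_nonneg (hd'0 m) (hp m))
      fun m => mul_le_mul_of_nonneg_right (hd'le m) (hp m)
  have hr' : r ≤ ∫⁻ ω, ENNReal.ofReal (Real.exp (-∑' m, d' m * β m ω)) ∂μ := by
    refine le_lintegral_exp_neg_tsum β_meas β_nonneg β_indep β_ident hd'0 hsum' fun T' => ?_
    rw [← Finset.prod_filter_mul_prod_filter_not T' (· ∈ T)]
    have h1 : ∏ m ∈ T' with m ∈ T, expMoment μ (β 0) (-d' m) = 1 := by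
      refine Finset.prod_eq_one fun m hm => ?_
      have : d' m = 0 := if_pos (Finset.mem_filter.mp hm).2
      simp [this, expMoment]
    rw [h1, one_mul]
    refine (hr (T'.filter (· ∉ T)) ?_).trans_eq (Finset.prod_congr rfl fun m hm => ?_)
    · rw [Finset.disjoint_left]
      intro m hm
      exact (Finset.mem_filter.mp hm).2
    · have : d' m = d m := if_neg (Finset.mem_filter.mp hm).2
      rw [this]
  set U : Ω → ℝ := fun ω => ∑ m ∈ T, c m * β m ω with hU
  set V : Ω → ℝ := fun ω => ∑' m, d' m * β m ω with hV
  have hUm : Measurable U := Finset.measurable_sum _ fun m _ => (β_meas m).const_mul _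
  have hVm : Measurable V := Measurable.tsum fun m => (β_meas m).const_mul _
  have hindep : IndepFun U V μ := by
    have hI := indep_iSup_of_disjoint (fun m => (β_meas m).comap_le) β_indep.iIndep
      (S := (T : Set ℤ)) (T := (T : Set ℤ)ᶜ) disjoint_compl_right
    rw [IndepFun_iff_Indep]
    refine indep_of_indep_of_le_left (indep_of_indep_of_le_right hI ?_) ?_
    · refine Measurable.comap_le ?_
      refine @Measurable.tsum _ _ _ (_) _ _ _ _ _ _ _ _ _ _ _ _ fun m => ?_
      by_cases hm : m ∈ T
      · have : d' m = 0 := if_pos hm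
        simp only [this, zero_mul]
        exact measurable_const
      · refine Measurable.const_mul ?_ _
        refine Measurable.mono (comap_measurable (β m)) ?_ le_rfl
        exact le_iSup₂ (f := fun (m : ℤ) (_ : m ∈ (T : Set ℤ)ᶜ) =>
          MeasurableSpace.comap (β m) inferInstance) m hm
    · refine Measurable.comap_le ?_
      refine Finset.measurable_sum _ fun m hm => ?_
      refine Measurable.const_mul ?_ _
      refine Measurable.mono (comap_measurable (β m)) ?_ le_rfl
      exact le_iSup₂ (f := fun (m : ℤ) (_ : m ∈ (T : Set ℤ)) =>
        MeasurableSpace.comap (β m) inferInstance) m hm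
  have hexp : Measurable fun y : ℝ => ENNReal.ofReal (Real.exp y) := by fun_prop
  have hexpn : Measurable fun y : ℝ => ENNReal.ofReal (Real.exp (-y)) := by fun_prop
  have hmul := lintegral_mul_eq_lintegral_mul_lintegral_of_indepFun
    (hexp.comp hUm) (hexpn.comp hVm) (hindep.comp hexp hexpn)
  calc (∏ m ∈ T, expMoment μ (β 0) (c m)) * r
      ≤ (∫⁻ ω, ENNReal.ofReal (Real.exp (U ω)) ∂μ) *
          ∫⁻ ω, ENNReal.ofReal (Real.exp (-V ω)) ∂μ := by
        rw [← lintegral_exp_sum β_meas β_indep β_ident c T]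
        gcongr
    _ = ∫⁻ ω, ENNReal.ofReal (Real.exp (U ω)) * ENNReal.ofReal (Real.exp (-V ω)) ∂μ := hmul.symm
    _ ≤ ∫⁻ ω, ENNReal.ofReal (Real.exp (∑' m, c m * β m ω)) ∂μ := by
        refine lintegral_mono_ae ?_
        filter_upwards [hsum, hsum', hpos] with ω hω hω' hp
        rw [← ENNReal.ofReal_mul (Real.exp_pos _).le, ← Real.exp_add]
        refine ENNReal.ofReal_le_ofReal (Real.exp_le_exp.mpr ?_)
        have hcs : Summable fun m => c m * β m ω := by
          refine Summable.of_norm_bounded hω fun m => ?_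
          rw [norm_mul, Real.norm_of_nonneg (hp m)]
          exact mul_le_mul_of_nonneg_right (hcd m) (hp m)
        have hUsum : U ω = ∑' m, if m ∈ T then c m * β m ω else 0 :=
          (tsum_eq_sum (s := T) (fun m hm => if_neg hm)).trans
            (Finset.sum_congr rfl fun m hm => if_pos hm) |>.symm
        have hUs : Summable fun m => if m ∈ T then c m * β m ω else 0 :=
          summable_of_ne_finset_zero (s := T) fun m hm => if_neg hm
        rw [hUsum, ← sub_eq_add_neg, hV, ← hUs.tsum_sub hω']
        refine (hUs.sub hω').tsum_le_tsum (fun m => ?_) hcs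
        by_cases hm : m ∈ T
        · simp [hd', hm]
        · simp only [hd', hm, if_false]
          have := mul_le_mul_of_nonneg_right (neg_le_of_abs_le (hcd m)) (hp m)
          linarith

end ExpSeries

/-! ### Cell averages and the coefficients of the series -/

/-- The average of `w` over the `n`-th cell `((n-1)/N, n/N)`. -/
noncomputable def cellAvg (w : ℝ → ℝ) (N : ℕ) (n : ℤ) : ℝ :=
  N * ∫ s in (((n : ℝ) - 1) / N)..((n : ℝ) / N), w s

/-- The coefficient of `β_m` in `N ∫_0^1 w(s) γ_{⌊Ns⌋+1} ds`. -/
noncomputable def cellWeight (h : ℤ → ℝ) (w : ℝ → ℝ) (N : ℕ) (m : ℤ) : ℝ :=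
  ∑ n ∈ Finset.Icc (1 : ℤ) N, h (n - m) * cellAvg w N n

section Discretisation

lemma sum_Icc_one_eq_sum_range {M : Type*} [AddCommMonoid M] (g : ℤ → M) (N : ℕ) :
    ∑ n ∈ Finset.Icc (1 : ℤ) N, g n = ∑ k ∈ Finset.range N, g (k + 1) := by
  symm
  refine Finset.sum_bij (fun k _ => (k : ℤ) + 1) ?_ ?_ ?_ ?_
  · intro k hk; rw [Finset.mem_range] at hk; rw [Finset.mem_Icc]; omega
  · intro a _ b _ hab; omega
  · intro n hn; rw [Finset.mem_Icc] at hn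
    exact ⟨(n - 1).toNat, by rw [Finset.mem_range]; omega, by omega⟩
  · intro k _; rfl

lemma floor_mul_eq {N : ℕ} (hN : 1 ≤ N) {k : ℤ} {s : ℝ} (h1 : (k : ℝ) / N ≤ s)
    (h2 : s < ((k : ℝ) + 1) / N) : ⌊(N : ℝ) * s⌋ = k := by
  have hN0 : (0 : ℝ) < N := by exact_mod_cast hN
  rw [Int.floor_eq_iff]
  rw [div_le_iff₀ hN0] at h1
  rw [lt_div_iff₀ hN0] at h2
  constructor <;> linarith

lemma mul_integral_comp_floor {N : ℕ} (hN : 1 ≤ N) {w : ℝ → ℝ} (hw : Measurable w) {W : ℝ}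
    (hW : ∀ s, |w s| ≤ W) (a : ℤ → ℝ) :
    N * ∫ s in (0 : ℝ)..1, w s * a (⌊(N : ℝ) * s⌋ + 1) =
      ∑ n ∈ Finset.Icc (1 : ℤ) N, a n * cellAvg w N n := by
  have hN0 : (0 : ℝ) < N := by exact_mod_cast hN
  have hwi : ∀ u v : ℝ, IntervalIntegrable w volume u v := by
    intro u v
    rw [intervalIntegrable_iff]
    exact Measure.integrableOn_of_bounded (M := W) (by simp)
      hw.aestronglyMeasurable (Eventually.of_forall hW)
  have hcong : ∀ k : ℕ, ∀ᵐ s, s ∈ Set.uIoc ((k : ℝ) / N) (((k + 1 : ℕ) : ℝ) / N) →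
      a ((k : ℤ) + 1) * w s = w s * a (⌊(N : ℝ) * s⌋ + 1) := by
    intro k
    have hne : ∀ᵐ s : ℝ, s ≠ ((k + 1 : ℕ) : ℝ) / N := by
      simp [ae_iff]
    filter_upwards [hne] with s hs hsI
    have hle : (k : ℝ) / N ≤ ((k + 1 : ℕ) : ℝ) / N := by gcongr; simp
    rw [uIoc_of_le hle] at hsI
    rw [floor_mul_eq hN (k := (k : ℤ)) (by push_cast; exact hsI.1.le) (by
      have := lt_of_le_of_ne hsI.2 hs
      push_cast at this ⊢
      exact this), mul_comm]
  have hint : ∀ k < N, IntervalIntegrable (fun s => w s * a (⌊(N : ℝ) * s⌋ + 1)) volume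
      ((k : ℝ) / N) (((k + 1 : ℕ) : ℝ) / N) := by
    intro k _
    refine ((hwi _ _).const_mul (a ((k : ℤ) + 1))).congr_ae ?_
    rw [EventuallyEq, ae_restrict_iff' measurableSet_uIoc]
    exact hcong k
  have hsum := intervalIntegral.sum_integral_adjacent_intervals (a := fun k : ℕ => (k : ℝ) / N) hint
  simp only [Nat.cast_zero, zero_div, div_self hN0.ne'] at hsum
  rw [← hsum, sum_Icc_one_eq_sum_range, Finset.mul_sum]
  refine Finset.sum_congr rfl fun k _ => ?_
  rw [← intervalIntegral.integral_congr_ae (hcong k), intervalIntegral.integral_const_mul, cellAvg]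
  push_cast
  rw [add_sub_cancel_right]
  ring

lemma cellWeight_eq_integral {N : ℕ} (hN : 1 ≤ N) {w : ℝ → ℝ} (hw : Measurable w) {W : ℝ}
    (hW : ∀ s, |w s| ≤ W) (h : ℤ → ℝ) (m : ℤ) :
    cellWeight h w N m = N * ∫ s in (0 : ℝ)..1, w s * h (⌊(N : ℝ) * s⌋ + 1 - m) :=
  (mul_integral_comp_floor hN hw hW fun n => h (n - m)).symm

lemma abs_cellAvg_sub_le {N : ℕ} (hN : 1 ≤ N) {w : ℝ → ℝ} (hw : Measurable w) {W : ℝ}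
    (hW : ∀ s, |w s| ≤ W) {n : ℤ} {y ε : ℝ}
    (hε : ∀ s ∈ Ioc (((n : ℝ) - 1) / N) ((n : ℝ) / N), |w s - y| ≤ ε) :
    |cellAvg w N n - y| ≤ ε := by
  have hN0 : (0 : ℝ) < N := by exact_mod_cast hN
  have hle : ((n : ℝ) - 1) / N ≤ (n : ℝ) / N := by gcongr; linarith
  have hlen : (n : ℝ) / N - ((n : ℝ) - 1) / N = 1 / N := by ring
  have hwi : IntervalIntegrable w volume (((n : ℝ) - 1) / N) ((n : ℝ) / N) := by
    rw [intervalIntegrable_iff]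
    exact Measure.integrableOn_of_bounded (M := W) (by simp)
      hw.aestronglyMeasurable (Eventually.of_forall hW)
  have e : cellAvg w N n - y = N * ∫ s in (((n : ℝ) - 1) / N)..((n : ℝ) / N), (w s - y) := by
    rw [intervalIntegral.integral_sub hwi (by simp), intervalIntegral.integral_const, hlen,
      cellAvg, smul_eq_mul]
    field_simp
  have hb := intervalIntegral.norm_integral_le_of_norm_le_const (f := fun s => w s - y) (C := ε)
    (a := ((n : ℝ) - 1) / N) (b := (n : ℝ) / N) (by rw [uIoc_of_le hle]; exact hε)
  rw [hlen, abs_of_pos (by positivity : (0 : ℝ) < 1 / N)] at hb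
  rw [e, abs_mul, abs_of_pos hN0]
  calc (N : ℝ) * |∫ s in (((n : ℝ) - 1) / N)..((n : ℝ) / N), (w s - y)| ≤ N * (ε * (1 / N)) := by
        gcongr; exact hb
    _ = ε := by field_simp

lemma abs_cellAvg_le {N : ℕ} (hN : 1 ≤ N) {w : ℝ → ℝ} (hw : Measurable w) {W : ℝ}
    (hW : ∀ s, |w s| ≤ W) (n : ℤ) : |cellAvg w N n| ≤ W := by
  have := abs_cellAvg_sub_le hN hw hW (n := n) (y := 0) (ε := W) fun s _ => by simpa using hW s
  simpa using this

lemma abs_cellWeight_le {N : ℕ} (hN : 1 ≤ N) {h : ℤ → ℝ} (h_nonneg : ∀ k, 0 ≤ h k) {w : ℝ → ℝ}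
    (hw : Measurable w) {W : ℝ} (hW : ∀ s, |w s| ≤ W) (m : ℤ) :
    |cellWeight h w N m| ≤ ∑ n ∈ Finset.Icc (1 : ℤ) N, W * h (n - m) := by
  refine (Finset.abs_sum_le_sum_abs _ _).trans (Finset.sum_le_sum fun n _ => ?_)
  rw [abs_mul, abs_of_nonneg (h_nonneg _), mul_comm]
  exact mul_le_mul_of_nonneg_right (abs_cellAvg_le hN hw hW n) (h_nonneg _)

/-- Away from discontinuities the coefficients converge, when `m/N → s`, to the limit value
`‖h‖₁ w(s)`. -/
lemma tendsto_cellWeight {h : ℤ → ℝ} (h_nonneg : ∀ k, 0 ≤ h k) (h_summable : Summable h)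
    {w : ℝ → ℝ} (hw : Measurable w) {W : ℝ} (hW : ∀ s, |w s| ≤ W) {s : ℝ} (hs : s ∈ Ioo (0 : ℝ) 1)
    (hws : ContinuousAt w s) :
    Tendsto (fun N : ℕ => cellWeight h w N (⌊(N : ℝ) * s⌋ + 1)) atTop (𝓝 ((∑' k, h k) * w s)) := by
  have hW0 : 0 ≤ W := (abs_nonneg _).trans (hW 0)
  -- the shifted cell averages, cut off outside the unit interval
  set a : ℕ → ℤ → ℝ := fun N k => if ⌊(N : ℝ) * s⌋ + 1 + k ∈ Finset.Icc (1 : ℤ) N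
    then cellAvg w N (⌊(N : ℝ) * s⌋ + 1 + k) else 0 with ha
  have hrep : ∀ N, cellWeight h w N (⌊(N : ℝ) * s⌋ + 1) = ∑' k, h k * a N k := by
    intro N
    have h1 : cellWeight h w N (⌊(N : ℝ) * s⌋ + 1) = ∑' n : ℤ, h (n - (⌊(N : ℝ) * s⌋ + 1)) *
        (if n ∈ Finset.Icc (1 : ℤ) N then cellAvg w N n else 0) := by
      rw [tsum_eq_sum (s := Finset.Icc (1 : ℤ) N) fun n hn => by rw [if_neg hn, mul_zero]]
      exact Finset.sum_congr rfl fun n hn => by rw [if_pos hn]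
    rw [h1, ← (Equiv.addLeft (⌊(N : ℝ) * s⌋ + 1)).tsum_eq]
    refine tsum_congr fun k => ?_
    simp only [Equiv.coe_addLeft, add_sub_cancel_left, ha]
    congr
  have hlim : Tendsto (fun N : ℕ => ∑' k, h k * a N k) atTop (𝓝 (∑' k, h k * w s)) := by
    refine tendsto_tsum_of_dominated_convergence (bound := fun k => h k * W)
      (h_summable.mul_right W) (fun k => ?_) ?_
    · refine Tendsto.const_mul _ ?_
      rw [Metric.tendsto_atTop]
      intro ε hε
      obtain ⟨δ, hδ, hδw⟩ := Metric.continuousAt_iff.mp hws (ε / 2) (half_pos hε)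
      -- cells within distance `δ` of `s` and inside the unit interval
      have hx : Tendsto (fun N : ℕ => (|(k : ℝ)| + 1) / (N : ℝ)) atTop (𝓝 0) :=
        tendsto_const_div_atTop_nhds_zero_nat _
      have hmin : 0 < min δ (min s (1 - s)) :=
        lt_min hδ (lt_min hs.1 (by linarith [hs.2]))
      obtain ⟨N₀, hN₀⟩ := eventually_atTop.mp (hx.eventually (gt_mem_nhds hmin))
      refine ⟨max N₀ 1, fun N hN => ?_⟩
      have hN1 : 1 ≤ N := (le_max_right _ _).trans hN
      have hN0 : (0 : ℝ) < N := by exact_mod_cast hN1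
      have hsm := hN₀ N ((le_max_left _ _).trans hN)
      rw [lt_min_iff, lt_min_iff, div_lt_iff₀ hN0, div_lt_iff₀ hN0, div_lt_iff₀ hN0] at hsm
      obtain ⟨hs1, hs2, hs3⟩ := hsm
      have hf1 := Int.floor_le ((N : ℝ) * s)
      have hf2 := Int.lt_floor_add_one ((N : ℝ) * s)
      have hk1 := neg_abs_le (k : ℝ)
      have hk2 := le_abs_self (k : ℝ)
      have hmem : ⌊(N : ℝ) * s⌋ + 1 + k ∈ Finset.Icc (1 : ℤ) N := by
        rw [Finset.mem_Icc]
        constructor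
        · have : (0 : ℝ) < ((⌊(N : ℝ) * s⌋ + 1 + k : ℤ) : ℝ) := by push_cast; nlinarith
          have : (0 : ℤ) < ⌊(N : ℝ) * s⌋ + 1 + k := by exact_mod_cast this
          omega
        · have : ((⌊(N : ℝ) * s⌋ + 1 + k : ℤ) : ℝ) ≤ N := by push_cast; nlinarith
          exact_mod_cast this
      simp only [ha, if_pos hmem]
      rw [Real.dist_eq]
      refine lt_of_le_of_lt (abs_cellAvg_sub_le hN1 hw hW (ε := ε / 2) fun u hu => ?_)
        (half_lt_self hε)
      refine le_of_lt (hδw ?_)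
      rw [Real.dist_eq, abs_lt]
      have hu1 := hu.1
      have hu2 := hu.2
      push_cast at hu1 hu2
      rw [div_lt_iff₀ hN0] at hu1
      rw [le_div_iff₀ hN0] at hu2
      constructor
      · by_contra hcon
        push Not at hcon
        have := mul_le_mul_of_nonneg_right hcon hN0.le
        linarith
      · by_contra hcon
        push Not at hcon
        have := mul_le_mul_of_nonneg_right hcon hN0.le
        linarith
    · filter_upwards [eventually_ge_atTop 1] with N hN k
      rw [norm_mul, Real.norm_of_nonneg (h_nonneg k)]
      refine mul_le_mul_of_nonneg_left ?_ (h_nonneg k)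
      simp only [ha]
      split_ifs
      · exact abs_cellAvg_le hN hw hW _
      · simpa using hW0
  rw [tsum_mul_right] at hlim
  exact hlim.congr fun N => (hrep N).symm

lemma lintegral_comp_floor {N : ℕ} (hN : 1 ≤ N) (g : ℤ → ℝ≥0∞) :
    ∫⁻ s in Ioc (0 : ℝ) 1, g (⌊(N : ℝ) * s⌋ + 1) =
      (∑ n ∈ Finset.Icc (1 : ℤ) N, g n) * ENNReal.ofReal ((N : ℝ)⁻¹) := by
  have hN0 : (0 : ℝ) < N := by exact_mod_cast hN
  have key : ∀ j : ℕ, ∫⁻ s in Ioc (0 : ℝ) ((j : ℝ) / N), g (⌊(N : ℝ) * s⌋ + 1) =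
      (∑ k ∈ Finset.range j, g (k + 1)) * ENNReal.ofReal ((N : ℝ)⁻¹) := by
    intro j
    induction j with
    | zero => simp
    | succ j ih =>
      have h1 : (0 : ℝ) ≤ (j : ℝ) / N := by positivity
      have h2 : (j : ℝ) / N ≤ ((j + 1 : ℕ) : ℝ) / N := by gcongr; simp
      rw [← Ioc_union_Ioc_eq_Ioc h1 h2, lintegral_union measurableSet_Ioc
        (Ioc_disjoint_Ioc_of_le le_rfl), ih, Finset.sum_range_succ, add_mul]
      congr 1
      have hc : ∫⁻ s in Ioc ((j : ℝ) / N) (((j + 1 : ℕ) : ℝ) / N), g (⌊(N : ℝ) * s⌋ + 1) =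
          ∫⁻ s in Ioc ((j : ℝ) / N) (((j + 1 : ℕ) : ℝ) / N), g ((j : ℤ) + 1) := by
        refine setLIntegral_congr_fun_ae measurableSet_Ioc ?_
        have hne : ∀ᵐ s : ℝ, s ≠ ((j + 1 : ℕ) : ℝ) / N := by simp [ae_iff]
        filter_upwards [hne] with s hs hsI
        rw [floor_mul_eq hN (k := (j : ℤ)) (by push_cast; exact hsI.1.le) (by
          have := lt_of_le_of_ne hsI.2 hs
          push_cast at this ⊢
          exact this)]
      rw [hc, setLIntegral_const, Real.volume_Ioc]
      congr 2
      push_cast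
      field_simp
      ring
  have := key N
  rw [div_self hN0.ne'] at this
  rw [this, sum_Icc_one_eq_sum_range]

end Discretisation

/-! ### Indices near the boundary of a block -/

section BoundaryTerms

/-- The number of `n ∈ [1, N]` with `n - k ∉ [1, N]`. -/
noncomputable def boundaryCount (N : ℕ) (k : ℤ) : ℕ :=
  ((Finset.Icc (1 : ℤ) N).filter fun n => n - k ∉ Finset.Icc (1 : ℤ) N).card

lemma boundaryCount_le (N : ℕ) (k : ℤ) : boundaryCount N k ≤ N := by
  refine (Finset.card_filter_le _ _).trans ?_
  simp

lemma boundaryCount_le_natAbs (N : ℕ) (k : ℤ) : boundaryCount N k ≤ k.natAbs := by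
  rcases le_total 0 k with hk | hk
  · refine (Finset.card_le_card (t := Finset.Icc 1 k) fun n hn => ?_).trans (by rw [Int.card_Icc]; omega)
    rw [Finset.mem_filter, Finset.mem_Icc, Finset.mem_Icc] at hn
    rw [Finset.mem_Icc]; omega
  · refine (Finset.card_le_card (t := Finset.Icc (N + k + 1) (N : ℤ)) fun n hn => ?_).trans
      (by rw [Int.card_Icc]; omega)
    rw [Finset.mem_filter, Finset.mem_Icc, Finset.mem_Icc] at hn
    rw [Finset.mem_Icc]; omega

lemma tendsto_boundary {p : ℤ → ℝ} (hp : ∀ k, 0 ≤ p k) (hps : Summable p) :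
    Tendsto (fun N : ℕ => (N : ℝ)⁻¹ * ∑' k, p k * boundaryCount N k) atTop (𝓝 0) := by
  have h0 : (0 : ℝ) = ∑' k : ℤ, p k * 0 := by simp
  have h1 : ∀ N : ℕ, (N : ℝ)⁻¹ * ∑' k, p k * boundaryCount N k =
      ∑' k, p k * ((N : ℝ)⁻¹ * boundaryCount N k) := by
    intro N
    rw [← tsum_mul_left]
    exact tsum_congr fun k => by ring
  simp_rw [h1]
  rw [h0]
  refine tendsto_tsum_of_dominated_convergence (bound := p) hps (fun k => ?_) ?_
  · refine Tendsto.const_mul _ ?_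
    refine squeeze_zero (fun N => by positivity) (fun N => ?_)
      (tendsto_const_div_atTop_nhds_zero_nat (k.natAbs : ℝ))
    rw [div_eq_inv_mul]
    gcongr
    exact_mod_cast boundaryCount_le_natAbs N k
  · refine Eventually.of_forall fun N k => ?_
    rw [norm_mul, Real.norm_of_nonneg (hp k), Real.norm_of_nonneg (by positivity)]
    refine mul_le_of_le_one_right (hp k) ?_
    rcases Nat.eq_zero_or_pos N with rfl | hN
    · simp
    · rw [inv_mul_le_iff₀ (by exact_mod_cast hN), mul_one]
      exact_mod_cast boundaryCount_le N k

/-- The total weight `p (n - m)` that connects `n ∈ [1, N]` to indices `m` outside of `[1, N]`. -/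
lemma sum_sum_le_boundary {p : ℤ → ℝ} (hp : ∀ k, 0 ≤ p k) (hps : Summable p) (N : ℕ)
    {T : Finset ℤ} (hT : Disjoint T (Finset.Icc (1 : ℤ) N)) :
    ∑ m ∈ T, ∑ n ∈ Finset.Icc (1 : ℤ) N, p (n - m) ≤ ∑' k, p k * boundaryCount N k := by
  classical
  rw [Finset.sum_comm]
  have h1 : ∀ n ∈ Finset.Icc (1 : ℤ) N, ∑ m ∈ T, p (n - m) ≤
      ∑' k, if n - k ∉ Finset.Icc (1 : ℤ) N then p k else 0 := by
    intro n _
    have hs : Summable fun k => if n - k ∉ Finset.Icc (1 : ℤ) N then p k else 0 := by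
      refine hps.of_nonneg_of_le (fun k => ?_) fun k => ?_
      · split_ifs; exacts [le_rfl, hp k]
      · split_ifs; exacts [hp k, le_rfl]
    have h2 : ∑ m ∈ T, p (n - m) = ∑ k ∈ T.image (fun m => n - m),
        if n - k ∉ Finset.Icc (1 : ℤ) N then p k else 0 := by
      rw [Finset.sum_image (fun a _ b _ hab => sub_right_injective hab)]
      refine Finset.sum_congr rfl fun m hm => ?_
      rw [sub_sub_cancel, if_pos (Finset.disjoint_left.mp hT hm)]
    rw [h2]
    refine hs.sum_le_tsum _ fun k _ => ?_
    split_ifs; exacts [le_rfl, hp k]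
  refine (Finset.sum_le_sum h1).trans_eq ?_
  rw [← Summable.tsum_finsetSum]
  · refine tsum_congr fun k => ?_
    rw [← Finset.sum_filter, Finset.sum_const, nsmul_eq_mul, mul_comm]
    rfl
  · intro n _
    refine hps.of_nonneg_of_le (fun k => ?_) fun k => ?_
    · split_ifs; exacts [le_rfl, hp k]
    · split_ifs; exacts [hp k, le_rfl]

end BoundaryTerms

/-! ### Jensen's inequality and the upper bound -/

section Jensen

set_option linter.unusedSectionVars false

variable {Ω : Type*} [MeasurableSpace Ω] {μ : Measure Ω} [IsProbabilityMeasure μ] {X : Ω → ℝ}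

/-- Jensen's inequality for the cumulant generating function and a sub-probability density `q`. -/
lemma logMGF_integral_le (hX : Measurable X) (hpos : ∀ᵐ ω ∂μ, 0 ≤ X ω) {b q : ℝ → ℝ} {T M : ℝ}
    (hb : Measurable b) (hbT : ∀ s, |b s| ≤ T) (hq : Measurable q) (hq0 : ∀ s, 0 ≤ q s)
    (hqM : ∀ s, q s ≤ M) (hq1 : ∫ s in Ioc (0 : ℝ) 1, q s ≤ 1)
    (hmem : ∀ᵐ s ∂volume.restrict (Ioc (0 : ℝ) 1), b s ∈ integrableExpSet X μ)
    (hint : IntegrableOn (fun s => cgf X μ (b s)) (Ioc 0 1)) :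
    logMGF μ X (∫ s in Ioc (0 : ℝ) 1, b s * q s) ≤
      ((∫ s in Ioc (0 : ℝ) 1, cgf X μ (b s) * q s : ℝ) : EReal) := by
  have hqn : ∀ᵐ s ∂volume.restrict (Ioc (0 : ℝ) 1), ‖q s‖ ≤ M :=
    Eventually.of_forall fun s => by rw [Real.norm_of_nonneg (hq0 s)]; exact hqM s
  have hbi : IntegrableOn b (Ioc 0 1) := Measure.integrableOn_of_bounded (M := T) (by simp)
      hb.aestronglyMeasurable (Eventually.of_forall hbT)
  have hqi : IntegrableOn q (Ioc 0 1) := Measure.integrableOn_of_bounded (M := M) (by simp)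
      hq.aestronglyMeasurable hqn
  have hbq : IntegrableOn (fun s => b s * q s) (Ioc 0 1) :=
    hbi.mul_bdd hq.aestronglyMeasurable hqn
  have hcq : IntegrableOn (fun s => cgf X μ (b s) * q s) (Ioc 0 1) :=
    hint.mul_bdd hq.aestronglyMeasurable hqn
  refine logMGF_le_of_forall_lt hX fun a ha => ?_
  have haS : a ∈ interior (integrableExpSet X μ) := by
    rcases lt_or_ge a 0 with h0 | h0
    · exact interior_maximal (fun t ht => mem_integrableExpSet_of_nonpos hX hpos (le_of_lt ht))
        isOpen_Iio h0
    · -- some value of `b` exceeds `a`, otherwise the mean would not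
      obtain ⟨s, hs, hsa⟩ : ∃ s, b s ∈ integrableExpSet X μ ∧ a < b s := by
        by_contra! hcon
        refine absurd ha (not_lt.mpr ?_)
        calc ∫ s in Ioc (0 : ℝ) 1, b s * q s ≤ ∫ s in Ioc (0 : ℝ) 1, a * q s := by
              refine integral_mono_ae hbq (hqi.const_mul a) ?_
              filter_upwards [hmem] with s hs
              exact mul_le_mul_of_nonneg_right (hcon s hs) (hq0 s)
          _ = a * ∫ s in Ioc (0 : ℝ) 1, q s := integral_const_mul _ _
          _ ≤ a := mul_le_of_le_one_right h0 hq1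
      exact interior_maximal (fun t ht => mem_integrableExpSet_of_le hX hpos (le_of_lt ht) hs)
        isOpen_Iio hsa
  obtain ⟨k, hk, hline⟩ := exists_supporting_line hX hpos haS
  rw [logMGF_of_mem (interior_subset haS)]
  refine EReal.coe_le_coe_iff.mpr ?_
  have h0 := hline 0 zero_mem_integrableExpSet
  rw [cgf_zero] at h0
  calc cgf X μ a ≤ (cgf X μ a - k * a) * (∫ s in Ioc (0 : ℝ) 1, q s) +
        k * ∫ s in Ioc (0 : ℝ) 1, b s * q s := by
        have h1 : cgf X μ a - k * a ≤ 0 := by linarith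
        nlinarith [mul_nonneg_of_nonpos_of_nonpos h1 (sub_nonpos.mpr hq1),
          mul_le_mul_of_nonneg_left ha.le hk]
    _ = ∫ s in Ioc (0 : ℝ) 1, ((cgf X μ a - k * a) * q s + k * (b s * q s)) := by
        rw [integral_add (hqi.const_mul _) (hbq.const_mul _), integral_const_mul,
          integral_const_mul]
    _ ≤ ∫ s in Ioc (0 : ℝ) 1, cgf X μ (b s) * q s := by
        refine integral_mono_ae ((hqi.const_mul _).add (hbq.const_mul _)) hcq ?_
        filter_upwards [hmem] with s hs
        have := mul_le_mul_of_nonneg_right (hline _ hs) (hq0 s)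
        calc (cgf X μ a - k * a) * q s + k * (b s * q s)
            = (cgf X μ a + k * (b s - a)) * q s := by ring
          _ ≤ _ := this

end Jensen

section UpperBound

set_option linter.unusedSectionVars false

variable {Ω : Type*} [MeasurableSpace Ω] {μ : Measure Ω} [IsProbabilityMeasure μ] {β : ℤ → Ω → ℝ}
  {h : ℤ → ℝ} {w : ℝ → ℝ} {W : ℝ}

lemma sum_sub_le_tsum (h_nonneg : ∀ k, 0 ≤ h k) (h_summable : Summable h) (T : Finset ℤ) (m : ℤ) :
    ∑ n ∈ T, h (n - m) ≤ ∑' k, h k := by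
  rw [← (Equiv.subRight m).tsum_eq h]
  exact Summable.sum_le_tsum (f := fun n => h (n - m)) T (fun _ _ => h_nonneg _)
    ((Equiv.subRight m).summable_iff.mpr h_summable)

lemma sum_sub_left_le_tsum (h_nonneg : ∀ k, 0 ≤ h k) (h_summable : Summable h) (T : Finset ℤ)
    (n : ℤ) : ∑ m ∈ T, h (n - m) ≤ ∑' k, h k := by
  rw [← (Equiv.subLeft n).tsum_eq h]
  exact Summable.sum_le_tsum (f := fun m => h (n - m)) T (fun _ _ => h_nonneg _)
    ((Equiv.subLeft n).summable_iff.mpr h_summable)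

lemma cellAvg_one {N : ℕ} (hN : 1 ≤ N) (n : ℤ) : cellAvg (fun _ => 1) N n = 1 := by
  have hN0 : (0 : ℝ) < N := by exact_mod_cast hN
  rw [cellAvg, intervalIntegral.integral_const, smul_eq_mul]
  field_simp
  ring

lemma summable_cellWeight_mul {ω : Ω} (hω : ∀ n : ℤ, Summable fun m => h (n - m) * β m ω)
    (w : ℝ → ℝ) (N : ℕ) : Summable fun m => cellWeight h w N m * β m ω := by
  simp_rw [cellWeight, Finset.sum_mul]
  refine summable_sum fun n _ => ((hω n).mul_left (cellAvg w N n)).congr fun m => ?_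
  ring

lemma measurable_comp_floor (g : ℤ → ℝ) (N : ℕ) :
    Measurable fun s : ℝ => g (⌊(N : ℝ) * s⌋ + 1) :=
  (measurable_from_top (f := fun n : ℤ => g (n + 1))).comp
    (Int.measurable_floor.comp (measurable_const.mul measurable_id))

/-- The upper bound for the exponential moment, without error term. -/
lemma lintegral_exp_cellWeight_le (h_nonneg : ∀ k, 0 ≤ h k) (h_summable : Summable h)
    (hκ : 0 < ∑' k, h k)
    (β_meas : ∀ m, Measurable (β m)) (β_nonneg : ∀ m, ∀ᵐ ω ∂μ, 0 ≤ β m ω)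
    (β_indep : iIndepFun β μ) (β_ident : ∀ m, IdentDistrib (β m) (β 0) μ μ)
    (hsum : ∀ᵐ ω ∂μ, ∀ n : ℤ, Summable fun m => h (n - m) * β m ω)
    (hw : Measurable w) (hW : ∀ s, |w s| ≤ W) {N : ℕ} (hN : 1 ≤ N)
    (hmem : ∀ᵐ s ∂volume.restrict (Ioc (0 : ℝ) 1),
      (∑' k, h k) * w s ∈ integrableExpSet (β 0) μ)
    (hint : IntegrableOn (fun s => cgf (β 0) μ ((∑' k, h k) * w s)) (Ioc 0 1)) :
    ∫⁻ ω, ENNReal.ofReal (Real.exp (∑' m, cellWeight h w N m * β m ω)) ∂μ ≤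
      ENNReal.ofReal (Real.exp (N * ∫ s in Ioc (0 : ℝ) 1, cgf (β 0) μ ((∑' k, h k) * w s))) := by
  set κ := ∑' k, h k with hκdef
  -- sub-probability densities in `s`, which sum over `m` to the constant `N`
  set q : ℤ → ℝ → ℝ := fun m s => N * h (⌊(N : ℝ) * s⌋ + 1 - m) / κ with hq
  have hqm : ∀ m, Measurable (q m) := fun m =>
    ((measurable_comp_floor (fun n => h (n - m)) N).const_mul _).div_const _
  have hq0 : ∀ m s, 0 ≤ q m s := fun m s =>
    div_nonneg (mul_nonneg (Nat.cast_nonneg _) (h_nonneg _)) hκ.le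
  have hqsum : ∀ (T : Finset ℤ) s, ∑ m ∈ T, q m s ≤ N := by
    intro T s
    simp only [hq]
    rw [← Finset.sum_div, ← Finset.mul_sum, div_le_iff₀ hκ]
    exact mul_le_mul_of_nonneg_left (sum_sub_left_le_tsum h_nonneg h_summable T _)
      (Nat.cast_nonneg _)
  have hqN : ∀ m s, q m s ≤ N := fun m s => by simpa using hqsum {m} s
  have hq1 : ∀ m, ∫ s in Ioc (0 : ℝ) 1, q m s ≤ 1 := by
    intro m
    have h1 := mul_integral_comp_floor hN (w := fun _ => 1) measurable_const (W := 1) (by simp)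
      (fun n => h (n - m))
    simp_rw [cellAvg_one hN, mul_one, one_mul] at h1
    rw [intervalIntegral.integral_of_le zero_le_one] at h1
    simp only [hq]
    rw [integral_div, integral_const_mul, h1, div_le_one hκ]
    exact sum_sub_le_tsum h_nonneg h_summable _ m
  have hbm : Measurable fun s => κ * w s := hw.const_mul _
  have hbT : ∀ s, |κ * w s| ≤ κ * W := fun s => by
    rw [abs_mul, abs_of_pos hκ]; exact mul_le_mul_of_nonneg_left (hW s) hκ.le
  have hc : ∀ m, cellWeight h w N m = ∫ s in Ioc (0 : ℝ) 1, κ * w s * q m s := by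
    intro m
    rw [cellWeight_eq_integral hN hw hW, intervalIntegral.integral_of_le zero_le_one,
      ← integral_const_mul]
    refine integral_congr_ae (Eventually.of_forall fun s => ?_)
    simp only [hq]
    field_simp
  have hexp : ∀ m, expMoment μ (β 0) (cellWeight h w N m) ≤
      ENNReal.ofReal (Real.exp (∫ s in Ioc (0 : ℝ) 1, cgf (β 0) μ (κ * w s) * q m s)) := by
    intro m
    have h1 := logMGF_integral_le (β_meas 0) (β_nonneg 0) hbm hbT (hqm m) (hq0 m) (hqN m) (hq1 m)
      hmem hint
    rw [← hc, logMGF_eq_log_expMoment, ← Real.log_exp (∫ s in Ioc (0 : ℝ) 1, _),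
      ← ENNReal.log_ofReal_of_pos (Real.exp_pos _), ENNReal.log_le_log_iff] at h1
    exact h1
  have hiq : ∀ m, IntegrableOn (fun s => cgf (β 0) μ (κ * w s) * q m s) (Ioc 0 1) := fun m =>
    Integrable.mul_bdd (c := N) hint (hqm m).aestronglyMeasurable
      (Eventually.of_forall fun s => by rw [Real.norm_of_nonneg (hq0 m s)]; exact hqN m s)
  refine lintegral_exp_tsum_le β_meas β_indep β_ident
    (hsum.mono fun ω hω => summable_cellWeight_mul hω w N)
    (r := fun K => ENNReal.ofReal (Real.exp (∫ s in Ioc (0 : ℝ) 1,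
      cgf (β 0) μ (κ * w s) * ∑ m ∈ Finset.Icc (-(K : ℤ)) K, q m s))) (fun K => ?_) ?_
  · refine (Finset.prod_le_prod' fun m _ => hexp m).trans_eq ?_
    rw [← ENNReal.ofReal_prod_of_nonneg fun _ _ => (Real.exp_pos _).le, ← Real.exp_sum,
      ← integral_finsetSum _ fun m _ => hiq m]
    simp_rw [Finset.mul_sum]
  · refine (ENNReal.continuous_ofReal.tendsto _).comp ((Real.continuous_exp.tendsto _).comp ?_)
    rw [← integral_const_mul]
    refine tendsto_integral_of_dominated_convergence (fun s => |cgf (β 0) μ (κ * w s)| * N)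
      (fun K => (hint.aestronglyMeasurable.mul
        (Finset.measurable_fun_sum _ fun m _ => hqm m).aestronglyMeasurable))
      (hint.abs.mul_const _) (fun K => Eventually.of_forall fun s => ?_)
      (Eventually.of_forall fun s => ?_)
    · rw [norm_mul, Real.norm_of_nonneg (Finset.sum_nonneg fun m _ => hq0 m s), Real.norm_eq_abs]
      exact mul_le_mul_of_nonneg_left (hqsum _ s) (abs_nonneg _)
    · rw [mul_comm (N : ℝ)]
      refine Tendsto.const_mul _ ?_
      have h1 : HasSum (fun m => q m s) N := by
        have h2 : HasSum (fun m => h (⌊(N : ℝ) * s⌋ + 1 - m)) κ :=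
          (Equiv.subLeft (⌊(N : ℝ) * s⌋ + 1)).hasSum_iff.mpr h_summable.hasSum
        have h3 := (h2.mul_left (N : ℝ)).div_const κ
        rwa [mul_div_cancel_right₀ _ hκ.ne'] at h3
      exact h1.comp tendsto_Icc_int

end UpperBound

/-! ### The lower bound -/

section LowerBound

set_option linter.unusedSectionVars false

variable {Ω : Type*} [MeasurableSpace Ω] {μ : Measure Ω} [IsProbabilityMeasure μ] {β : ℤ → Ω → ℝ}
  {h : ℤ → ℝ} {w : ℝ → ℝ} {W : ℝ}

lemma neg_cgf_neg_nonneg (β_meas : ∀ m, Measurable (β m)) (β_nonneg : ∀ m, ∀ᵐ ω ∂μ, 0 ≤ β m ω)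
    {t : ℝ} (ht : 0 ≤ t) : 0 ≤ -cgf (β 0) μ (-t) := by
  linarith [cgf_nonpos (β_meas 0) (β_nonneg 0) (neg_nonpos.mpr ht)]

lemma prod_expMoment_neg (β_meas : ∀ m, Measurable (β m)) (β_nonneg : ∀ m, ∀ᵐ ω ∂μ, 0 ≤ β m ω)
    {d : ℤ → ℝ} (hd : ∀ m, 0 ≤ d m) (T : Finset ℤ) :
    ∏ m ∈ T, expMoment μ (β 0) (-d m) =
      ENNReal.ofReal (Real.exp (∑ m ∈ T, cgf (β 0) μ (-d m))) := by
  rw [Real.exp_sum, ENNReal.ofReal_prod_of_nonneg fun _ _ => (Real.exp_pos _).le]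
  exact Finset.prod_congr rfl fun m _ => expMoment_of_mem
    (mem_integrableExpSet_of_nonpos (β_meas 0) (β_nonneg 0) (neg_nonpos.mpr (hd m)))

/-- The sums of `cgf (-W h_k)` are bounded below by `log 𝔼 exp (-W γ_0)`, which is finite since `γ_0`
is. -/
lemma summable_neg_cgf (h_nonneg : ∀ k, 0 ≤ h k)
    (β_meas : ∀ m, Measurable (β m)) (β_nonneg : ∀ m, ∀ᵐ ω ∂μ, 0 ≤ β m ω)
    (β_indep : iIndepFun β μ) (β_ident : ∀ m, IdentDistrib (β m) (β 0) μ μ)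
    (hsum : ∀ᵐ ω ∂μ, ∀ n : ℤ, Summable fun m => h (n - m) * β m ω) (hW0 : 0 ≤ W) :
    Summable fun k => -cgf (β 0) μ (-(W * h k)) := by
  have hpos : ∀ᵐ ω ∂μ, ∀ m, 0 ≤ β m ω := ae_all_iff.mpr β_nonneg
  have hd : ∀ m : ℤ, 0 ≤ W * h (0 - m) := fun m => mul_nonneg hW0 (h_nonneg _)
  set e := ∫⁻ ω, ENNReal.ofReal (Real.exp (-∑' m, W * h (0 - m) * β m ω)) ∂μ with he
  have he0 : e ≠ 0 := by
    have hm : Measurable fun ω => ∑' m, W * h (0 - m) * β m ω :=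
      Measurable.tsum fun m => (β_meas m).const_mul _
    rw [he, Ne, lintegral_eq_zero_iff (by fun_prop)]
    intro h0
    obtain ⟨ω, hω⟩ := h0.exists
    simp only [Pi.zero_apply, ENNReal.ofReal_eq_zero] at hω
    exact absurd hω (not_le.mpr (Real.exp_pos _))
  have hbound : ∀ T : Finset ℤ, e ≤ ENNReal.ofReal (Real.exp
      (∑ m ∈ T, cgf (β 0) μ (-(W * h (0 - m))))) := by
    intro T
    rw [← prod_expMoment_neg β_meas β_nonneg hd, ← lintegral_exp_sum β_meas β_indep β_ident]
    refine lintegral_mono_ae ?_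
    filter_upwards [hpos, hsum] with ω hω hs
    refine ENNReal.ofReal_le_ofReal (Real.exp_le_exp.mpr ?_)
    simp_rw [neg_mul]
    rw [Finset.sum_neg_distrib]
    refine neg_le_neg (Summable.sum_le_tsum T (fun m _ => mul_nonneg (hd m) (hω m)) ?_)
    exact ((hs 0).mul_left W).congr fun m => by ring
  have hetop : e ≠ ⊤ := ne_top_of_le_ne_top ENNReal.ofReal_ne_top (hbound ∅)
  have hepos : 0 < e.toReal := ENNReal.toReal_pos he0 hetop
  have hs : Summable fun m => -cgf (β 0) μ (-(W * h (0 - m))) := by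
    refine summable_of_sum_le (c := -Real.log e.toReal)
      (fun m => neg_cgf_neg_nonneg β_meas β_nonneg (hd m)) fun T => ?_
    have h1 := ENNReal.toReal_le_of_le_ofReal (Real.exp_pos _).le (hbound T)
    rw [Finset.sum_neg_distrib, neg_le_neg_iff]
    exact (Real.log_le_iff_le_exp hepos).mpr h1
  exact (Equiv.subLeft (0 : ℤ)).summable_iff.mp hs

/-- The indices outside of `[1, N]` cost at most the factor given by the boundary counts. -/
lemma le_lintegral_exp_cellWeight (h_nonneg : ∀ k, 0 ≤ h k)
    (β_meas : ∀ m, Measurable (β m)) (β_nonneg : ∀ m, ∀ᵐ ω ∂μ, 0 ≤ β m ω)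
    (β_indep : iIndepFun β μ) (β_ident : ∀ m, IdentDistrib (β m) (β 0) μ μ)
    (hsum : ∀ᵐ ω ∂μ, ∀ n : ℤ, Summable fun m => h (n - m) * β m ω)
    (hw : Measurable w) (hW : ∀ s, |w s| ≤ W) {N : ℕ} (hN : 1 ≤ N) :
    (∏ m ∈ Finset.Icc (1 : ℤ) N, expMoment μ (β 0) (cellWeight h w N m)) *
        ENNReal.ofReal (Real.exp (-∑' k, -cgf (β 0) μ (-(W * h k)) * boundaryCount N k)) ≤
      ∫⁻ ω, ENNReal.ofReal (Real.exp (∑' m, cellWeight h w N m * β m ω)) ∂μ := by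
  have hW0 : 0 ≤ W := (abs_nonneg _).trans (hW 0)
  have hd : ∀ m, 0 ≤ ∑ n ∈ Finset.Icc (1 : ℤ) N, W * h (n - m) := fun m =>
    Finset.sum_nonneg fun n _ => mul_nonneg hW0 (h_nonneg _)
  refine le_lintegral_exp_tsum β_meas β_nonneg β_indep β_ident hd
    (fun m => abs_cellWeight_le hN h_nonneg hw hW m) ?_ _ fun T' hT' => ?_
  · filter_upwards [hsum] with ω hω
    simp_rw [Finset.sum_mul]
    exact summable_sum fun n _ => ((hω n).mul_left W).congr fun m => by ring
  · rw [prod_expMoment_neg β_meas β_nonneg hd]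
    refine ENNReal.ofReal_le_ofReal (Real.exp_le_exp.mpr ?_)
    rw [neg_le, ← Finset.sum_neg_distrib]
    refine le_trans (Finset.sum_le_sum fun m _ => ?_) (sum_sum_le_boundary
      (fun k => neg_cgf_neg_nonneg β_meas β_nonneg (mul_nonneg hW0 (h_nonneg k)))
      (summable_neg_cgf h_nonneg β_meas β_nonneg β_indep β_ident hsum hW0) N hT')
    rw [Finset.sum_neg_distrib, neg_le_neg_iff]
    exact sum_cgf_neg_le (β_meas 0) (β_nonneg 0) _ fun n => mul_nonneg hW0 (h_nonneg _)

end LowerBound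

/-! ### Convergence of the normalised logarithmic moment generating functions -/

section Limit

set_option linter.unusedSectionVars false

variable {Ω : Type*} [MeasurableSpace Ω] {μ : Measure Ω} [IsProbabilityMeasure μ] {β : ℤ → Ω → ℝ}
  {h : ℤ → ℝ} {w : ℝ → ℝ} {W : ℝ}

/-- Adding the constant `B` makes all terms non-negative, so that the logarithm of the product becomes
a sum in `[0, ∞]`. -/
lemma log_prod_expMoment_add {X : Ω → ℝ} {c : ℤ → ℝ} {B : ℝ} (T : Finset ℤ)
    (hc : ∀ m ∈ T, -(B : EReal) ≤ logMGF μ X (c m)) :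
    ENNReal.log (∏ m ∈ T, expMoment μ X (c m)) + ((T.card * B : ℝ) : EReal) =
      ((∑ m ∈ T, (logMGF μ X (c m) + (B : EReal)).toENNReal : ℝ≥0∞) : EReal) := by
  classical
  have hnn : ∀ a : EReal, -(B : EReal) ≤ a → 0 ≤ a + B := by
    intro a ha
    have := add_le_add_left ha (B : EReal)
    rwa [← EReal.coe_neg, ← EReal.coe_add, neg_add_cancel, EReal.coe_zero] at this
  induction T using Finset.induction_on with
  | empty => simp
  | insert i T hi ih =>
    rw [Finset.prod_insert hi, Finset.sum_insert hi, ENNReal.log_mul_add, EReal.coe_ennreal_add,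
      ← ih fun m hm => hc m (Finset.mem_insert_of_mem hm), Finset.card_insert_of_notMem hi,
      EReal.coe_toENNReal (hnn _ (hc i (Finset.mem_insert_self _ _))), ← logMGF_eq_log_expMoment]
    rw [Nat.cast_succ, add_mul, one_mul, EReal.coe_add]
    ac_rfl

variable {E : Type*} [NormedAddCommGroup E] [InnerProductSpace ℝ E] [FiniteDimensional ℝ E]
  [MeasurableSpace E] [BorelSpace E] {H : ℝ → E} {C κ : ℝ}

lemma integrableOn_cgf {X : Ω → ℝ} (hX : Measurable X) (hpos : ∀ᵐ ω ∂μ, 0 ≤ X ω) (hκ : 0 ≤ κ)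
    (hH : Measurable H) (hC : ∀ s, ‖H s‖ ≤ C) {l : E}
    (hl : l ∈ effDomain (avgLogMGF μ X κ H)) :
    IntegrableOn (fun s => cgf X μ (κ * inner ℝ l (H s))) (Ioc 0 1) := by
  have hmem := ae_mem_integrableExpSet hX hpos hκ hH hC hl
  rw [effDomain, mem_ofPred_eq, avgLogMGF_eq hX hpos hκ hH hC le_rfl] at hl
  set B := -cgf X μ (-(κ * (‖l‖ * C))) with hB
  have hfin : ∫⁻ s in Ioc (0 : ℝ) 1,
      (logMGF μ X (κ * inner ℝ l (H s)) + (B : EReal)).toENNReal ≠ ⊤ := by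
    intro h
    rw [h] at hl
    simp at hl
  have heq : ∫⁻ s in Ioc (0 : ℝ) 1,
      (logMGF μ X (κ * inner ℝ l (H s)) + (B : EReal)).toENNReal =
      ∫⁻ s in Ioc (0 : ℝ) 1, ENNReal.ofReal (cgf X μ (κ * inner ℝ l (H s)) + B) := by
    refine lintegral_congr_ae ?_
    filter_upwards [hmem] with s hs
    rw [logMGF_of_mem hs, ← EReal.coe_add, EReal.toENNReal_of_ne_top (EReal.coe_ne_top _),
      EReal.toReal_coe]
  rw [heq] at hfin
  have hmc : Measurable fun s => cgf X μ (κ * inner ℝ l (H s)) :=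
    (measurable_cgf hX).comp ((measurable_const.inner hH).const_mul _)
  have h0 : 0 ≤ᵐ[volume.restrict (Ioc (0 : ℝ) 1)]
      fun s => cgf X μ (κ * inner ℝ l (H s)) + B := by
    filter_upwards [hmem] with s hs
    have := cgf_mono hX hpos (neg_le_of_abs_le (abs_mul_inner_le hκ hC le_rfl s)) hs
    simp only [Pi.zero_apply]
    linarith
  have h1 := (lintegral_ofReal_ne_top_iff_integrable
    (hmc.add_const B).aestronglyMeasurable h0).mp hfin
  have h2 := h1.sub (integrable_const B)
  refine h2.congr (Eventually.of_forall fun s => ?_)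
  simp

lemma log_exp_cellWeight_le_avgLogMGF (h_nonneg : ∀ k, 0 ≤ h k) (h_summable : Summable h)
    (hκ : 0 < ∑' k, h k)
    (β_meas : ∀ m, Measurable (β m)) (β_nonneg : ∀ m, ∀ᵐ ω ∂μ, 0 ≤ β m ω)
    (β_indep : iIndepFun β μ) (β_ident : ∀ m, IdentDistrib (β m) (β 0) μ μ)
    (hsum : ∀ᵐ ω ∂μ, ∀ n : ℤ, Summable fun m => h (n - m) * β m ω)
    (hH : Measurable H) (hC : ∀ s, ‖H s‖ ≤ C) (l : E) {N : ℕ} (hN : 1 ≤ N) :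
    (((N : ℝ)⁻¹ : ℝ) : EReal) * ENNReal.log (∫⁻ ω, ENNReal.ofReal (Real.exp
        (∑' m, cellWeight h (fun s => inner ℝ l (H s)) N m * β m ω)) ∂μ) ≤
      avgLogMGF μ (β 0) (∑' k, h k) H l := by
  have hN0 : (0 : ℝ) < N := by exact_mod_cast hN
  rcases eq_or_lt_of_le (le_top (a := avgLogMGF μ (β 0) (∑' k, h k) H l)) with htop | hl
  · rw [htop]; exact le_top
  have hmem := ae_mem_integrableExpSet (β_meas 0) (β_nonneg 0) hκ.le hH hC hl
  have hint := integrableOn_cgf (β_meas 0) (β_nonneg 0) hκ.le hH hC hl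
  have h1 := lintegral_exp_cellWeight_le h_nonneg h_summable hκ β_meas β_nonneg β_indep β_ident
    hsum (measurable_const.inner hH) (W := ‖l‖ * C) (fun s => (abs_real_inner_le_norm _ _).trans
      (mul_le_mul_of_nonneg_left (hC s) (norm_nonneg _))) hN hmem hint
  have h2 := ENNReal.log_monotone h1
  rw [ENNReal.log_ofReal_of_pos (Real.exp_pos _), Real.log_exp] at h2
  rw [avgLogMGF, unitIntegral_coe (hmem.mono fun s hs => logMGF_of_mem hs) hint]
  refine (mul_le_mul_of_nonneg_left h2 (EReal.coe_nonneg.mpr (by positivity))).trans_eq ?_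
  rw [← EReal.coe_mul, inv_mul_cancel_left₀ hN0.ne']

/-- The lower bound: Fatou's lemma for the indices inside the block, and a negligible contribution of
the indices outside. -/
lemma avgLogMGF_le_liminf (h_nonneg : ∀ k, 0 ≤ h k) (h_summable : Summable h)
    (β_meas : ∀ m, Measurable (β m)) (β_nonneg : ∀ m, ∀ᵐ ω ∂μ, 0 ≤ β m ω)
    (β_indep : iIndepFun β μ) (β_ident : ∀ m, IdentDistrib (β m) (β 0) μ μ)
    (hsum : ∀ᵐ ω ∂μ, ∀ n : ℤ, Summable fun m => h (n - m) * β m ω)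
    (hH : Measurable H) (hC : ∀ s, ‖H s‖ ≤ C)
    (hHc : ∀ᵐ s ∂volume.restrict (Ioc (0 : ℝ) 1), ContinuousAt H s) (l : E) :
    avgLogMGF μ (β 0) (∑' k, h k) H l ≤
      liminf (fun N : ℕ => (((N : ℝ)⁻¹ : ℝ) : EReal) * ENNReal.log (∫⁻ ω, ENNReal.ofReal (Real.exp
        (∑' m, cellWeight h (fun s => inner ℝ l (H s)) N m * β m ω)) ∂μ)) atTop := by
  set κ := ∑' k, h k with hκdef
  have hκ : 0 ≤ κ := tsum_nonneg h_nonneg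
  set w : ℝ → ℝ := fun s => inner ℝ l (H s) with hwdef
  have hw : Measurable w := measurable_const.inner hH
  have hW : ∀ s, |w s| ≤ ‖l‖ * C := fun s => (abs_real_inner_le_norm _ _).trans
    (mul_le_mul_of_nonneg_left (hC s) (norm_nonneg _))
  have hW0 : 0 ≤ ‖l‖ * C := (abs_nonneg _).trans (hW 0)
  set X := β 0 with hX
  set B := -cgf X μ (-(κ * (‖l‖ * C))) with hB
  set P : ℕ → ℝ := fun N => ∑' k, -cgf X μ (-(‖l‖ * C * h k)) * boundaryCount N k with hP
  set Y : ℕ → EReal := fun N => (((N : ℝ)⁻¹ : ℝ) : EReal) * ENNReal.log (∫⁻ ω, ENNReal.ofReal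
    (Real.exp (∑' m, cellWeight h w N m * β m ω)) ∂μ) with hY
  have hcB : ∀ N : ℕ, 1 ≤ N → ∀ m, -(B : EReal) ≤ logMGF μ X (cellWeight h w N m) := by
    intro N hN m
    refine neg_le_logMGF (β_meas 0) (β_nonneg 0) (mul_nonneg hκ hW0) ?_
    refine (abs_cellWeight_le hN h_nonneg hw hW m).trans ?_
    rw [← Finset.mul_sum, mul_comm]
    exact mul_le_mul_of_nonneg_right (sum_sub_le_tsum h_nonneg h_summable _ _) hW0
  set J : ℕ → ℝ≥0∞ := fun N => ∫⁻ s in Ioc (0 : ℝ) 1,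
    (logMGF μ X (cellWeight h w N (⌊(N : ℝ) * s⌋ + 1)) + (B : EReal)).toENNReal with hJ
  have hJY : ∀ N : ℕ, 1 ≤ N →
      ((J N : ℝ≥0∞) : EReal) + ((-(B + (N : ℝ)⁻¹ * P N) : ℝ) : EReal) ≤ Y N := by
    intro N hN
    have hN0 : (0 : ℝ) < N := by exact_mod_cast hN
    have h1 := le_lintegral_exp_cellWeight h_nonneg β_meas β_nonneg β_indep β_ident hsum hw hW hN
    have h2 := ENNReal.log_monotone h1
    rw [ENNReal.log_mul_add, ENNReal.log_ofReal_of_pos (Real.exp_pos _), Real.log_exp] at h2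
    have h3 := log_prod_expMoment_add (Finset.Icc (1 : ℤ) N) fun m _ => hcB N hN m
    rw [Int.card_Icc, show ((N : ℤ) + 1 - 1).toNat = N by omega] at h3
    have h4 : J N = (∑ m ∈ Finset.Icc (1 : ℤ) N,
        (logMGF μ X (cellWeight h w N m) + (B : EReal)).toENNReal) * ENNReal.ofReal (N : ℝ)⁻¹ :=
      lintegral_comp_floor hN fun n => (logMGF μ X (cellWeight h w N n) + (B : EReal)).toENNReal
    have hinv : (0 : EReal) ≤ (((N : ℝ)⁻¹ : ℝ) : EReal) := EReal.coe_nonneg.mpr (by positivity)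
    have h5 : ((J N : ℝ≥0∞) : EReal) = (((N : ℝ)⁻¹ : ℝ) : EReal) *
        ENNReal.log (∏ m ∈ Finset.Icc (1 : ℤ) N, expMoment μ X (cellWeight h w N m)) + (B : EReal) := by
      rw [h4, EReal.coe_ennreal_mul, ← h3, EReal.coe_ennreal_ofReal,
        max_eq_left (by positivity : (0 : ℝ) ≤ (N : ℝ)⁻¹), mul_comm,
        EReal.left_distrib_of_nonneg_of_ne_top hinv (EReal.coe_ne_top _), ← EReal.coe_mul,
        inv_mul_cancel_left₀ hN0.ne']
    have h6 := mul_le_mul_of_nonneg_left h2 hinv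
    rw [EReal.left_distrib_of_nonneg_of_ne_top hinv (EReal.coe_ne_top _), ← EReal.coe_mul] at h6
    refine le_trans (le_of_eq ?_) h6
    rw [h5, add_assoc, ← EReal.coe_add]
    congr 2
    simp only [hP, mul_neg]
    ring
  have hfatou : ∫⁻ s in Ioc (0 : ℝ) 1, (logMGF μ X (κ * w s) + (B : EReal)).toENNReal ≤
      liminf J atTop := by
    have hne : ∀ᵐ s ∂volume.restrict (Ioc (0 : ℝ) 1), s ≠ 1 :=
      ae_restrict_of_ae (by simp [ae_iff])
    calc ∫⁻ s in Ioc (0 : ℝ) 1, (logMGF μ X (κ * w s) + (B : EReal)).toENNReal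
        ≤ ∫⁻ s in Ioc (0 : ℝ) 1, liminf (fun N : ℕ =>
          (logMGF μ X (cellWeight h w N (⌊(N : ℝ) * s⌋ + 1)) + (B : EReal)).toENNReal) atTop := by
          refine lintegral_mono_ae ?_
          filter_upwards [hHc, hne, ae_restrict_mem measurableSet_Ioc] with s hs hs1 hsI
          have ht := tendsto_cellWeight h_nonneg h_summable hw hW
            (s := s) ⟨hsI.1, lt_of_le_of_ne hsI.2 hs1⟩ (ContinuousAt.inner continuousAt_const hs)
          have hl := lowerSemicontinuous_iff_le_liminf.mp
            (lowerSemicontinuous_toENNReal_logMGF_add (μ := μ) (β_meas 0) B) (κ * w s)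
          exact hl.trans (liminf_le_liminf_of_le ht)
      _ ≤ liminf J atTop := lintegral_liminf_le fun N =>
          (lowerSemicontinuous_toENNReal_logMGF_add (μ := μ) (β_meas 0) B).measurable.comp
            (measurable_comp_floor (fun n => cellWeight h w N n) N)
  have hlim : Tendsto (fun N : ℕ => ((-(B + (N : ℝ)⁻¹ * P N) : ℝ) : EReal)) atTop
      (𝓝 ((-B : ℝ) : EReal)) := by
    refine (continuous_coe_real_ereal.tendsto _).comp ?_
    have := tendsto_boundary
      (fun k => neg_cgf_neg_nonneg β_meas β_nonneg (mul_nonneg hW0 (h_nonneg k)))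
      (summable_neg_cgf h_nonneg β_meas β_nonneg β_indep β_ident hsum hW0)
    have h1 := (this.const_add B).neg
    rwa [add_zero] at h1
  have hmap : ((liminf J atTop : ℝ≥0∞) : EReal) = liminf (fun N => ((J N : ℝ≥0∞) : EReal)) atTop :=
    Monotone.map_liminf_of_continuousAt (fun _ _ hab => EReal.coe_ennreal_le_coe_ennreal_iff.mpr hab) J
      continuous_coe_ennreal_ereal.continuousAt
  rw [avgLogMGF_eq (β_meas 0) (β_nonneg 0) hκ hH hC le_rfl, sub_eq_add_neg, ← EReal.coe_neg]
  calc _ ≤ liminf (fun N => ((J N : ℝ≥0∞) : EReal)) atTop +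
        liminf (fun N : ℕ => ((-(B + (N : ℝ)⁻¹ * P N) : ℝ) : EReal)) atTop := by
        rw [hlim.liminf_eq, ← hmap]
        exact add_le_add_left (EReal.coe_ennreal_le_coe_ennreal_iff.mpr hfatou) _
    _ ≤ _ := EReal.le_liminf_add
    _ ≤ _ := liminf_le_liminf ((eventually_ge_atTop 1).mono fun N hN => hJY N hN)

/-- The limiting logarithmic moment generating function of `N ∫_0^1 l · H(s) γ_{⌊Ns⌋+1} ds`,
written as a series in the `β_m`. -/
lemma tendsto_log_exp_cellWeight (h_nonneg : ∀ k, 0 ≤ h k) (h_summable : Summable h)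
    (β_meas : ∀ m, Measurable (β m)) (β_nonneg : ∀ m, ∀ᵐ ω ∂μ, 0 ≤ β m ω)
    (β_indep : iIndepFun β μ) (β_ident : ∀ m, IdentDistrib (β m) (β 0) μ μ)
    (hsum : ∀ᵐ ω ∂μ, ∀ n : ℤ, Summable fun m => h (n - m) * β m ω)
    (hH : Measurable H) (hC : ∀ s, ‖H s‖ ≤ C)
    (hHc : ∀ᵐ s ∂volume.restrict (Ioc (0 : ℝ) 1), ContinuousAt H s) (l : E) :
    Tendsto (fun N : ℕ => (((N : ℝ)⁻¹ : ℝ) : EReal) * ENNReal.log (∫⁻ ω, ENNReal.ofReal (Real.exp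
        (∑' m, cellWeight h (fun s => inner ℝ l (H s)) N m * β m ω)) ∂μ)) atTop
      (𝓝 (avgLogMGF μ (β 0) (∑' k, h k) H l)) := by
  rcases eq_or_lt_of_le (tsum_nonneg h_nonneg) with h0 | hκ
  · have hz : ∀ k, h k = 0 := fun k =>
      congr_fun ((hasSum_zero_iff_of_nonneg h_nonneg).mp (h0 ▸ h_summable.hasSum)) k
    rw [← h0, avgLogMGF_zero_left]
    simp [cellWeight, hz]
  · refine tendsto_of_le_liminf_of_limsup_le
      (avgLogMGF_le_liminf h_nonneg h_summable β_meas β_nonneg β_indep β_ident hsum hH hC hHc l) ?_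
    refine limsup_le_of_le (by isBoundedDefault) ((eventually_ge_atTop 1).mono fun N hN => ?_)
    exact log_exp_cellWeight_le_avgLogMGF h_nonneg h_summable hκ β_meas β_nonneg β_indep β_ident
      hsum hH hC l hN

end Limit

/-! ### The vector function `H`

Only the values of `f` on `(0,1)` matter, so `f` may be replaced by its restriction, extended by zero.
This makes `H` bounded and measurable on the whole line. -/

section Restriction

variable {f : ℝ → ℝ}

lemma integrableOn_of_memLp_two (hf : MemLp f 2 (volume.restrict (Ioo (0 : ℝ) 1))) :
    IntegrableOn f (Ioo 0 1) :=
  hf.integrable (by norm_num)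

lemma primitive_indicator {s : ℝ} (hs : s ∈ Icc (0 : ℝ) 1) :
    primitive ((Ioo 0 1).indicator f) s = primitive f s := by
  refine intervalIntegral.integral_congr_ae ?_
  have hne : ∀ᵐ t : ℝ, t ≠ 1 := by simp [ae_iff]
  filter_upwards [hne] with t ht htI
  rw [uIoc_of_le hs.1] at htI
  exact indicator_of_mem (show t ∈ Ioo (0 : ℝ) 1 from
    ⟨htI.1, lt_of_le_of_ne (htI.2.trans hs.2) ht⟩) f

lemma Hvec_indicator {s : ℝ} (hs : s ∈ Icc (0 : ℝ) 1) (x : ℝ) :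
    Hvec ((Ioo 0 1).indicator f) x s = Hvec f x s := by
  rw [Hvec, Hvec, primitive_indicator hs]
  by_cases h : s ∈ Ioo 0 x
  · simp only [indicator_of_mem h, primitive_indicator hs]
  · simp only [indicator_of_notMem h]

lemma Zvec_indicator {Ω : Type*} [MeasurableSpace Ω] (h : ℤ → ℝ) (β : ℤ → Ω → ℝ) (x : ℝ) :
    Zvec h β ((Ioo 0 1).indicator f) x = Zvec h β f x := by
  funext N ω
  refine congrArg (WithLp.toLp 2) (funext fun i => ?_)
  refine intervalIntegral.integral_congr fun s hs => ?_
  rw [uIcc_of_le zero_le_one] at hs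
  simp only [Hvec_indicator hs]

lemma limitLambda_indicator {Ω : Type*} [MeasurableSpace Ω] (μ : Measure Ω) (h : ℤ → ℝ) (b : Ω → ℝ)
    (x : ℝ) : limitLambda μ h b f x = avgLogMGF μ b (∑' k, h k) (Hvec ((Ioo 0 1).indicator f) x) := by
  funext l
  refine unitIntegral_congr fun s hs => ?_
  rw [Hvec_indicator (Ioc_subset_Icc_self hs)]

lemma abs_primitive_le (hf : Integrable f) (s : ℝ) : |primitive f s| ≤ ∫ t, |f t| :=
  intervalIntegral.norm_integral_le_integral_norm_uIoc.trans
    (setIntegral_le_integral hf.norm (Eventually.of_forall fun _ => norm_nonneg _))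

lemma continuous_primitive_of_integrable (hf : Integrable f) : Continuous (primitive f) :=
  intervalIntegral.continuous_primitive (fun _ _ => hf.intervalIntegrable) 0

end Restriction

section HvecBasics

variable {f : ℝ → ℝ} {x : ℝ}

lemma Hvec_zero (f : ℝ → ℝ) (x s : ℝ) : Hvec f x s 0 = (Ioo 0 x).indicator (primitive f) s := rfl
lemma Hvec_one (f : ℝ → ℝ) (x s : ℝ) : Hvec f x s 1 = primitive f s := rfl
lemma Hvec_two (f : ℝ → ℝ) (x s : ℝ) :
    Hvec f x s 2 = (Ioo 0 x).indicator (fun _ => (1 : ℝ)) s := rfl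
lemma Hvec_three (f : ℝ → ℝ) (x s : ℝ) : Hvec f x s 3 = 1 := rfl

lemma measurable_Hvec_apply (hf : Integrable f) (x : ℝ) (i : Fin 4) :
    Measurable fun s => Hvec f x s i := by
  have hp := (continuous_primitive_of_integrable hf).measurable
  fin_cases i
  · exact hp.indicator measurableSet_Ioo
  · exact hp
  · exact measurable_const.indicator measurableSet_Ioo
  · exact measurable_const

lemma measurable_Hvec (hf : Integrable f) (x : ℝ) : Measurable (Hvec f x) := by
  have h : Measurable fun s i => Hvec f x s i := measurable_pi_iff.mpr (measurable_Hvec_apply hf x)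
  exact (PiLp.continuous_toLp 2 _).measurable.comp h

lemma abs_Hvec_apply_le (hf : Integrable f) (x s : ℝ) (i : Fin 4) :
    |Hvec f x s i| ≤ (∫ t, |f t|) + 1 := by
  have h0 : 0 ≤ ∫ t, |f t| := integral_nonneg fun _ => abs_nonneg _
  have hp := abs_primitive_le hf s
  fin_cases i
  · change |(Ioo 0 x).indicator (primitive f) s| ≤ _
    by_cases hs : s ∈ Ioo 0 x
    · rw [indicator_of_mem hs]; linarith
    · rw [indicator_of_notMem hs, abs_zero]; linarith
  · change |primitive f s| ≤ _
    linarith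
  · change |(Ioo 0 x).indicator (fun _ => (1 : ℝ)) s| ≤ _
    by_cases hs : s ∈ Ioo 0 x
    · rw [indicator_of_mem hs, abs_one]; linarith
    · rw [indicator_of_notMem hs, abs_zero]; linarith
  · change |(1 : ℝ)| ≤ _
    rw [abs_one]; linarith

lemma norm_Hvec_le (hf : Integrable f) (x s : ℝ) : ‖Hvec f x s‖ ≤ 4 * ((∫ t, |f t|) + 1) := by
  have h0 : 0 ≤ ∫ t, |f t| := integral_nonneg fun _ => abs_nonneg _
  rw [EuclideanSpace.norm_eq]
  refine Real.sqrt_le_iff.mpr ⟨by linarith, ?_⟩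
  calc ∑ i, ‖Hvec f x s i‖ ^ 2 ≤ ∑ _i : Fin 4, ((∫ t, |f t|) + 1) ^ 2 := by
        refine Finset.sum_le_sum fun i _ => ?_
        exact pow_le_pow_left₀ (norm_nonneg _) (abs_Hvec_apply_le hf x s i) 2
    _ ≤ _ := by
        rw [Finset.sum_const, Finset.card_univ, Fintype.card_fin, nsmul_eq_mul]
        push_cast
        nlinarith [sq_nonneg ((∫ t, |f t|) + 1)]

lemma continuousAt_Hvec (hf : Integrable f) {s : ℝ} (h0 : s ≠ 0) (hx : s ≠ x) :
    ContinuousAt (Hvec f x) s := by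
  have hp := (continuous_primitive_of_integrable hf).continuousAt (x := s)
  have hind : ∀ g : ℝ → ℝ, ContinuousAt g s → ContinuousAt ((Ioo 0 x).indicator g) s := by
    intro g hg
    by_cases hs : s ∈ Ioo 0 x
    · exact hg.congr ((isOpen_Ioo.eventually_mem hs).mono fun t ht => (indicator_of_mem ht g).symm)
    · have hev : ∀ᶠ t in 𝓝 s, t ∉ Ioo 0 x := by
        rcases lt_or_gt_of_ne h0 with h | h
        · filter_upwards [Iio_mem_nhds h] with t ht hmem
          exact absurd hmem.1 (not_lt.mpr (le_of_lt ht))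
        · have h' : x < s := lt_of_le_of_ne (not_lt.mp fun hh => hs ⟨h, hh⟩) hx.symm
          filter_upwards [Ioi_mem_nhds h'] with t ht hmem
          exact absurd hmem.2 (not_lt.mpr (le_of_lt ht))
      exact continuousAt_const.congr (hev.mono fun t ht => (indicator_of_notMem ht g).symm)
  have h : ContinuousAt (fun s i => Hvec f x s i) s := by
    rw [continuousAt_pi]
    intro i
    fin_cases i
    · exact hind _ hp
    · exact hp
    · exact hind _ continuousAt_const
    · exact continuousAt_const
  exact (PiLp.continuous_toLp 2 _).continuousAt.comp h

end HvecBasics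

/-! ### The random vectors `Z_ε` -/

section ZvecSeries

set_option linter.unusedSectionVars false

variable {Ω : Type*} [MeasurableSpace Ω] {β : ℤ → Ω → ℝ} {h : ℤ → ℝ} {f : ℝ → ℝ} {x : ℝ}

lemma measurable_gam (β_meas : ∀ m, Measurable (β m)) (n : ℤ) : Measurable (gam h β n) :=
  Measurable.tsum fun m => (β_meas m).const_mul _

lemma Zvec_apply (h : ℤ → ℝ) (β : ℤ → Ω → ℝ) (f : ℝ → ℝ) (x : ℝ) (N : ℕ) (ω : Ω) (i : Fin 4) :
    Zvec h β f x N ω i = ∫ s in (0 : ℝ)..1, Hvec f x s i * gam h β (⌊(N : ℝ) * s⌋ + 1) ω := rfl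

lemma mul_Zvec_apply (hf : Integrable f) {N : ℕ} (hN : 1 ≤ N) (ω : Ω) (i : Fin 4) :
    N * Zvec h β f x N ω i =
      ∑ n ∈ Finset.Icc (1 : ℤ) N, gam h β n ω * cellAvg (fun s => Hvec f x s i) N n :=
  mul_integral_comp_floor hN (measurable_Hvec_apply hf x i) (fun s => abs_Hvec_apply_le hf x s i)
    fun n => gam h β n ω

lemma measurable_Zvec (hf : Integrable f) (β_meas : ∀ m, Measurable (β m)) (N : ℕ) :
    Measurable (Zvec h β f x N) := by
  have h1 : ∀ i, Measurable fun ω => Zvec h β f x N ω i := by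
    intro i
    rcases Nat.eq_zero_or_pos N with rfl | hN
    · simp only [Zvec_apply, Nat.cast_zero, zero_mul, Int.floor_zero, zero_add,
        intervalIntegral.integral_mul_const]
      exact (measurable_gam β_meas 1).const_mul _
    · have hN0 : (N : ℝ) ≠ 0 := by exact_mod_cast hN.ne'
      have : (fun ω => Zvec h β f x N ω i) = fun ω => (N : ℝ)⁻¹ *
          ∑ n ∈ Finset.Icc (1 : ℤ) N, gam h β n ω * cellAvg (fun s => Hvec f x s i) N n := by
        funext ω
        rw [← mul_Zvec_apply hf hN, inv_mul_cancel_left₀ hN0]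
      rw [this]
      exact (Finset.measurable_fun_sum _ fun n _ =>
        (measurable_gam β_meas n).mul_const _).const_mul _
  exact (PiLp.continuous_toLp 2 _).measurable.comp (measurable_pi_iff.mpr h1)

lemma cellAvg_inner (hf : Integrable f) (l : EuclideanSpace ℝ (Fin 4)) (N : ℕ) (n : ℤ) :
    cellAvg (fun s => inner ℝ l (Hvec f x s)) N n =
      ∑ i, l i * cellAvg (fun s => Hvec f x s i) N n := by
  have hi : ∀ (i : Fin 4) (u v : ℝ), IntervalIntegrable (fun s => l i * Hvec f x s i) volume u v := by
    intro i u v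
    refine IntervalIntegrable.const_mul ?_ _
    rw [intervalIntegrable_iff]
    exact Measure.integrableOn_of_bounded (M := (∫ t, |f t|) + 1) (by simp)
      (measurable_Hvec_apply hf x i).aestronglyMeasurable
      (Eventually.of_forall fun s => abs_Hvec_apply_le hf x s i)
  have hin : ∀ s, inner ℝ l (Hvec f x s) = ∑ i, l i * Hvec f x s i := by
    intro s
    rw [PiLp.inner_apply]
    exact Finset.sum_congr rfl fun i _ => by simp [mul_comm]
  simp_rw [cellAvg, hin]
  rw [intervalIntegral.integral_finsetSum fun i _ => hi i _ _, Finset.mul_sum]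
  refine Finset.sum_congr rfl fun i _ => ?_
  rw [intervalIntegral.integral_const_mul]
  ring

lemma mul_inner_Zvec (hf : Integrable f) {N : ℕ} (hN : 1 ≤ N) {ω : Ω}
    (hω : ∀ n : ℤ, Summable fun m => h (n - m) * β m ω) (l : EuclideanSpace ℝ (Fin 4)) :
    inner ℝ ((N : ℝ) • l) (Zvec h β f x N ω) =
      ∑' m, cellWeight h (fun s => inner ℝ l (Hvec f x s)) N m * β m ω := by
  have h1 : inner ℝ ((N : ℝ) • l) (Zvec h β f x N ω) =
      ∑ n ∈ Finset.Icc (1 : ℤ) N, gam h β n ω * cellAvg (fun s => inner ℝ l (Hvec f x s)) N n := by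
    simp_rw [cellAvg_inner hf, Finset.mul_sum]
    rw [Finset.sum_comm, PiLp.inner_apply]
    refine Finset.sum_congr rfl fun i _ => ?_
    have := mul_Zvec_apply (h := h) (β := β) (x := x) hf hN ω i
    calc inner ℝ (((N : ℝ) • l) i) (Zvec h β f x N ω i) = l i * (N * Zvec h β f x N ω i) := by
          simp; ring
      _ = _ := by
          rw [this, Finset.mul_sum]
          exact Finset.sum_congr rfl fun n _ => by ring
  rw [h1]
  simp_rw [cellWeight, Finset.sum_mul, gam]
  rw [Summable.tsum_finsetSum fun n _ => ((hω n).mul_left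
    (cellAvg (fun s => inner ℝ l (Hvec f x s)) N n)).congr fun m => by ring]
  refine Finset.sum_congr rfl fun n _ => ?_
  rw [← tsum_mul_right]
  exact tsum_congr fun m => by ring

/-- The limiting logarithmic moment generating function of `Z_ε`. -/
lemma tendsto_logMGF_Zvec {μ : Measure Ω} [IsProbabilityMeasure μ]
    (h_nonneg : ∀ k, 0 ≤ h k) (h_summable : Summable h)
    (β_meas : ∀ m, Measurable (β m)) (β_nonneg : ∀ m, ∀ᵐ ω ∂μ, 0 ≤ β m ω)
    (β_indep : iIndepFun β μ) (β_ident : ∀ m, IdentDistrib (β m) (β 0) μ μ)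
    (hsum : ∀ᵐ ω ∂μ, ∀ n : ℤ, Summable fun m => h (n - m) * β m ω)
    (hf : Integrable f) (x : ℝ) (l : EuclideanSpace ℝ (Fin 4)) :
    Tendsto (fun N : ℕ => (((N : ℝ)⁻¹ : ℝ) : EReal) *
        logMGF μ (Zvec h β f x N) ((N : ℝ) • l)) atTop
      (𝓝 (avgLogMGF μ (β 0) (∑' k, h k) (Hvec f x) l)) := by
  have hc : ∀ᵐ s ∂volume.restrict (Ioc (0 : ℝ) 1), ContinuousAt (Hvec f x) s := by
    have hx : ∀ᵐ s : ℝ, s ≠ x := by simp [ae_iff]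
    filter_upwards [ae_restrict_of_ae hx, ae_restrict_mem measurableSet_Ioc] with s hs hsI
    exact continuousAt_Hvec hf hsI.1.ne' hs
  refine (tendsto_log_exp_cellWeight h_nonneg h_summable β_meas β_nonneg β_indep β_ident hsum
    (measurable_Hvec hf x) (norm_Hvec_le hf x) hc l).congr' ?_
  filter_upwards [eventually_ge_atTop 1] with N hN
  unfold logMGF
  congr 2
  refine lintegral_congr_ae ?_
  filter_upwards [hsum] with ω hω
  rw [mul_inner_Zvec hf hN hω]

end ZvecSeries

/-! ### The contraction principle -/

section Contraction

open ExpGrowth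

set_option linter.unusedSectionVars false

variable {Ω : Type*} [MeasurableSpace Ω] {μ : Measure Ω}
variable {E : Type*} [NormedAddCommGroup E] [InnerProductSpace ℝ E]
variable {E' : Type*} [NormedAddCommGroup E'] [InnerProductSpace ℝ E']

/-- The rate function is infinite outside a closed set that carries the random vectors. -/
lemma SatisfiesLDP.eq_top_of_notMem {Y : ℕ → Ω → E} {I : E → EReal} (h : SatisfiesLDP μ Y I)
    {S : Set E} (hS : IsClosed S) (hY : ∀ N : ℕ, 1 ≤ N → ∀ᵐ ω ∂μ, Y N ω ∈ S) {z : E} (hz : z ∉ S) :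
    I z = ⊤ := by
  have h1 := ((satisfiesLDP_iff.mp h) Sᶜ).1
  have h2 : expGrowthInf (fun N => μ {ω | Y N ω ∈ Sᶜ}) = ⊥ := by
    have : (fun N => μ {ω | Y N ω ∈ Sᶜ}) =ᶠ[atTop] (0 : ℕ → ℝ≥0∞) := by
      filter_upwards [eventually_ge_atTop 1] with N hN
      exact hY N hN
    rw [expGrowthInf_congr this, expGrowthInf_zero]
  rw [h2, hS.isOpen_compl.interior_eq, le_bot_iff, EReal.neg_eq_bot_iff] at h1
  exact (iInf₂_eq_top.mp h1) z hz

/-- The contraction principle for a map that is continuous on a closed set carrying the random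
vectors. -/
lemma SatisfiesLDP.comp_continuousOn {Y : ℕ → Ω → E} {I : E → EReal} (h : SatisfiesLDP μ Y I)
    {S : Set E} (hS : IsClosed S) (hY : ∀ N : ℕ, 1 ≤ N → ∀ᵐ ω ∂μ, Y N ω ∈ S)
    {g : E → E'} (hg : ContinuousOn g S) :
    SatisfiesLDP μ (fun N ω => g (Y N ω)) fun y => ⨅ z ∈ g ⁻¹' {y}, I z := by
  have htop := fun z hz => h.eq_top_of_notMem hS hY (z := z) hz
  rw [satisfiesLDP_iff] at h ⊢
  refine fun Γ => ⟨?_, ?_⟩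
  · rw [EReal.neg_le]
    refine le_iInf₂ fun y hy => le_iInf₂ fun z hz => ?_
    have hz' : g z = y := hz
    by_cases hzS : z ∈ S
    · obtain ⟨O, hO, hOz⟩ := (continuousOn_iff'.mp hg) (interior Γ) isOpen_interior
      have hzO : z ∈ O := by
        have : z ∈ g ⁻¹' interior Γ ∩ S := ⟨by rw [mem_preimage, hz']; exact hy, hzS⟩
        rw [hOz] at this
        exact this.1
      have h1 := (h O).1
      rw [hO.interior_eq, EReal.neg_le] at h1
      refine le_trans ?_ (h1.trans (iInf₂_le z hzO))
      rw [EReal.neg_le_neg_iff]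
      refine expGrowthInf_eventually_monotone ?_
      filter_upwards [eventually_ge_atTop 1] with N hN
      refine measure_mono_ae ?_
      filter_upwards [hY N hN] with ω hω hωO
      have : Y N ω ∈ g ⁻¹' interior Γ ∩ S := by rw [hOz]; exact ⟨hωO, hω⟩
      exact interior_subset this.1
    · rw [htop z hzS]; exact le_top
  · have hK : IsClosed (S ∩ g ⁻¹' closure Γ) := hg.preimage_isClosed_of_isClosed hS isClosed_closure
    have h1 := (h (S ∩ g ⁻¹' closure Γ)).2
    rw [hK.closure_eq] at h1
    refine le_trans (expGrowthSup_eventually_monotone ?_) (h1.trans ?_)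
    · filter_upwards [eventually_ge_atTop 1] with N hN
      refine measure_mono_ae ?_
      filter_upwards [hY N hN] with ω hω hωΓ
      exact ⟨hω, subset_closure hωΓ⟩
    · rw [EReal.neg_le_neg_iff]
      refine le_iInf₂ fun z hz => ?_
      exact (iInf₂_le (g z) hz.2).trans (iInf₂_le (f := fun z' _ => I z') z rfl)

lemma IsGoodRateFunction.comp_continuousOn {I : E → EReal} (hI : IsGoodRateFunction I)
    {S : Set E} (hS : IsClosed S) (htop : ∀ z ∉ S, I z = ⊤) {g : E → E'} (hg : ContinuousOn g S) :
    IsGoodRateFunction fun y => ⨅ z ∈ g ⁻¹' {y}, I z := by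
  obtain ⟨hlsc, h0, hcomp⟩ := hI
  have hnn : ∀ y, 0 ≤ (⨅ z ∈ g ⁻¹' {y}, I z) := fun y => le_iInf₂ fun z _ => h0 z
  have hsub : ∀ a : ℝ, {z | I z ≤ (a : EReal)} ⊆ S := by
    intro a z hz
    by_contra hcon
    rw [mem_ofPred_eq, htop z hcon] at hz
    exact absurd hz (not_le.mpr (EReal.coe_lt_top a))
  have himage : ∀ a : ℝ, 0 ≤ a → {y | (⨅ z ∈ g ⁻¹' {y}, I z) ≤ (a : EReal)} =
      g '' {z | I z ≤ (a : EReal)} := by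
    intro a ha
    ext y
    constructor
    · intro hy
      have hy' : (⨅ z ∈ g ⁻¹' {y}, I z) < ((a + 1 : ℝ) : EReal) :=
        lt_of_le_of_lt hy (EReal.coe_lt_coe_iff.mpr (lt_add_one a))
      simp only [iInf_lt_iff] at hy'
      obtain ⟨z₁, hz₁, hz₁'⟩ := hy'
      have hK : IsCompact ({z | I z ≤ ((a + 1 : ℝ) : EReal)} ∩ (S ∩ g ⁻¹' {y})) :=
        (hcomp _ (by linarith)).inter_right (hg.preimage_isClosed_of_isClosed hS isClosed_singleton)
      obtain ⟨z, hz, hmin⟩ := LowerSemicontinuousOn.exists_isMinOn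
        (f := I) (show ({z | I z ≤ ((a + 1 : ℝ) : EReal)} ∩ (S ∩ g ⁻¹' {y})).Nonempty from
          ⟨z₁, hz₁'.le, hsub _ hz₁'.le, hz₁⟩) hK (hlsc.lowerSemicontinuousOn _)
      refine ⟨z, show I z ≤ a from le_trans (le_iInf₂ fun z' hz' => ?_) hy, hz.2.2⟩
      rcases le_or_gt (I z') ((a + 1 : ℝ) : EReal) with hle | hgt
      · exact hmin ⟨hle, hsub _ hle, hz'⟩
      · exact hz.1.trans hgt.le
    · rintro ⟨z, hz, rfl⟩
      exact le_trans (iInf₂_le (f := fun z' (_ : z' ∈ g ⁻¹' {g z}) => I z') z rfl) hz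
  have hcomp' : ∀ a : ℝ, 0 ≤ a → IsCompact {y | (⨅ z ∈ g ⁻¹' {y}, I z) ≤ (a : EReal)} := by
    intro a ha
    rw [himage a ha]
    exact (hcomp a ha).image_of_continuousOn (hg.mono (hsub a))
  refine ⟨lowerSemicontinuous_of_isClosed_le_real fun a => ?_, hnn, hcomp'⟩
  rcases le_or_gt 0 a with ha | ha
  · exact (hcomp' a ha).isClosed
  · convert isClosed_empty
    refine eq_empty_of_forall_notMem fun y hy => ?_
    have := (hnn y).trans hy
    exact absurd (EReal.coe_nonneg.mp this) (not_le.mpr ha)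

end Contraction

/-! ### Continuity of `g` on a cone -/

section Cone

/-- A closed cone that carries the random vectors `Z_ε` when `|F| ≤ K`. -/
def zCone (K : ℝ) : Set (EuclideanSpace ℝ (Fin 4)) :=
  {z | 0 ≤ z 2 ∧ z 2 ≤ z 3 ∧ |z 0| ≤ K * z 2 ∧ |z 1| ≤ K * z 3}

lemma isClosed_zCone (K : ℝ) : IsClosed (zCone K) := by
  have h : ∀ i : Fin 4, Continuous fun z : EuclideanSpace ℝ (Fin 4) => z i := fun i => by fun_prop
  exact (isClosed_le continuous_const (h 2)).inter ((isClosed_le (h 2) (h 3)).inter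
    ((isClosed_le (h 0).abs ((h 2).const_mul K)).inter
      (isClosed_le (h 1).abs ((h 3).const_mul K))))

/-- On the cone `|z₃ / z₄| ≤ 1`, so `g` is continuous also at the origin, the only point of the
cone with `z₄ = 0`. -/
lemma continuousOn_gfun (K : ℝ) : ContinuousOn gfun (zCone K) := by
  have hc : ∀ i : Fin 4, Continuous fun z : EuclideanSpace ℝ (Fin 4) => z i := fun i => by fun_prop
  intro z hz
  obtain ⟨h1, h2, h3, h4⟩ := hz
  rcases eq_or_lt_of_le (h1.trans h2) with h0 | hpos
  · have hz2 : z 2 = 0 := le_antisymm (h2.trans h0.ge) h1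
    have hz0 : z 0 = 0 := by rw [hz2, mul_zero] at h3; exact abs_nonpos_iff.mp h3
    have hz1 : z 1 = 0 := by rw [← h0, mul_zero] at h4; exact abs_nonpos_iff.mp h4
    have hg0 : gfun z = 0 := by simp [gfun, hz0, hz1]
    rw [ContinuousWithinAt, hg0]
    have hlim : Tendsto (fun z' : EuclideanSpace ℝ (Fin 4) => |z' 0| + |z' 1|) (𝓝[zCone K] z)
        (𝓝 0) := by
      have : Continuous fun z' : EuclideanSpace ℝ (Fin 4) => |z' 0| + |z' 1| :=
        (hc 0).abs.add (hc 1).abs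
      exact (this.tendsto' z 0 (by simp [hz0, hz1])).mono_left nhdsWithin_le_nhds
    refine squeeze_zero_norm' ?_ hlim
    filter_upwards [self_mem_nhdsWithin] with z' hz'
    have hq : |z' 2 / z' 3| ≤ 1 := by
      rw [abs_div, abs_of_nonneg hz'.1, abs_of_nonneg (hz'.1.trans hz'.2.1)]
      exact div_le_one_of_le₀ hz'.2.1 (hz'.1.trans hz'.2.1)
    calc ‖gfun z'‖ ≤ |-z' 0| + |z' 1 * (z' 2 / z' 3)| := abs_add_le _ _
      _ ≤ |z' 0| + |z' 1| := by
        rw [abs_neg, abs_mul]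
        exact add_le_add le_rfl (mul_le_of_le_one_right (abs_nonneg _) hq)
  · refine ContinuousAt.continuousWithinAt ?_
    exact (hc 0).neg.continuousAt.add ((hc 1).continuousAt.mul
      ((hc 2).continuousAt.div (hc 3).continuousAt hpos.ne'))

lemma floor_add_one_mem_Icc {N : ℕ} {s : ℝ} (hs : s ∈ Ioc (0 : ℝ) 1) :
    ⌊(N : ℝ) * s⌋ + 1 ∈ Finset.Icc (1 : ℤ) (N + 1) := by
  have h0 : (0 : ℝ) ≤ N * s := mul_nonneg (Nat.cast_nonneg _) hs.1.le
  have h1 : (N : ℝ) * s ≤ N := mul_le_of_le_one_right (Nat.cast_nonneg _) hs.2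
  have h2 := Int.floor_nonneg.mpr h0
  have h3 : ⌊(N : ℝ) * s⌋ ≤ N := Int.floor_le_iff.mpr (by push_cast; linarith)
  rw [Finset.mem_Icc]
  omega

lemma integrableOn_comp_floor (a : ℤ → ℝ) (N : ℕ) :
    IntegrableOn (fun s : ℝ => a (⌊(N : ℝ) * s⌋ + 1)) (Ioc 0 1) := by
  refine Measure.integrableOn_of_bounded (M := ∑ n ∈ Finset.Icc (1 : ℤ) (N + 1), |a n|) (by simp)
    (measurable_comp_floor a N).aestronglyMeasurable ?_
  filter_upwards [ae_restrict_mem measurableSet_Ioc] with s hs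
  exact Finset.single_le_sum (f := fun n => |a n|) (fun _ _ => abs_nonneg _)
    (floor_add_one_mem_Icc hs)

variable {Ω : Type*} {β : ℤ → Ω → ℝ} {h : ℤ → ℝ} {f : ℝ → ℝ}

lemma integrableOn_Hvec_mul (hf : Integrable f) (x : ℝ) (N : ℕ) (ω : Ω) (i : Fin 4) :
    IntegrableOn (fun s => Hvec f x s i * gam h β (⌊(N : ℝ) * s⌋ + 1) ω) (Ioc 0 1) :=
  Integrable.bdd_mul (c := (∫ t, |f t|) + 1) (integrableOn_comp_floor (fun n => gam h β n ω) N)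
    (measurable_Hvec_apply hf x i).aestronglyMeasurable
    (Eventually.of_forall fun s => abs_Hvec_apply_le hf x s i)

lemma Zvec_mem_zCone [MeasurableSpace Ω] (hf : Integrable f) (x : ℝ) (N : ℕ) {ω : Ω}
    (hγ : ∀ n, 0 ≤ gam h β n ω) : Zvec h β f x N ω ∈ zCone (∫ t, |f t|) := by
  set K := ∫ t, |f t| with hK
  have hi := fun i => integrableOn_Hvec_mul (h := h) (β := β) hf x N ω i
  have hZ : ∀ i, Zvec h β f x N ω i =
      ∫ s in Ioc (0 : ℝ) 1, Hvec f x s i * gam h β (⌊(N : ℝ) * s⌋ + 1) ω := fun i => by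
    rw [Zvec_apply, intervalIntegral.integral_of_le zero_le_one]
  have habs : ∀ i j, (∀ s, |Hvec f x s i| ≤ K * Hvec f x s j) →
      |Zvec h β f x N ω i| ≤ K * Zvec h β f x N ω j := by
    intro i j hij
    rw [hZ, hZ, ← integral_const_mul, ← Real.norm_eq_abs]
    refine norm_integral_le_of_norm_le ((hi j).const_mul K) (Eventually.of_forall fun s => ?_)
    rw [norm_mul, Real.norm_of_nonneg (hγ _), ← mul_assoc]
    exact mul_le_mul_of_nonneg_right (hij s) (hγ _)
  refine ⟨?_, ?_, habs 0 2 fun s => ?_, habs 1 3 fun s => ?_⟩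
  · rw [hZ]
    refine integral_nonneg fun s => mul_nonneg ?_ (hγ _)
    rw [Hvec_two]
    exact indicator_nonneg (fun _ _ => zero_le_one) _
  · rw [hZ, hZ]
    refine integral_mono (hi 2) (hi 3) fun s => mul_le_mul_of_nonneg_right ?_ (hγ _)
    rw [Hvec_two, Hvec_three]
    exact indicator_le_self' (fun _ _ => zero_le_one) _
  · rw [Hvec_zero, Hvec_two]
    by_cases hs : s ∈ Ioo 0 x
    · rw [indicator_of_mem hs, indicator_of_mem hs, mul_one]; exact abs_primitive_le hf s
    · rw [indicator_of_notMem hs, indicator_of_notMem hs, abs_zero, mul_zero]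
  · rw [Hvec_one, Hvec_three, mul_one]
    exact abs_primitive_le hf s

end Cone

/-! ### The du Bois-Reymond lemma -/

section DuBoisReymond

lemma exists_Icc_of_isCompact_subset_Ioo {K : Set ℝ} (hK : IsCompact K) (hK' : K ⊆ Ioo (0 : ℝ) 1) :
    ∃ a b : ℝ, 0 < a ∧ a ≤ b ∧ b < 1 ∧ K ⊆ Icc a b := by
  rcases K.eq_empty_or_nonempty with rfl | hne
  · exact ⟨1 / 2, 1 / 2, by norm_num, le_rfl, by norm_num, empty_subset _⟩
  · obtain ⟨a, ha, hal⟩ := hK.exists_isLeast hne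
    obtain ⟨b, hb, hbg⟩ := hK.exists_isGreatest hne
    exact ⟨a, b, (hK' ha).1, hal hb, (hK' hb).2, fun s hs => ⟨hal hs, hbg hs⟩⟩

lemma IsTestFunction.exists_Icc {φ : ℝ → ℝ} (hφ : IsTestFunction φ) :
    ∃ a b : ℝ, 0 < a ∧ a ≤ b ∧ b < 1 ∧ ∀ s ∉ Icc a b, φ s = 0 := by
  obtain ⟨a, b, ha, hab, hb, hsub⟩ := exists_Icc_of_isCompact_subset_Ioo hφ.2.1 hφ.2.2
  exact ⟨a, b, ha, hab, hb, fun s hs => image_eq_zero_of_notMem_tsupport fun h => hs (hsub h)⟩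

lemma isTestFunction_of_forall_notMem {φ : ℝ → ℝ} (hφ : ContDiff ℝ ((⊤ : ℕ∞) : WithTop ℕ∞) φ)
    {a b : ℝ} (ha : 0 < a) (hb : b < 1) (h0 : ∀ s ∉ Icc a b, φ s = 0) : IsTestFunction φ := by
  have hsub : tsupport φ ⊆ Icc a b := closure_minimal (fun s hs => by
    by_contra hcon
    exact hs (h0 s hcon)) isClosed_Icc
  exact ⟨hφ, isCompact_Icc.of_isClosed_subset (isClosed_tsupport φ) hsub,
    hsub.trans fun s hs => ⟨ha.trans_le hs.1, hs.2.trans_lt hb⟩⟩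

lemma IsTestFunction.apply_zero {φ : ℝ → ℝ} (hφ : IsTestFunction φ) : φ 0 = 0 :=
  image_eq_zero_of_notMem_tsupport fun h => lt_irrefl _ (hφ.2.2 h).1

lemma IsTestFunction.apply_one {φ : ℝ → ℝ} (hφ : IsTestFunction φ) : φ 1 = 0 :=
  image_eq_zero_of_notMem_tsupport fun h => lt_irrefl _ (hφ.2.2 h).2

/-- A smooth function with compact support in `(0,1)` and zero mean is the derivative of a test
function. -/
lemma exists_isTestFunction_deriv_eq {ψ : ℝ → ℝ} (hψ : IsTestFunction ψ)
    (h0 : ∫ s in (0 : ℝ)..1, ψ s = 0) : ∃ φ, IsTestFunction φ ∧ deriv φ = ψ := by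
  obtain ⟨a, b, ha, hab, hb, hz⟩ := hψ.exists_Icc
  have hc : Continuous ψ := hψ.1.continuous
  have hd : ∀ s, HasDerivAt (fun s => ∫ t in (0 : ℝ)..s, ψ t) (ψ s) s := fun s =>
    intervalIntegral.integral_hasDerivAt_right (hc.intervalIntegrable _ _)
      (hc.stronglyMeasurableAtFilter _ _) hc.continuousAt
  have hderiv : deriv (fun s => ∫ t in (0 : ℝ)..s, ψ t) = ψ := funext fun s => (hd s).deriv
  refine ⟨fun s => ∫ t in (0 : ℝ)..s, ψ t, isTestFunction_of_forall_notMem ?_ ha hb ?_, hderiv⟩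
  · refine contDiff_infty_iff_deriv.mpr ⟨fun s => (hd s).differentiableAt, ?_⟩
    rw [hderiv]
    exact hψ.1
  · intro s hs
    rw [mem_Icc, not_and_or, not_le, not_le] at hs
    rcases hs with hs | hs
    · refine (intervalIntegral.integral_congr (g := fun _ => (0 : ℝ)) fun t ht => ?_).trans (by simp)
      refine hz t fun hmem => ?_
      have := (max_lt ha hs).trans_le hmem.1
      exact absurd (this.trans_le' ht.2) (lt_irrefl _)
    · refine Eq.trans ?_ h0
      rw [← sub_eq_zero, intervalIntegral.integral_interval_sub_left
        (hc.intervalIntegrable _ _) (hc.intervalIntegrable _ _)]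
      refine (intervalIntegral.integral_congr (g := fun _ => (0 : ℝ)) fun t ht => ?_).trans (by simp)
      refine hz t fun hmem => ?_
      exact absurd ((lt_min hb hs).trans_le ht.1) (not_lt.mpr hmem.2)

lemma exists_isTestFunction_integral_eq_one :
    ∃ ρ, IsTestFunction ρ ∧ ∫ s in (0 : ℝ)..1, ρ s = 1 := by
  let χ : ContDiffBump (1 / 2 : ℝ) := ⟨1 / 8, 1 / 4, by norm_num, by norm_num⟩
  have hsupp : ∀ s ∉ Icc (1 / 4 : ℝ) (3 / 4), χ.normed volume s = 0 := by
    intro s hs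
    refine image_eq_zero_of_notMem_tsupport fun hmem => hs ?_
    rw [χ.tsupport_normed_eq, Metric.mem_closedBall, Real.dist_eq, abs_le] at hmem
    simp only [χ] at hmem
    constructor <;> linarith [hmem.1, hmem.2]
  refine ⟨χ.normed volume, isTestFunction_of_forall_notMem χ.contDiff_normed (by norm_num)
    (by norm_num) hsupp, ?_⟩
  rw [intervalIntegral.integral_of_le zero_le_one]
  refine (setIntegral_eq_integral_of_forall_compl_eq_zero fun s hs => hsupp s fun hmem => hs ?_).trans
    χ.integral_normed
  exact ⟨by linarith [hmem.1], by linarith [hmem.2]⟩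

/-- The du Bois-Reymond lemma. -/
lemma exists_ae_eq_const_of_integral_mul_deriv {g : ℝ → ℝ}
    (hg : IntervalIntegrable g volume 0 1)
    (h : ∀ φ, IsTestFunction φ → ∫ s in (0 : ℝ)..1, g s * deriv φ s = 0) :
    ∃ c : ℝ, ∀ᵐ s, s ∈ Ioo (0 : ℝ) 1 → g s = c := by
  obtain ⟨ρ, hρ, hρ1⟩ := exists_isTestFunction_integral_eq_one
  set c := ∫ s in (0 : ℝ)..1, g s * ρ s with hc
  refine ⟨c, ?_⟩
  have hgc : IntervalIntegrable (fun s => g s - c) volume 0 1 := hg.sub (by simp)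
  have hloc : LocallyIntegrableOn (fun s => g s - c) (Ioo (0 : ℝ) 1) volume :=
    (((intervalIntegrable_iff_integrableOn_Ioc_of_le zero_le_one).mp hgc).mono_set
      Ioo_subset_Ioc_self).locallyIntegrableOn
  have hmain := isOpen_Ioo.ae_eq_zero_of_integral_contDiff_smul_eq_zero hloc ?_
  · filter_upwards [hmain] with s hs hsI
    exact sub_eq_zero.mp (hs hsI)
  intro ψ hψ1 hψ2 hψ3
  have hψ : IsTestFunction ψ := ⟨hψ1, hψ2, hψ3⟩
  have hψc := hψ1.continuous
  have hρc := hρ.1.continuous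
  set p := ∫ s in (0 : ℝ)..1, ψ s with hp
  have hψρ : IsTestFunction fun s => ψ s - p * ρ s := by
    obtain ⟨a, b, ha, -, hb, hz⟩ := hψ.exists_Icc
    obtain ⟨a', b', ha', -, hb', hz'⟩ := hρ.exists_Icc
    refine isTestFunction_of_forall_notMem (hψ1.sub (contDiff_const.mul hρ.1))
      (lt_min ha ha') (max_lt hb hb') fun s hs => ?_
    rw [hz s fun hm => hs ⟨(min_le_left _ _).trans hm.1, hm.2.trans (le_max_left _ _)⟩,
      hz' s fun hm => hs ⟨(min_le_right _ _).trans hm.1, hm.2.trans (le_max_right _ _)⟩]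
    simp
  obtain ⟨φ, hφ, hφd⟩ := exists_isTestFunction_deriv_eq hψρ (by
    rw [intervalIntegral.integral_sub (hψc.intervalIntegrable _ _)
      ((hρc.intervalIntegrable _ _).const_mul _), intervalIntegral.integral_const_mul, hρ1]
    simp [hp])
  have h1 := h φ hφ
  have hi1 : IntervalIntegrable (fun s => g s * ψ s) volume 0 1 := hg.mul_continuousOn hψc.continuousOn
  have hi2 : IntervalIntegrable (fun s => g s * ρ s) volume 0 1 := hg.mul_continuousOn hρc.continuousOn
  have h2 : ∫ s in (0 : ℝ)..1, g s * deriv φ s = (∫ s in (0 : ℝ)..1, g s * ψ s) - p * c := by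
    rw [hφd, hc, ← intervalIntegral.integral_const_mul, ← intervalIntegral.integral_sub hi1
      (hi2.const_mul p)]
    exact intervalIntegral.integral_congr fun s _ => by ring
  have h3 : ∫ s, ψ s • (g s - c) = ∫ s in (0 : ℝ)..1, ψ s * (g s - c) := by
    rw [intervalIntegral.integral_of_le zero_le_one]
    refine (setIntegral_eq_integral_of_forall_compl_eq_zero fun s hs => ?_).symm
    rw [smul_eq_mul, image_eq_zero_of_notMem_tsupport fun hm =>
      hs (Ioo_subset_Ioc_self (hψ3 hm)), zero_mul]
  rw [h3]
  have h4 : ∫ s in (0 : ℝ)..1, ψ s * (g s - c) = (∫ s in (0 : ℝ)..1, g s * ψ s) - c * p := by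
    rw [hp, ← intervalIntegral.integral_const_mul, ← intervalIntegral.integral_sub hi1
      ((hψc.intervalIntegrable _ _).const_mul c)]
    exact intervalIntegral.integral_congr fun s _ => by ring
  linarith

lemma integral_primitive_mul_deriv {g φ : ℝ → ℝ} (hg : IntervalIntegrable g volume 0 1)
    (hφ : IsTestFunction φ) :
    ∫ s in (0 : ℝ)..1, primitive g s * deriv φ s = -∫ s in (0 : ℝ)..1, g s * φ s := by
  have h1 : AbsolutelyContinuousOnInterval (primitive g) 0 1 :=
    hg.absolutelyContinuousOnInterval_intervalIntegral (by simp)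
  have h2 : AbsolutelyContinuousOnInterval φ 0 1 :=
    (hφ.1.of_le (by exact_mod_cast le_top)).contDiffOn.absolutelyContinuousOnInterval
  rw [h1.integral_mul_deriv_eq_deriv_mul h2, hφ.apply_zero, hφ.apply_one, mul_zero, mul_zero,
    sub_zero, zero_sub]
  congr 1
  refine intervalIntegral.integral_congr_ae ?_
  filter_upwards [hg.ae_hasDerivAt_integral] with s hs hsI
  have : HasDerivAt (primitive g) (g s) s := hs (uIoc_subset_uIcc hsI) 0 (by simp)
  rw [this.deriv]

end DuBoisReymond

/-! ### The weak solution -/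

section WeakSolution

lemma integral_indicator_mul {x : ℝ} (hx : x ∈ Ioo (0 : ℝ) 1) (g k : ℝ → ℝ) :
    ∫ s in (0 : ℝ)..1, (Ioo 0 x).indicator g s * k s = ∫ s in (0 : ℝ)..x, g s * k s := by
  have h1 : (fun s => (Ioo 0 x).indicator g s * k s) = (Ioo 0 x).indicator fun s => g s * k s := by
    funext s
    exact (indicator_mul_left (Ioo 0 x) g k).symm
  rw [h1, intervalIntegral.integral_of_le zero_le_one, intervalIntegral.integral_of_le hx.1.le,
    setIntegral_indicator measurableSet_Ioo,
    inter_eq_right.mpr (Ioo_subset_Ioc_self.trans (Ioc_subset_Ioc_right hx.2.le)),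
    integral_Ioc_eq_integral_Ioo]

/-- The flux `a u'` equals `c - F` for a constant `c`, which the boundary condition determines. -/
lemma IsWeakSolution.apply_eq {γ f u : ℝ → ℝ} (hγm : Measurable γ) (hγ0 : ∀ s, 0 < γ s)
    (hγi : IntervalIntegrable γ volume 0 1) {M : ℝ}
    (hγM : ∀ᵐ s ∂volume.restrict (Ioc (0 : ℝ) 1), (γ s)⁻¹ ≤ M) (hf : Integrable f)
    (hu : IsWeakSolution (fun s => (γ s)⁻¹) f u) {x : ℝ} (hx : x ∈ Ioo (0 : ℝ) 1) :
    u x = -(∫ s in (0 : ℝ)..x, primitive f s * γ s) +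
      (∫ s in (0 : ℝ)..1, primitive f s * γ s) *
        ((∫ s in (0 : ℝ)..x, γ s) / ∫ s in (0 : ℝ)..1, γ s) := by
  obtain ⟨huc, hu0, hu1, v, hv, hvu, hvf⟩ := hu
  have hvi : IntervalIntegrable v volume 0 1 := by
    rw [intervalIntegrable_iff_integrableOn_Ioo_of_le zero_le_one]
    exact integrableOn_of_memLp_two hv
  have hFc : Continuous (primitive f) := continuous_primitive_of_integrable hf
  have hVc : ContinuousOn (primitive v) (Icc 0 1) := by
    have := intervalIntegral.continuousOn_primitive_interval' hvi (left_mem_uIcc)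
    rwa [uIcc_of_le zero_le_one] at this
  -- `u` is the primitive of its weak derivative
  obtain ⟨c₁, hc₁⟩ := exists_ae_eq_const_of_integral_mul_deriv (g := fun s => u s - primitive v s)
    (ContinuousOn.intervalIntegrable (by rw [uIcc_of_le zero_le_one]; exact huc.sub hVc))
    fun φ hφ => by
      have hd : ContinuousOn (deriv φ) (uIcc 0 1) :=
        (hφ.1.continuous_deriv (by exact_mod_cast le_top)).continuousOn
      have hi : ∀ k : ℝ → ℝ, ContinuousOn k (Icc 0 1) →
          IntervalIntegrable (fun s => k s * deriv φ s) volume 0 1 := fun k hk =>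
        ContinuousOn.intervalIntegrable ((by rwa [uIcc_of_le zero_le_one] :
          ContinuousOn k (uIcc 0 1)).mul hd)
      simp_rw [sub_mul]
      rw [intervalIntegral.integral_sub (hi u huc) (hi _ hVc),
        hvu φ hφ, integral_primitive_mul_deriv hvi hφ, sub_self]
  have huV : ∀ s ∈ Icc (0 : ℝ) 1, u s - primitive v s = c₁ := by
    have hae : (fun s => u s - primitive v s) =ᵐ[volume.restrict (Icc 0 1)] fun _ => c₁ := by
      rw [← restrict_Ioo_eq_restrict_Icc, EventuallyEq, ae_restrict_iff' measurableSet_Ioo]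
      exact hc₁
    exact Measure.eqOn_Icc_of_ae_eq volume zero_ne_one hae (huc.sub hVc) continuousOn_const
  have hc0 : c₁ = 0 := by
    rw [← huV 0 ⟨le_rfl, zero_le_one⟩, hu0, primitive]; simp
  have huv : ∀ s ∈ Icc (0 : ℝ) 1, u s = primitive v s := fun s hs =>
    sub_eq_zero.mp ((huV s hs).trans hc0)
  -- the flux plus `F` has vanishing weak derivative
  have havi : IntervalIntegrable (fun s => (γ s)⁻¹ * v s) volume 0 1 := by
    rw [intervalIntegrable_iff_integrableOn_Ioc_of_le zero_le_one] at hvi ⊢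
    refine Integrable.bdd_mul (c := M) hvi hγm.inv.aestronglyMeasurable (hγM.mono fun s hs => ?_)
    rwa [Real.norm_of_nonneg (inv_nonneg.mpr (hγ0 s).le)]
  obtain ⟨c, hc⟩ := exists_ae_eq_const_of_integral_mul_deriv
    (g := fun s => (γ s)⁻¹ * v s + primitive f s) (havi.add (hFc.intervalIntegrable _ _))
    fun φ hφ => by
      have hd : Continuous (deriv φ) := hφ.1.continuous_deriv (by exact_mod_cast le_top)
      have hi : IntervalIntegrable (fun s => primitive f s * deriv φ s) volume 0 1 :=
        (hFc.mul hd).intervalIntegrable _ _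
      simp_rw [add_mul]
      rw [intervalIntegral.integral_add (havi.mul_continuousOn hd.continuousOn) hi, hvf φ hφ,
        integral_primitive_mul_deriv hf.intervalIntegrable hφ, add_neg_cancel]
  have hFγi : ∀ y ∈ Icc (0 : ℝ) 1, IntervalIntegrable (fun s => primitive f s * γ s) volume 0 y :=
    fun y hy => (hγi.continuousOn_mul hFc.continuousOn).mono_set
      (by rw [uIcc_of_le hy.1, uIcc_of_le zero_le_one]; exact Icc_subset_Icc_right hy.2)
  have hγi' : ∀ y ∈ Icc (0 : ℝ) 1, IntervalIntegrable γ volume 0 y :=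
    fun y hy => hγi.mono_set
      (by rw [uIcc_of_le hy.1, uIcc_of_le zero_le_one]; exact Icc_subset_Icc_right hy.2)
  have hformula : ∀ y ∈ Icc (0 : ℝ) 1, u y =
      c * (∫ s in (0 : ℝ)..y, γ s) - ∫ s in (0 : ℝ)..y, primitive f s * γ s := by
    intro y hy
    rw [huv y hy, ← intervalIntegral.integral_const_mul,
      ← intervalIntegral.integral_sub ((hγi' y hy).const_mul c) (hFγi y hy)]
    refine intervalIntegral.integral_congr_ae ?_
    have hne : ∀ᵐ s : ℝ, s ≠ 1 := by simp [ae_iff]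
    filter_upwards [hc, hne] with s hs hs1 hsI
    rw [uIoc_of_le hy.1] at hsI
    have h1 := hs ⟨hsI.1, lt_of_le_of_ne (hsI.2.trans hy.2) hs1⟩
    have h2 := (hγ0 s).ne'
    rw [← h1]
    field_simp
    ring
  have hpos : 0 < ∫ s in (0 : ℝ)..1, γ s :=
    intervalIntegral.intervalIntegral_pos_of_pos hγi hγ0 zero_lt_one
  have h1 := hformula 1 ⟨zero_le_one, le_rfl⟩
  rw [hu1] at h1
  rw [hformula x ⟨hx.1.le, hx.2.le⟩]
  have hc' : c = (∫ s in (0 : ℝ)..1, primitive f s * γ s) / ∫ s in (0 : ℝ)..1, γ s := by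
    rw [eq_div_iff hpos.ne']
    linarith
  rw [hc']
  ring

lemma IsWeakSolution.indicator_right {a f u : ℝ → ℝ} (hu : IsWeakSolution a f u) :
    IsWeakSolution a ((Ioo 0 1).indicator f) u := by
  obtain ⟨huc, hu0, hu1, v, hv, hvu, hvf⟩ := hu
  refine ⟨huc, hu0, hu1, v, hv, hvu, fun φ hφ => (hvf φ hφ).trans ?_⟩
  refine intervalIntegral.integral_congr_ae ?_
  have hne : ∀ᵐ t : ℝ, t ≠ 1 := by simp [ae_iff]
  filter_upwards [hne] with t ht htI
  rw [uIoc_of_le zero_le_one] at htI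
  rw [indicator_of_mem (show t ∈ Ioo (0 : ℝ) 1 from ⟨htI.1, lt_of_le_of_ne htI.2 ht⟩)]

/-- The explicit solution formula `u_ε(x) = g(Z_ε)`. -/
lemma IsWeakSolution.apply_eq_gfun {Ω : Type*} [MeasurableSpace Ω] {β : ℤ → Ω → ℝ} {h : ℤ → ℝ}
    {f u : ℝ → ℝ} (hf : Integrable f) {N : ℕ} {ω : Ω} (hγ : ∀ n, 0 < gam h β n ω)
    (hu : IsWeakSolution (coeffA h β N ω) f u) {x : ℝ} (hx : x ∈ Ioo (0 : ℝ) 1) :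
    u x = gfun (Zvec h β f x N ω) := by
  have hinv : ∀ᵐ s ∂volume.restrict (Ioc (0 : ℝ) 1), (gam h β (⌊(N : ℝ) * s⌋ + 1) ω)⁻¹ ≤
      ∑ n ∈ Finset.Icc (1 : ℤ) (N + 1), (gam h β n ω)⁻¹ := by
    filter_upwards [ae_restrict_mem measurableSet_Ioc] with s hs
    refine Finset.single_le_sum (f := fun n => (gam h β n ω)⁻¹)
      (fun n _ => inv_nonneg.mpr (hγ n).le) (floor_add_one_mem_Icc hs)
  rw [IsWeakSolution.apply_eq (γ := fun s => gam h β (⌊(N : ℝ) * s⌋ + 1) ω)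
    (measurable_comp_floor (fun n => gam h β n ω) N) (fun s => hγ _)
    ((intervalIntegrable_iff_integrableOn_Ioc_of_le zero_le_one).mpr
      (integrableOn_comp_floor (fun n => gam h β n ω) N)) hinv hf hu hx]
  simp only [gfun, Zvec_apply, Hvec_zero, Hvec_one, Hvec_two, Hvec_three,
    integral_indicator_mul hx, one_mul]

end WeakSolution

/-! ### The cumulant generating function on the negative half-line -/

section CgfNonpos

set_option linter.unusedSectionVars false

variable {Ω : Type*} [MeasurableSpace Ω] {μ : Measure Ω} [IsProbabilityMeasure μ] {X : Ω → ℝ}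

lemma mul_integral_le_cgf (hXi : Integrable X μ) {t : ℝ} (ht : t ∈ integrableExpSet X μ) :
    t * ∫ ω, X ω ∂μ ≤ cgf X μ t := by
  have ht' : Integrable (fun ω => Real.exp (t * X ω)) μ := ht
  set m := ∫ ω, X ω ∂μ with hm
  rw [cgf, Real.le_log_iff_exp_le (mgf_pos ht'), mgf]
  have hi' : Integrable (fun ω => t * (X ω - m)) μ := (hXi.sub (integrable_const m)).const_mul t
  have hi : Integrable (fun ω => Real.exp (t * m) * (1 + t * (X ω - m))) μ :=
    ((integrable_const 1).add hi').const_mul _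
  calc Real.exp (t * m) = ∫ ω, Real.exp (t * m) * (1 + t * (X ω - m)) ∂μ := by
        rw [integral_const_mul, integral_add (integrable_const 1) hi', integral_const_mul,
          integral_sub hXi (integrable_const m), ← hm]
        simp
    _ ≤ ∫ ω, Real.exp (t * X ω) ∂μ := by
        refine integral_mono hi ht' fun ω => ?_
        have h1 := Real.add_one_le_exp (t * (X ω - m))
        calc Real.exp (t * m) * (1 + t * (X ω - m)) ≤
            Real.exp (t * m) * Real.exp (t * (X ω - m)) := by
              gcongr; linarith
          _ = Real.exp (t * X ω) := by rw [← Real.exp_add]; ring_nf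

/-- On the negative half-line the cumulant generating function is Lipschitz, with the mean as
constant: the slopes increase towards the left derivative at `0`. -/
lemma abs_cgf_sub_le (hX : Measurable X) (hpos : ∀ᵐ ω ∂μ, 0 ≤ X ω) (hXi : Integrable X μ) {a b : ℝ}
    (ha : a ≤ 0) (hb : b ≤ 0) : |cgf X μ a - cgf X μ b| ≤ (∫ ω, X ω ∂μ) * |a - b| := by
  wlog hab : a ≤ b generalizing a b
  · rw [abs_sub_comm, abs_sub_comm a]
    exact this hb ha (le_of_not_ge hab)
  have haS := mem_integrableExpSet_of_nonpos hX hpos ha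
  have hbS := mem_integrableExpSet_of_nonpos hX hpos hb
  rw [abs_sub_comm, abs_sub_comm a, abs_of_nonneg (sub_nonneg.mpr (cgf_mono hX hpos hab hbS)),
    abs_of_nonneg (sub_nonneg.mpr hab)]
  rcases eq_or_lt_of_le hb with rfl | hb'
  · have := mul_integral_le_cgf hXi haS
    rw [cgf_zero]
    linarith
  rcases eq_or_lt_of_le hab with rfl | hab'
  · simp
  have h1 := (convexOn_cgf (μ := μ) hX).slope_mono_adjacent haS zero_mem_integrableExpSet hab' hb'
  have h2 := mul_integral_le_cgf hXi hbS
  rw [cgf_zero, div_le_div_iff₀ (by linarith) (by linarith)] at h1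
  have h3 : (0 - cgf X μ b) * (b - a) ≤ (-b * ∫ ω, X ω ∂μ) * (b - a) :=
    mul_le_mul_of_nonneg_right (by linarith) (by linarith)
  have h4 : (cgf X μ b - cgf X μ a) * (-b) ≤ ((∫ ω, X ω ∂μ) * (b - a)) * (-b) := by
    calc _ = (cgf X μ b - cgf X μ a) * (0 - b) := by ring
      _ ≤ _ := h1.trans (h3.trans_eq (by ring))
  exact le_of_mul_le_mul_right h4 (by linarith)

/-- If `X` has no atom at `0`, the Laplace transform tends to `0`. -/
lemma exists_cgf_neg_le (hX : Measurable X) (hpos : ∀ᵐ ω ∂μ, 0 < X ω) (R : ℝ) :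
    ∃ n : ℕ, cgf X μ (-(n : ℝ)) ≤ -R := by
  have hnn : ∀ᵐ ω ∂μ, 0 ≤ X ω := hpos.mono fun _ h => h.le
  have hlim : Tendsto (fun n : ℕ => mgf X μ (-(n : ℝ))) atTop (𝓝 0) := by
    have h0 : (0 : ℝ) = ∫ _, (0 : ℝ) ∂μ := by simp
    rw [h0]
    refine tendsto_integral_of_dominated_convergence (fun _ => 1) (fun n => by fun_prop)
      (integrable_const 1) (fun n => ?_) ?_
    · filter_upwards [hnn] with ω hω
      rw [Real.norm_of_nonneg (Real.exp_pos _).le, Real.exp_le_one_iff, neg_mul]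
      exact neg_nonpos.mpr (mul_nonneg (Nat.cast_nonneg _) hω)
    · filter_upwards [hpos] with ω hω
      refine Real.tendsto_exp_atBot.comp ?_
      simp_rw [neg_mul]
      exact tendsto_neg_atTop_atBot.comp (tendsto_natCast_atTop_atTop.atTop_mul_const hω)
  obtain ⟨n, hn⟩ := (hlim.eventually (gt_mem_nhds (Real.exp_pos (-R)))).exists
  refine ⟨n, ?_⟩
  have hS : -(n : ℝ) ∈ integrableExpSet X μ :=
    mem_integrableExpSet_of_nonpos hX hnn (neg_nonpos.mpr (Nat.cast_nonneg n))
  rw [cgf, Real.log_le_iff_le_exp (mgf_pos hS)]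
  exact hn.le

end CgfNonpos

/-! ### The effective domain and the rate function -/

section Domain

set_option linter.unusedSectionVars false

variable {Ω : Type*} [MeasurableSpace Ω] {μ : Measure Ω} [IsProbabilityMeasure μ] {X : Ω → ℝ}
variable {E : Type*} [NormedAddCommGroup E] [InnerProductSpace ℝ E] [FiniteDimensional ℝ E]
  [MeasurableSpace E] [BorelSpace E]
variable {κ C : ℝ} {H : ℝ → E}

/-- Where all arguments are negative, the gradient is bounded by the mean. -/
lemma norm_gradient_avgLogMGF_le (hX : Measurable X) (hpos : ∀ᵐ ω ∂μ, 0 ≤ X ω)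
    (hXi : Integrable X μ) (hκ : 0 ≤ κ) (hH : Measurable H) (hC : ∀ s, ‖H s‖ ≤ C) {l : E} {δ : ℝ}
    (hδ : 0 < δ) (hl : ∀ s ∈ Ioc (0 : ℝ) 1, inner ℝ l (H s) ≤ -δ) :
    ‖gradient (fun l => (avgLogMGF μ X κ H l).toReal) l‖ ≤ (∫ ω, X ω ∂μ) * (κ * C) := by
  have hC0 : 0 ≤ C := (norm_nonneg _).trans (hC 0)
  have hm0 : 0 ≤ ∫ ω, X ω ∂μ := integral_nonneg_of_ae hpos
  have hr : 0 < δ / (C + 1) := by positivity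
  have hnp : ∀ l' ∈ Metric.ball l (δ / (C + 1)), ∀ s ∈ Ioc (0 : ℝ) 1,
      κ * inner ℝ l' (H s) ≤ 0 := by
    intro l' hl' s hs
    refine mul_nonpos_of_nonneg_of_nonpos hκ ?_
    have h1 : inner ℝ l' (H s) = inner ℝ l (H s) + inner ℝ (l' - l) (H s) := by
      rw [← inner_add_left, add_sub_cancel]
    have h2 : inner ℝ (l' - l) (H s) ≤ δ / (C + 1) * C :=
      (real_inner_le_norm _ _).trans
        (mul_le_mul (mem_ball_iff_norm.mp hl').le (hC s) (norm_nonneg _) hr.le)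
    have h3 : δ / (C + 1) * C ≤ δ := by
      rw [div_mul_eq_mul_div, div_le_iff₀ (by positivity)]
      nlinarith
    linarith [hl s hs]
  have hval : ∀ l' ∈ Metric.ball l (δ / (C + 1)), (avgLogMGF μ X κ H l').toReal =
      ∫ s in Ioc (0 : ℝ) 1, cgf X μ (κ * inner ℝ l' (H s)) := by
    intro l' hl'
    rw [avgLogMGF_eq_integral hX hpos hκ hH hC zero_mem_integrableExpSet
      ((ae_restrict_mem measurableSet_Ioc).mono fun s hs => hnp l' hl' s hs), EReal.toReal_coe]
  have hint : ∀ l' ∈ Metric.ball l (δ / (C + 1)),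
      IntegrableOn (fun s => cgf X μ (κ * inner ℝ l' (H s))) (Ioc 0 1) := by
    intro l' hl'
    refine Measure.integrableOn_of_bounded (M := (∫ ω, X ω ∂μ) * (κ * (‖l'‖ * C))) (by simp)
      ((measurable_cgf hX).comp ((measurable_const.inner hH).const_mul _)).aestronglyMeasurable ?_
    filter_upwards [ae_restrict_mem measurableSet_Ioc] with s hs
    have h1 := abs_cgf_sub_le hX hpos hXi (hnp l' hl' s hs) le_rfl
    rw [cgf_zero, sub_zero, sub_zero] at h1
    exact h1.trans (mul_le_mul_of_nonneg_left (abs_mul_inner_le hκ hC le_rfl s) hm0)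
  have hbd : ‖fderiv ℝ (fun l => (avgLogMGF μ X κ H l).toReal) l‖ ≤ (∫ ω, X ω ∂μ) * (κ * C) := by
    refine norm_fderiv_le_of_lip' ℝ (by positivity) ?_
    filter_upwards [Metric.ball_mem_nhds l hr] with l' hl'
    rw [hval l' hl', hval l (Metric.mem_ball_self hr),
      ← integral_sub (hint l' hl') (hint l (Metric.mem_ball_self hr))]
    have h1 := norm_setIntegral_le_of_norm_le_const (μ := volume) (s := Ioc (0 : ℝ) 1)
      (f := fun s => cgf X μ (κ * inner ℝ l' (H s)) - cgf X μ (κ * inner ℝ l (H s)))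
      (C := (∫ ω, X ω ∂μ) * (κ * C) * ‖l' - l‖) (by simp) fun s hs => by
        refine (abs_cgf_sub_le hX hpos hXi (hnp l' hl' s hs)
          (hnp l (Metric.mem_ball_self hr) s hs)).trans ?_
        rw [← mul_sub, ← inner_sub_left, mul_assoc, mul_assoc]
        refine mul_le_mul_of_nonneg_left ?_ hm0
        refine (abs_mul_inner_le hκ hC le_rfl s).trans_eq (by ring)
    simpa using h1
  rwa [gradient, LinearIsometryEquiv.norm_map]

/-- Steepness forces exponential moments of positive order: otherwise the effective domain would
have the origin on its boundary, and the gradient would stay bounded by the mean on approach to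
it. -/
lemma zero_mem_interior_effDomain (hX : Measurable X) (hpos : ∀ᵐ ω ∂μ, 0 ≤ X ω)
    (hXi : Integrable X μ) (hκ : 0 ≤ κ) (hH : Measurable H) (hC : ∀ s, ‖H s‖ ≤ C) {e : E}
    (he : ∀ s, inner ℝ e (H s) = 1) (hsteep : IsSteep (avgLogMGF μ X κ H)) :
    (0 : E) ∈ interior (effDomain (avgLogMGF μ X κ H)) := by
  rcases eq_or_lt_of_le hκ with rfl | hκ'
  · have : effDomain (avgLogMGF μ X 0 H : E → EReal) = univ :=
      eq_univ_of_forall fun l => by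
        rw [effDomain, mem_ofPred_eq, avgLogMGF_zero_left]; exact EReal.coe_lt_top 0
    rw [this, interior_univ]
    exact mem_univ _
  by_cases hS : ∃ t > 0, t ∈ integrableExpSet X μ
  · obtain ⟨t, ht, htS⟩ := hS
    refine (contDiffAt_avgLogMGF hX hpos hκ hH hC (l := 0) (c := 0) (ε := t / 2) (half_pos ht)
      (fun a ha => mem_integrableExpSet_of_le hX hpos ?_ htS) (by simp)).1
    rw [mem_Iio] at ha
    linarith
  push Not at hS
  by_contra hcon
  -- approach to the origin along `-e`, where all arguments are negative
  set w : ℕ → E := fun j => (-(1 / ((j : ℝ) + 1))) • e with hw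
  have hj : ∀ j : ℕ, (0 : ℝ) < 1 / ((j : ℝ) + 1) := fun j => by positivity
  have hwi : ∀ j s, inner ℝ (w j) (H s) = -(1 / ((j : ℝ) + 1)) := fun j s => by
    simp only [hw]
    rw [real_inner_smul_left, he, mul_one]
  have hwD : ∀ j, w j ∈ interior (effDomain (avgLogMGF μ X κ H)) := by
    intro j
    refine (contDiffAt_avgLogMGF hX hpos hκ hH hC (c := κ * -(1 / ((j : ℝ) + 1)))
      (ε := κ * (1 / ((j : ℝ) + 1)) / 2) (by have := hj j; positivity)
      (fun a ha => mem_integrableExpSet_of_nonpos hX hpos ?_)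
      (Eventually.of_forall fun s => by rw [hwi])).1
    rw [mem_Iio] at ha
    linarith
  have hw0 : Tendsto w atTop (𝓝 0) := by
    have h1 := (tendsto_one_div_add_atTop_nhds_zero_nat (𝕜 := ℝ)).neg.smul_const e
    rwa [neg_zero, zero_smul] at h1
  have hfr : (0 : E) ∈ frontier (interior (effDomain (avgLogMGF μ X κ H))) := by
    refine ⟨mem_closure_of_tendsto hw0 (Eventually.of_forall hwD), ?_⟩
    rwa [interior_interior]
  have hlim := hsteep 0 w hfr hwD hw0
  obtain ⟨j, hj'⟩ := (hlim.eventually (eventually_gt_atTop ((∫ ω, X ω ∂μ) * (κ * C)))).exists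
  exact absurd hj' (not_lt.mpr (norm_gradient_avgLogMGF_le hX hpos hXi hκ hH hC (hj j)
    fun s _ => (hwi j s).le))

/-- The Legendre transform is infinite at `z` if `e · z ≤ 0` for a direction `e` in which `H` is
the indicator function of a set of positive measure, and `X` has no atom at `0`. -/
lemma legendre_avgLogMGF_eq_top (hX : Measurable X) (hpos : ∀ᵐ ω ∂μ, 0 < X ω)
    (hκ : 0 < κ) (hH : Measurable H) (hC : ∀ s, ‖H s‖ ≤ C) {A : Set ℝ} (hA : MeasurableSet A)
    (hA' : 0 < volume.real (Ioc 0 1 ∩ A)) {e : E}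
    (he : ∀ s, inner ℝ e (H s) = A.indicator (fun _ => (1 : ℝ)) s) {z : E} (hz : inner ℝ e z ≤ 0) :
    legendre (avgLogMGF μ X κ H) z = ⊤ := by
  have hnn : ∀ᵐ ω ∂μ, 0 ≤ X ω := hpos.mono fun _ h => h.le
  set p := volume.real (Ioc 0 1 ∩ A) with hp
  rw [EReal.eq_top_iff_forall_lt]
  intro R
  -- the supremum is unbounded along the ray in direction `-e`
  obtain ⟨n, hn⟩ := exists_cgf_neg_le hX hpos ((|R| + 1) / p)
  have hval : avgLogMGF μ X κ H ((-(n / κ)) • e) = ((p * cgf X μ (-(n : ℝ)) : ℝ) : EReal) := by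
    have hin : ∀ s, κ * inner ℝ ((-(n / κ)) • e) (H s) =
        A.indicator (fun _ => -(n : ℝ)) s := by
      intro s
      rw [real_inner_smul_left, he]
      by_cases hs : s ∈ A
      · rw [indicator_of_mem hs, indicator_of_mem hs]; field_simp
      · rw [indicator_of_notMem hs, indicator_of_notMem hs]; simp
    rw [avgLogMGF_eq_integral hX hnn hκ.le hH hC zero_mem_integrableExpSet
      (Eventually.of_forall fun s => by
        rw [hin]
        exact indicator_nonpos (fun _ _ => neg_nonpos.mpr (Nat.cast_nonneg n)) s)]
    congr 1
    have hfun : (fun s => cgf X μ (κ * inner ℝ ((-(n / κ)) • e) (H s))) =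
        A.indicator fun _ => cgf X μ (-(n : ℝ)) := by
      funext s
      rw [hin]
      by_cases hs : s ∈ A
      · rw [indicator_of_mem hs, indicator_of_mem hs]
      · rw [indicator_of_notMem hs, indicator_of_notMem hs, cgf_zero]
    rw [hfun, setIntegral_indicator hA, setIntegral_const, smul_eq_mul]
  refine lt_of_lt_of_le ?_ (le_legendre _ ((-(n / κ)) • e) z)
  rw [hval, ← EReal.coe_sub, EReal.coe_lt_coe_iff, real_inner_smul_left]
  have h1 : 0 ≤ -(n / κ) * inner ℝ e z :=
    mul_nonneg_of_nonpos_of_nonpos (neg_nonpos.mpr (by positivity)) hz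
  have h2 := mul_le_mul_of_nonneg_left hn hA'.le
  rw [mul_neg, mul_div_cancel₀ _ hA'.ne'] at h2
  linarith [le_abs_self R]

end Domain

section Coordinates

variable {f : ℝ → ℝ} {x : ℝ}

lemma inner_single_one (i : Fin 4) (z : EuclideanSpace ℝ (Fin 4)) :
    inner ℝ (EuclideanSpace.single i (1 : ℝ)) z = z i := by
  simp [EuclideanSpace.inner_single_left]

lemma legendre_eq_top_of_nonpos {Ω : Type*} [MeasurableSpace Ω] {μ : Measure Ω}
    [IsProbabilityMeasure μ] {X : Ω → ℝ} {κ : ℝ} (hX : Measurable X) (hpos : ∀ᵐ ω ∂μ, 0 < X ω)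
    (hκ : 0 < κ) (hf : Integrable f) (hx : x ∈ Ioo (0 : ℝ) 1) {z : EuclideanSpace ℝ (Fin 4)}
    (hz : z 2 ≤ 0 ∨ z 3 ≤ 0) : legendre (avgLogMGF μ X κ (Hvec f x)) z = ⊤ := by
  rcases hz with hz | hz
  · refine legendre_avgLogMGF_eq_top hX hpos hκ (measurable_Hvec hf x) (norm_Hvec_le hf x)
      (A := Ioo 0 x) measurableSet_Ioo ?_ (e := EuclideanSpace.single 2 1)
      (fun s => by rw [inner_single_one, Hvec_two]) (by rwa [inner_single_one])
    rw [inter_eq_right.mpr (Ioo_subset_Ioc_self.trans (Ioc_subset_Ioc_right hx.2.le)),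
      Real.volume_real_Ioo_of_le hx.1.le, sub_zero]
    exact hx.1
  · refine legendre_avgLogMGF_eq_top hX hpos hκ (measurable_Hvec hf x) (norm_Hvec_le hf x)
      (A := univ) MeasurableSet.univ (by simp) (e := EuclideanSpace.single 3 1)
      (fun s => by rw [inner_single_one, Hvec_three, indicator_univ]) (by rwa [inner_single_one])

end Coordinates

end EllipticLDP

theorem theorem4 {Ω : Type*} [MeasurableSpace Ω] (μ : Measure Ω) [IsProbabilityMeasure μ]
    (h : ℤ → ℝ) (h_nonneg : ∀ k, 0 ≤ h k) (h_summable : Summable h)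
    (β : ℤ → Ω → ℝ) (β_meas : ∀ m, Measurable (β m))
    (β_nonneg : ∀ m, ∀ᵐ ω ∂μ, 0 ≤ β m ω)
    (β_indep : iIndepFun β μ) (β_ident : ∀ m, IdentDistrib (β m) (β 0) μ μ)
    (γ_def : HasContinuousLimitCharFun μ h (β 0))
    (f : ℝ → ℝ) (hf : MemLp f 2 (volume.restrict (Ioo (0 : ℝ) 1)))
    (x : ℝ) (hx : x ∈ Ioo (0 : ℝ) 1) :
    -- `Λ` is convex with values in `(-∞, ∞]` and smooth in the interior of its domain
    (∀ l, limitLambda μ h (β 0) f x l ≠ ⊥) ∧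
    IsConvexFun (limitLambda μ h (β 0) f x) ∧
    ContDiffOn ℝ ((⊤ : ℕ∞) : WithTop ℕ∞) (fun l => (limitLambda μ h (β 0) f x l).toReal)
      (interior (effDomain (limitLambda μ h (β 0) f x))) ∧
    ((∀ t : ℝ, logMGF μ (β 0) t < ⊤) →
      (∀ l, limitLambda μ h (β 0) f x l < ⊤) ∧
      ContDiff ℝ ((⊤ : ℕ∞) : WithTop ℕ∞) (fun l => (limitLambda μ h (β 0) f x l).toReal)) ∧
    -- the limiting logarithmic moment generating function of `Z_ε` is `Λ`
    (∀ l : EuclideanSpace ℝ (Fin 4),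
      Tendsto (fun N : ℕ => (((N : ℝ)⁻¹ : ℝ) : EReal) *
          logMGF μ (Zvec h β f x N) ((N : ℝ) • l)) atTop
        (𝓝 (limitLambda μ h (β 0) f x l))) ∧
    -- the large deviation principles
    (Integrable (β 0) μ → IsSteep (limitLambda μ h (β 0) f x) →
      (IsGoodRateFunction (legendre (limitLambda μ h (β 0) f x)) ∧
        IsConvexFun (legendre (limitLambda μ h (β 0) f x)) ∧
        SatisfiesLDP μ (Zvec h β f x) (legendre (limitLambda μ h (β 0) f x))) ∧
      ((∀ n : ℤ, ∀ᵐ ω ∂μ, 0 < gam h β n ω) →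
        -- `u_ε = g(Z_ε)`, for every solution `u_ε` of the boundary value problem
        ∀ u : ℕ → Ω → ℝ → ℝ,
          (∀ N : ℕ, 1 ≤ N → ∀ᵐ ω ∂μ, IsWeakSolution (coeffA h β N ω) f (u N ω)) →
          (∀ N : ℕ, 1 ≤ N → ∀ᵐ ω ∂μ, u N ω x = gfun (Zvec h β f x N ω)) ∧
          IsGoodRateFunction (rateU (limitLambda μ h (β 0) f x)) ∧
          SatisfiesLDP μ (fun N ω => u N ω x) (rateU (limitLambda μ h (β 0) f x)) ∧
          (μ {ω | β 0 ω = 0} = 0 → ∀ y : ℝ,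
            rateU (limitLambda μ h (β 0) f x) y =
              ⨅ z ∈ {z : EuclideanSpace ℝ (Fin 4) | 0 < z 2 ∧ 0 < z 3 ∧ gfun z = y},
                legendre (limitLambda μ h (β 0) f x) z))) := by
  have hfm : Integrable ((Ioo 0 1).indicator f) :=
    (integrable_indicator_iff measurableSet_Ioo).mpr (integrableOn_of_memLp_two hf)
  have hκ : 0 ≤ ∑' k, h k := tsum_nonneg h_nonneg
  have hsum := ae_summable_gam h_nonneg β_meas β_nonneg β_indep β_ident γ_def
  rw [limitLambda_indicator, ← Zvec_indicator (f := f) h β x]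
  set f₁ := (Ioo 0 1).indicator f with hf₁
  set L := avgLogMGF μ (β 0) (∑' k, h k) (Hvec f₁ x) with hL
  have hH := measurable_Hvec hfm x
  have hC := norm_Hvec_le hfm x
  -- the last component of `H` is constant
  have he : ∀ s, inner ℝ (EuclideanSpace.single (3 : Fin 4) (1 : ℝ)) (Hvec f₁ x s) = 1 := fun s => by
    rw [inner_single_one, Hvec_three]
  have hbot := avgLogMGF_ne_bot (β_meas 0) (β_nonneg 0) hκ hH hC
  have hconv := isConvexFun_avgLogMGF (β_meas 0) (β_nonneg 0) hκ hH hC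
  have hsmooth := contDiffOn_avgLogMGF (β_meas 0) (β_nonneg 0) hκ hH hC fun s _ => he s
  have hlim := tendsto_logMGF_Zvec h_nonneg h_summable β_meas β_nonneg β_indep β_ident hsum hfm x
  refine ⟨hbot, hconv, hsmooth, fun hfin => avgLogMGF_smooth_of_finite (β_meas 0) (β_nonneg 0) hκ
    hH hC hfin, hlim, fun hβi hsteep => ?_⟩
  have h0 := zero_mem_interior_effDomain (β_meas 0) (β_nonneg 0) hβi hκ hH hC he hsteep
  have hgood : IsGoodRateFunction (legendre L) :=
    isGoodRateFunction_legendre hbot avgLogMGF_zero h0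
  have hldp : SatisfiesLDP μ (Zvec h β f₁ x) (legendre L) :=
    gartnerEllis (measurable_Zvec hfm β_meas) hlim hbot hconv
      (lowerSemicontinuous_avgLogMGF (β_meas 0) (β_nonneg 0) hκ hH hC) avgLogMGF_zero h0
      (fun η hη => (hsmooth.contDiffAt (isOpen_interior.mem_nhds hη)).differentiableAt (by simp))
      hsteep
  refine ⟨⟨hgood, isConvexFun_legendre hbot, hldp⟩, fun hγ u hu => ?_⟩
  have hγ' : ∀ᵐ ω ∂μ, ∀ n, 0 < gam h β n ω := ae_all_iff.mpr hγ
  have hcone : ∀ N : ℕ, 1 ≤ N → ∀ᵐ ω ∂μ, Zvec h β f₁ x N ω ∈ zCone (∫ t, |f₁ t|) := fun N _ =>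
    hγ'.mono fun ω hω => Zvec_mem_zCone hfm x N fun n => (hω n).le
  have hug : ∀ N : ℕ, 1 ≤ N → ∀ᵐ ω ∂μ, u N ω x = gfun (Zvec h β f₁ x N ω) := fun N hN => by
    filter_upwards [hγ', hu N hN] with ω hω huω
    exact huω.indicator_right.apply_eq_gfun hfm hω hx
  have hS := isClosed_zCone (∫ t, |f₁ t|)
  have hg := continuousOn_gfun (∫ t, |f₁ t|)
  refine ⟨hug, hgood.comp_continuousOn hS (fun z hz => hldp.eq_top_of_notMem hS hcone hz) hg,
    (hldp.comp_continuousOn hS hcone hg).congr_ae fun N hN => ?_, fun hβ0 y => ?_⟩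
  · filter_upwards [hug N hN] with ω hω
    exact hω.symm
  · -- positivity of the `γ_n` excludes `h = 0`
    have hκ' : 0 < ∑' k, h k := by
      refine lt_of_le_of_ne hκ fun h0 => ?_
      have hz : ∀ k, h k = 0 := fun k =>
        congr_fun ((hasSum_zero_iff_of_nonneg h_nonneg).mp (h0 ▸ h_summable.hasSum)) k
      obtain ⟨ω, hω⟩ := hγ'.exists
      have := hω 0
      simp [gam, hz] at this
    have hpos : ∀ᵐ ω ∂μ, 0 < β 0 ω := by
      have hne : ∀ᵐ ω ∂μ, β 0 ω ≠ 0 := by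
        rw [ae_iff]
        simpa using hβ0
      filter_upwards [hne, β_nonneg 0] with ω h1 h2
      exact lt_of_le_of_ne h2 h1.symm
    refine le_antisymm (le_iInf₂ fun z hz => iInf₂_le z hz.2.2) (le_iInf₂ fun z hz => ?_)
    by_cases h23 : 0 < z 2 ∧ 0 < z 3
    · exact iInf₂_le z ⟨h23.1, h23.2, hz⟩
    · rw [not_and_or, not_lt, not_lt] at h23
      rw [hL, legendre_eq_top_of_nonpos (β_meas 0) hpos hκ' hfm hx h23]
      exact le_top
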